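/- **Setting.** Let $P$ be a nonempty convex $d$-polytope in a finite-dimensional Euclidean space $E$; "face" means nonempty face. For every proper face $F$ of $P$ fix a hyperplane $\{x : a_F\cdot x=b_F\}$ with $a_F\cdot x\le b_F$ on $P$ and equality on $P$ exactly on $F$. For $\epsilon>0$ put $c_F(x)=b_F-a_F\cdot x-\epsilon^{\dim F+1}$, so that $c_F=0$ is the supporting hyperplane at $F$ moved into $P$ to depth $\epsilon^{\dim F+1}$ (the depth being measured by $a_F$). The *complete truncation* is $T(P)=\{x\in P: c_F(x)\ge 0\text{ for all proper faces }F\text{ of }P\}$. The construction below is recursive and passes from $P$ to certain sections $K$ of $P$. For such $K$ put $T(K)=T(P)\cap K$, and for a proper face $F$ of $K$ let $c_F$ mean $c_{\hat F}$, where $\hat F$ is the smallest face of $P$ containing $F$. The *label set* $\sigma(G)$ of a face $G$ of $T(K)$ consists of the dimensions of all proper faces $F$ of $K$ with $c_F=0$ on $G$. Let $q\in E$ be the sweeping vector of $K$. For a face $G$ of $T(K)$ of positive dimension let $j=\min\{i\ge 0: i\notin\sigma(G)\}$; the *top face* $\tau(G)$ (*bottom face* $\beta(G)$) is the face of $G$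 of dimension $\dim G-1$ with label set $\sigma(G)\cup\{j\}$ that contains the vertex of $G$ maximizing (minimizing) $q\cdot x$. For a vertex $v$ of $K$ let $H_v=\{x: q\cdot x=q\cdot v\}$, $H_v^+=\{x:q\cdot x>q\cdot v\}$, $Q_v=K\cap\{c_{\{v\}}=0\}$ and $R_v=Q_v\cap H_v$. A *middle face* of $T(Q_v)$ is a face of $T(Q_v)$ that meets $H_v$. The polytope $Q_v$ is swept by the same vector $q$. On $R_v$ the function $q\cdot x$ is constant, so $R_v$ is swept by a vector of its own; this vector may be prescribed arbitrarily for each $R_v$ arising in the recursion, as a function of the sequence of faces $\hat{\{v\}}$ of $P$ belonging to the vertices $v$ chosen on the way, and independently of $\epsilon$. **Construction of $\mathcal B(K)=\bigcup_{v\in\mathrm{vert}(K)}\mathcal B_v(K)$.** If $\dim K=0$, $K=\{v\}$, then $\mathcal B_v(K)$ has the single block $\{\{v\}\}$. If $\dim K>0$, form for each face $G$ of $T(K)$ with $0\notin\sigma(G)$ the pre-block consisting of $G$, $\tau(G)$, $\beta(G)$ and of every middle face $M$ of any $T(Q_v)$, $v\in\mathrm{vert}(K)$, whose top face $\tau(M)$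 is one of these three. Then, for each vertex $v$ of $K$, $\mathcal B_v(K)$ consists of (i) for each block $B\in\mathcal B(R_v)$, the union of all pre-blocks that contain a middle face $M$ of $T(Q_v)$ with $M\cap H_v\in B$ (nothing if $R_v=\emptyset$); and (ii) for each vertex $w$ of $Q_v$ in $H_v^+$ and each block $B\in\mathcal B_w(Q_v)$, the union of all pre-blocks that contain a member of $B$. **Theorem.** Let the hyperplanes, a sweeping vector $p$ of $P$ and the sweeping vectors for the polytopes $R_v$ be given. There is $\epsilon_0>0$ such that for every $0<\epsilon<\epsilon_0$ the following holds, provided that for each polytope $K$ occurring in the recursion (including $P$) its sweeping vector takes distinct values at all vertices occurring at all stages of the truncation of $K$ (stage $k$ being $\{x\in K: c_F(x)\ge0\text{ for all proper faces }F\text{ of }K\text{ with }\dim F<k\}$). Every face of $T(P)$ of positive dimension has exactly one top face and exactly one bottom face, and $\mathcal B(P)$ is a partition of the set of nonempty faces of $T(P)$: every block is a nonempty set of nonempty faces of $T(P)$, and every nonempty face of $T(P)$ lies in exactly one block. Moreover: * **P1.** $\mathcal B(P)=\bigcup_v\mathcal B_v(P)$, where every vertex $v$ of $P$ contributes a (possibly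 empty) collection $\mathcal B_v(P)$ of blocks, and distinct vertices contribute no common block. * **P2.** If $d>0$, every face $G$ of $T(P)$ with $0\notin\sigma(G)$ is in the same block as its top face $\tau(G)$. * **P3.** Suppose $d>0$ and $H=\{x:p\cdot x=t\}$ does not meet any $T(Q_u)$, $u\in\mathrm{vert}(P)$. Then for every vertex $v$ of $P$ with $p\cdot v>t$, all faces in the blocks of $\mathcal B_v(P)$ lie in $\{x:p\cdot x>t\}$. -/

import Mathlib

namespace Sweep

noncomputable section

variable {E : Type*} [NormedAddCommGroup E] [InnerProductSpace ℝ E]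

/-- A nonempty convex polytope. -/
def IsPolytope (P : Set E) : Prop :=
  ∃ s : Finset E, s.Nonempty ∧ P = convexHull ℝ (s : Set E)

/-- `F` is a nonempty face of the polytope `K` (the improper face `K` included). -/
def IsFace (K F : Set E) : Prop :=
  IsExposed ℝ K F ∧ F.Nonempty

/-- The vertices: the points `v` for which `{v}` is a face. -/
def vert (K : Set E) : Set E := {v | IsFace K {v}}

/-- The dimension of a nonempty convex set. -/
def dim (S : Set E) : ℕ := Module.finrank ℝ (vectorSpan ℝ S)

/-- The smallest face of `P` that contains `S`. -/
def faceHull (P S : Set E) : Set E := ⋂₀ {F | IsFace P F ∧ S ⊆ F}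

/-- For every proper nonempty face `F` of `P`, the hyperplane `⟪a F, x⟫ = b F` supports `P` and
meets `P` exactly in `F`. -/
def IsSupportFamily (P : Set E) (a : Set E → E) (b : Set E → ℝ) : Prop :=
  ∀ F, IsFace P F → F ≠ P →
    (∀ x ∈ P, inner ℝ (a F) x ≤ b F) ∧ F = {x ∈ P | inner ℝ (a F) x = b F}

/-- The supporting hyperplane at `F`, pushed a depth `ε ^ (dim F + 1)` into `P`, is the zero set of
`cut a b ε F`; the part that survives the truncation of `F` is where this function is `≥ 0`. -/
def cut (a : Set E → E) (b : Set E → ℝ) (ε : ℝ) (F : Set E) (x : E) : ℝ :=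
  b F - inner ℝ (a F) x - ε ^ (dim F + 1)

/-!
Below, `P` is the polytope that is truncated and `c F = cut a b ε F` are the truncating functions.
The construction is recursive; the polytopes `K` that occur in the recursion are `P` itself and
certain sections of `P`. A proper face `F` of such a section `K` is truncated by the same
hyperplane as the face `faceHull P F` of `P` of which it is a section.
-/

/-- The complete truncation `T(K)`. For `K = P` this is `P` with all its proper faces truncated; for
a section `K` of `P` it is the truncation induced by `T(P)`, that is `T(P) ∩ K`. -/
def trunc (P : Set E) (c : Set E → E → ℝ) (K : Set E) : Set E :=
  {x ∈ K | ∀ F, IsFace P F → F ≠ P → 0 ≤ c F x}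

/-- The polytope reached from `K` after truncating its faces of dimension less than `k`. -/
def stage (P : Set E) (c : Set E → E → ℝ) (K : Set E) (k : ℕ) : Set E :=
  {x ∈ K | ∀ F, IsFace K F → F ≠ K → dim F < k → 0 ≤ c (faceHull P F) x}

/-- All vertices that occur at all stages of the truncation of `K`. -/
def stageVertices (P : Set E) (c : Set E → E → ℝ) (K : Set E) : Set E :=
  ⋃ k, vert (stage P c K k)

/-- The label set `σ(G)` of a face `G` of `T(K)`. -/
def labels (P : Set E) (c : Set E → E → ℝ) (K G : Set E) : Set ℕ :=
  {i | ∃ F, IsFace K F ∧ F ≠ K ∧ dim F = i ∧ ∀ x ∈ G, c (faceHull P F) x = 0}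

/-- `G'` is the top face `τ(G)` of the face `G` of `T(K)` for the sweeping vector `q`. -/
def IsTopFace (P : Set E) (c : Set E → E → ℝ) (K : Set E) (q : E) (G G' : Set E) : Prop :=
  IsFace (trunc P c K) G' ∧ G' ⊆ G ∧ dim G' + 1 = dim G ∧
    labels P c K G' = insert (sInf {i | i ∉ labels P c K G}) (labels P c K G) ∧
    ∃ w ∈ vert G, (∀ x ∈ vert G, inner ℝ q x ≤ inner ℝ q w) ∧ w ∈ G'

/-- `G'` is the bottom face `β(G)` of the face `G` of `T(K)` for the sweeping vector `q`. -/
def IsBottomFace (P : Set E) (c : Set E → E → ℝ) (K : Set E) (q : E) (G G' : Set E) : Prop :=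
  IsFace (trunc P c K) G' ∧ G' ⊆ G ∧ dim G' + 1 = dim G ∧
    labels P c K G' = insert (sInf {i | i ∉ labels P c K G}) (labels P c K G) ∧
    ∃ w ∈ vert G, (∀ x ∈ vert G, inner ℝ q w ≤ inner ℝ q x) ∧ w ∈ G'

/-- The hyperplane `H_v` of the sweeping family through `v`. -/
def sweepPlane (q v : E) : Set E := {x | inner ℝ q x = inner ℝ q v}

/-- `Q_v`, the face created when the vertex `v` of `K` is truncated. -/
def linkAt (P : Set E) (c : Set E → E → ℝ) (K : Set E) (v : E) : Set E :=
  {x ∈ K | c (faceHull P {v}) x = 0}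

/-- `R_v = Q_v ∩ H_v`. -/
def sliceAt (P : Set E) (c : Set E → E → ℝ) (K : Set E) (q v : E) : Set E :=
  linkAt P c K v ∩ sweepPlane q v

/-- The middle faces of `T(Q_v)`: those that meet `H_v`. -/
def IsMiddle (P : Set E) (c : Set E → E → ℝ) (K : Set E) (q v : E) (G : Set E) : Prop :=
  IsFace (trunc P c (linkAt P c K v)) G ∧ (G ∩ sweepPlane q v).Nonempty

/-- The set `{G, τ(G), β(G)}`. -/
def triple (P : Set E) (c : Set E → E → ℝ) (K : Set E) (q : E) (G : Set E) : Set (Set E) :=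
  {G' | G' = G ∨ IsTopFace P c K q G G' ∨ IsBottomFace P c K q G G'}

/-- The pre-block of `G`: `{G, τ(G), β(G)}` together with all middle faces (of the various `T(Q_v)`)
whose top face lies in that set. -/
def preBlock (P : Set E) (c : Set E → E → ℝ) (K : Set E) (q : E) (G : Set E) : Set (Set E) :=
  triple P c K q G ∪
    {M | ∃ v ∈ vert K, IsMiddle P c K q v M ∧ ∃ N ∈ triple P c K q G, IsTopFace P c K q M N}

/-- The union of all pre-blocks that contain a member of `S`; there is one pre-block for each
face `G` of `T(K)` with `0 ∉ σ(G)`. -/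
def merge (P : Set E) (c : Set E → E → ℝ) (K : Set E) (q : E) (S : Set (Set E)) : Set (Set E) :=
  {X | ∃ G, IsFace (trunc P c K) G ∧ 0 ∉ labels P c K G ∧
    (∃ M ∈ S, M ∈ preBlock P c K q G) ∧ X ∈ preBlock P c K q G}

/-- The blocks contributed by the vertex `v` of `K`, where `BQ w` are the blocks of `T(Q_v)`
contributed by the vertex `w` of `Q_v`, and `BR` are the blocks of `T(R_v)`. -/
def assemble (P : Set E) (c : Set E → E → ℝ) (K : Set E) (q v : E)
    (BQ : E → Set (Set (Set E))) (BR : Set (Set (Set E))) : Set (Set (Set E)) :=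
  {B' | ∃ B ∈ BR,
      B' = merge P c K q {M | IsMiddle P c K q v M ∧ M ∩ sweepPlane q v ∈ B}} ∪
  {B' | ∃ w ∈ vert (linkAt P c K v), inner ℝ q v < inner ℝ q w ∧
      ∃ B ∈ BQ w, B' = merge P c K q B}

/-- `blocksAt P c dir d K π q v` is the collection `𝓑_v(K)` for a `d`-polytope `K` that occurs in
the recursion and is swept by `q`. The polytope `Q_v` is again swept by `q`. On `R_v` the function
`⟪q, ·⟫` is constant, so `R_v` needs a sweeping vector of its own; it is taken from `dir`, where
`π` records the faces of `P` that contain (in their relative interior) the vertices chosen so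
far. -/
def blocksAt (P : Set E) (c : Set E → E → ℝ) (dir : List (Set E) → E) :
    ℕ → Set E → List (Set E) → E → E → Set (Set (Set E))
  | 0, _, _, _, v => {{{v}}}
  | 1, K, π, q, v =>
      assemble P c K q v
        (fun w => blocksAt P c dir 0 (linkAt P c K v) (faceHull P {v} :: π) q w)
        ∅
  | d + 2, K, π, q, v =>
      assemble P c K q v
        (fun w => blocksAt P c dir (d + 1) (linkAt P c K v) (faceHull P {v} :: π) q w)
        (⋃ w ∈ vert (sliceAt P c K q v),
          blocksAt P c dir d (sliceAt P c K q v) (faceHull P {v} :: π)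
            (dir (faceHull P {v} :: π)) w)

/-- The collection `𝓑_v(P)`. -/
def blocks (P : Set E) (c : Set E → E → ℝ) (dir : List (Set E) → E) (p v : E) :
    Set (Set (Set E)) :=
  blocksAt P c dir (dim P) P [] p v

/-- The family `𝓑(P)`. -/
def blockFamily (P : Set E) (c : Set E → E → ℝ) (dir : List (Set E) → E) (p : E) :
    Set (Set (Set E)) :=
  ⋃ v ∈ vert P, blocks P c dir p v

/-- The polytopes that occur in the recursion, with their records and sweeping vectors. -/
inductive Occurs (P : Set E) (c : Set E → E → ℝ) (dir : List (Set E) → E) (p : E) :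
    Set E → List (Set E) → E → Prop
  | base : Occurs P c dir p P [] p
  | link (K : Set E) (π : List (Set E)) (q v : E) : Occurs P c dir p K π q → v ∈ vert K →
      Occurs P c dir p (linkAt P c K v) (faceHull P {v} :: π) q
  | slice (K : Set E) (π : List (Set E)) (q v : E) : Occurs P c dir p K π q → v ∈ vert K →
      Occurs P c dir p (sliceAt P c K q v) (faceHull P {v} :: π) (dir (faceHull P {v} :: π))

/-- Each polytope in the recursion is swept by a vector that takes different values on all vertices
that occur at all stages of its truncation. -/
def IsGeneric (P : Set E) (c : Set E → E → ℝ) (dir : List (Set E) → E) (p : E) : Prop :=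
  ∀ K π q, Occurs P c dir p K π q →
    Set.InjOn (fun x => inner ℝ q x) (stageVertices P c K)

end

end Sweep

set_option linter.unusedSectionVars false

namespace Sweep

variable {E : Type*} [NormedAddCommGroup E] [InnerProductSpace ℝ E]

/-! ### Faces of convex polytopes -/

/-! For small ε the truncating hyperplanes through a common point of T(K) belong to a chain of
faces, and every chain occurs. Hence the nonempty faces of T(K) are the sets `cell P c K C` for the
chains C of proper faces, the codimension of such a cell is the size of C, and its labels are the
dimensions of the members of C (`eq_cell_of_isExtreme`, `dim_cell`, `labels_cell`). Passing to Q_v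
keeps the chains strictly above v and lowers all labels by one.

Let G be the cell of a chain C without vertices, and let its `core` be the least member of C, or K
if C is empty. The faces Q_u are ordered by q in the same way as the vertices u, so the top and the
bottom face of G arise by adding the highest and the lowest vertex of the core to C (`exists_top`,
`exists_bottom`). For any other vertex v of the core the cell of C ∪ {v} crosses H_v and is a middle
face. Its top face adds an edge of K that goes up from v, and is therefore also the bottom face of
the cell of C together with that edge. So every face has exactly one role, and the pre-blocks
partition the faces (`preBlock_unique`, `exists_preBlock`).

It remains to distribute the pre-blocks. The bottom face N of G lies in some T(Q_v), above H_v. By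
induction N is in a unique block of Q_v, contributed by a vertex w of Q_v. If w is above v, this
block is a seed for `merge`. If w is below v, then N can only be the top face of a face M that
crosses H_v (`exists_top_of_below`), and M ∩ H_v lies in a unique block of R_v. The two cases
exclude each other: by P2 for Q_v the faces M and N share a block, while the blocks of Q_v
contributed from above v stay above H_v (`exists_seed`, `seed_unique`). The induction carries
`IsPartitioned`, whose clause `bottom` also yields P3: if T(Q_v) avoids the level t below v, then by
convexity it lies above t, because a bottom face in it does, and bottom faces bound the heights on
their pre-blocks from below.

The threshold for ε is uniform because every polytope in the recursion has the form z(ε) + ε ^ k • K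
with K independent of ε, and after rescaling its i-dimensional faces are truncated at depth ε ^ (i +
m) (`Germ`, `IsGerm`). Links replace K by a vertex figure and slices by a hyperplane section, so all
hypotheses of the combinatorial part become finitely many statements about fixed polytopes. Their
analytic core is `exists_dominate`: a point on the truncating hyperplanes of two incomparable faces
would be too close to the intersection of these faces, which has been truncated more deeply
(`comparable`); and truncating hyperplanes converge to the faces they truncate (`eventually_lt`).
Genericity at the stages of truncation separates the vertices of K and of T(K), and keeps the
vertices of Q_v off H_v. -/

theorem isFace_iff {K F : Set E} : IsFace K F ↔ F.Nonempty ∧ ∃ (l : E →L[ℝ] ℝ) (β : ℝ),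
    (∀ x ∈ K, l x ≤ β) ∧ F = {x ∈ K | l x = β} := by
  constructor
  · rintro ⟨h, hne⟩
    refine ⟨hne, ?_⟩
    obtain ⟨l, hl⟩ := h hne
    obtain ⟨x₀, hx₀⟩ := hne
    have hx₁ : x₀ ∈ K ∧ ∀ y ∈ K, l y ≤ l x₀ := by rw [hl] at hx₀; exact hx₀
    refine ⟨l, l x₀, hx₁.2, ?_⟩
    rw [hl]
    ext x
    constructor
    · rintro ⟨hx, h⟩
      exact ⟨hx, le_antisymm (hx₁.2 x hx) (h x₀ hx₁.1)⟩
    · rintro ⟨hx, h⟩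
      exact ⟨hx, fun y hy => h ▸ hx₁.2 y hy⟩
  · rintro ⟨hne, l, β, hl, rfl⟩
    refine ⟨fun _ => ⟨l, ?_⟩, hne⟩
    obtain ⟨x₀, hx₀, hβ⟩ := hne
    ext x
    constructor
    · rintro ⟨hx, h⟩
      exact ⟨hx, fun y hy => h ▸ hl y hy⟩
    · rintro ⟨hx, h⟩
      exact ⟨hx, le_antisymm (hl x hx) (hβ ▸ h x₀ hx₀)⟩

theorem isFace_of_support {K : Set E} (l : E →L[ℝ] ℝ) {β : ℝ} (hl : ∀ x ∈ K, l x ≤ β)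
    {x : E} (hx : x ∈ K) (hxβ : l x = β) : IsFace K {x ∈ K | l x = β} :=
  isFace_iff.2 ⟨⟨x, hx, hxβ⟩, l, β, hl, rfl⟩

theorem IsFace.subset {K F : Set E} (h : IsFace K F) : F ⊆ K := h.1.subset

theorem IsFace.mono {K F F' : Set E} (h : IsFace K F) (hF : F ⊆ F') (hF' : F' ⊆ K) :
    IsFace F' F := ⟨h.1.mono hF' hF, h.2⟩

theorem IsFace.isExtreme {K F : Set E} (h : IsFace K F) : IsExtreme ℝ K F := h.1.isExtreme

theorem isFace_self {K : Set E} (h : K.Nonempty) : IsFace K K := ⟨IsExposed.refl _, h⟩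

theorem IsFace.inter {K F F' : Set E} (h : IsFace K F) (h' : IsFace K F')
    (hne : (F ∩ F').Nonempty) : IsFace K (F ∩ F') := ⟨h.1.inter h'.1, hne⟩

theorem mem_of_mem_vert {K : Set E} {v : E} (h : v ∈ vert K) : v ∈ K := h.subset rfl

/-! ### Faces of the convex hull of a finite set. -/

namespace IsPolytope

variable {K : Set E}

theorem nonempty (hK : IsPolytope K) : K.Nonempty := by
  obtain ⟨s, hs, rfl⟩ := hK
  exact Set.Nonempty.convexHull (by simpa using hs)

theorem convex (hK : IsPolytope K) : Convex ℝ K := by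
  obtain ⟨s, hs, rfl⟩ := hK
  exact convex_convexHull ℝ _

theorem isCompact (hK : IsPolytope K) : IsCompact K := by
  obtain ⟨s, hs, rfl⟩ := hK
  exact s.finite_toSet.isCompact_convexHull ℝ

/-- In a convex combination that attains the bound, the weighted slacks of the generators are
nonnegative and sum to zero, so only generators attaining the bound carry weight. Hence a face is
spanned by a subset of the generators, and there are finitely many faces. -/
theorem convexHull_inter_eq {s : Finset E} {l : E →L[ℝ] ℝ} {β : ℝ} (h : ∀ x ∈ s, l x ≤ β) :
    {x ∈ convexHull ℝ (s : Set E) | l x = β} = convexHull ℝ {x | x ∈ s ∧ l x = β} := by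
  classical
  apply Set.Subset.antisymm
  · rintro x ⟨hx, hxβ⟩
    obtain ⟨w, hw0, hw1, rfl⟩ := Finset.mem_convexHull'.1 hx
    have h0 : ∑ y ∈ s, w y * (β - l y) = 0 := by
      have : l (∑ y ∈ s, w y • y) = ∑ y ∈ s, w y * l y := by simp
      simp only [mul_sub, Finset.sum_sub_distrib, ← Finset.sum_mul, hw1, ← this, hxβ]
      ring
    have h1 := (Finset.sum_eq_zero_iff_of_nonneg
      (fun y hy => mul_nonneg (hw0 y hy) (sub_nonneg.2 (h y hy)))).1 h0
    have h2 : ∀ y ∈ s, w y ≠ 0 → l y = β := fun y hy hwy => by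
      rcases mul_eq_zero.1 (h1 y hy) with h | h
      · exact absurd h hwy
      · linarith
    have : ({x | x ∈ s ∧ l x = β} : Set E) = ((s.filter fun x => l x = β : Finset E) : Set E) := by
      ext; simp
    rw [this, Finset.mem_convexHull']
    refine ⟨w, fun y hy => hw0 y (Finset.mem_filter.1 hy).1, ?_, ?_⟩
    · rw [Finset.sum_filter_of_ne fun y hy => h2 y hy, hw1]
    · rw [Finset.sum_filter_of_ne]
      intro y hy hne
      exact h2 y hy (fun h => hne (by rw [h, zero_smul]))
  · refine convexHull_min ?_ ?_
    · rintro x ⟨hx, hxβ⟩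
      exact ⟨subset_convexHull ℝ _ hx, hxβ⟩
    · refine (convex_convexHull ℝ _).inter ?_
      exact (convex_singleton β).linear_preimage l.toLinearMap

theorem le_of_forall_mem {s : Finset E} {l : E →L[ℝ] ℝ} {β : ℝ} (h : ∀ x ∈ s, l x ≤ β) :
    ∀ x ∈ convexHull ℝ (s : Set E), l x ≤ β := by
  intro x hx
  have : convexHull ℝ (s : Set E) ⊆ {x | l x ≤ β} :=
    convexHull_min (fun x hx => h x hx) (convex_halfSpace_le l.isLinear β)
  exact this hx

/-- On a polytope, an affine function that is `≤ 0` on the zero set of a nonnegative affine function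
is bounded by a multiple of the latter. -/
theorem exists_dominate (hK : IsPolytope K) {l l' : E →L[ℝ] ℝ} {β β' : ℝ}
    (hl : ∀ x ∈ K, l x ≤ β) (h : ∀ x ∈ K, l x = β → l' x ≤ β') :
    ∃ M > 0, ∀ x ∈ K, l' x - β' ≤ M * (β - l x) := by
  classical
  obtain ⟨s, hs, rfl⟩ := hK
  -- The claim is affine in the point, so it need only hold at the generators. `M` bounds the ratios
  -- there; a generator of zero slack gives a meaningless ratio, but is covered by the hypothesis
  -- `h`. Replacing `M` by `max M 1` makes it positive.
  obtain ⟨M, hM⟩ := (s.image fun x => (l' x - β') / (β - l x)).exists_le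
  refine ⟨max M 1, by positivity, ?_⟩
  have : ∀ x ∈ s, (l' + max M 1 • l) x ≤ β' + max M 1 * β := by
    intro x hx
    have hxK := subset_convexHull ℝ (s : Set E) hx
    rcases (hl x hxK).lt_or_eq with h1 | h1
    · have h2 := hM _ (Finset.mem_image_of_mem _ hx)
      rw [div_le_iff₀ (by linarith)] at h2
      have h3 : M * (β - l x) ≤ max M 1 * (β - l x) :=
        mul_le_mul_of_nonneg_right (le_max_left _ _) (by linarith)
      simp only [add_apply, smul_apply, smul_eq_mul]
      linarith
    · have := h x hxK h1
      simp only [add_apply, smul_apply, smul_eq_mul, h1]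
      linarith
  intro x hx
  have := le_of_forall_mem this x hx
  simp only [add_apply, smul_apply, smul_eq_mul] at this
  linarith

theorem face (hK : IsPolytope K) {F : Set E} (hF : IsFace K F) : IsPolytope F := by
  classical
  obtain ⟨s, hs, rfl⟩ := hK
  obtain ⟨hne, l, β, hl, rfl⟩ := isFace_iff.1 hF
  rw [convexHull_inter_eq fun x hx => hl x (subset_convexHull ℝ _ hx)] at hne ⊢
  refine ⟨s.filter fun x => l x = β, ?_, by simp⟩
  have := convexHull_nonempty_iff.1 hne
  obtain ⟨x, hx⟩ := this
  exact ⟨x, by simpa using hx⟩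

theorem finite_faces (hK : IsPolytope K) : {F | IsFace K F}.Finite := by
  obtain ⟨s, hs, rfl⟩ := hK
  refine (s.finite_toSet.finite_subsets.image fun t => convexHull ℝ t).subset ?_
  intro F hF
  obtain ⟨hne, l, β, hl, rfl⟩ := isFace_iff.1 hF
  exact ⟨{x | x ∈ s ∧ l x = β}, fun x hx => hx.1,
    (convexHull_inter_eq fun x hx => hl x (subset_convexHull ℝ _ hx)).symm⟩

theorem finite_vert (hK : IsPolytope K) : (vert K).Finite :=
  Set.Finite.of_finite_image (f := fun v => ({v} : Set E))
    (hK.finite_faces.subset (by rintro _ ⟨v, hv, rfl⟩; exact hv))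
    Set.singleton_injective.injOn

/-- The functional of the smaller face is corrected by a large multiple of the functional of the
larger one. The multiple `M` from `exists_dominate` makes the sum supporting; one unit more forces
equality to occur only on `F`. -/
theorem face_trans (hK : IsPolytope K) {F N : Set E} (hF : IsFace K F) (hN : IsFace F N) :
    IsFace K N := by
  obtain ⟨-, l, β, hl, rfl⟩ := isFace_iff.1 hF
  obtain ⟨hne, l', β', hl', rfl⟩ := isFace_iff.1 hN
  obtain ⟨M, hM0, hM⟩ := hK.exists_dominate hl fun x hx h => hl' x ⟨hx, h⟩
  refine isFace_iff.2 ⟨hne, l' + (M + 1) • l, β' + (M + 1) * β, ?_, ?_⟩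
  · intro x hx
    have h1 := hM x hx
    have h2 := hl x hx
    simp only [add_apply, smul_apply, smul_eq_mul]
    linarith
  · ext x
    simp only [add_apply, smul_apply, smul_eq_mul,
      Set.mem_ofPred_eq]
    constructor
    · rintro ⟨⟨hx, h1⟩, h2⟩
      exact ⟨hx, by rw [h1, h2]⟩
    · rintro ⟨hx, h1⟩
      have h3 := hM x hx
      have h4 := hl x hx
      have h5 : l x = β := by linarith
      refine ⟨⟨hx, h5⟩, ?_⟩
      rw [h5] at h1
      linarith

end IsPolytope

/-! ### Dimension -/

theorem subsingleton_of_dim_eq_zero [FiniteDimensional ℝ E] {S : Set E} (h : dim S = 0) :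
    S.Subsingleton := by
  intro x hx y hy
  have h0 : vectorSpan ℝ S = ⊥ := Submodule.finrank_eq_zero.1 h
  have := vsub_mem_vectorSpan ℝ hx hy
  rw [h0, Submodule.mem_bot, vsub_eq_sub, sub_eq_zero] at this
  exact this

theorem dim_eq_zero_of_subsingleton {S : Set E} (h : S.Subsingleton) : dim S = 0 := by
  rw [dim, vectorSpan_of_subsingleton ℝ h, finrank_bot]

theorem dim_singleton (v : E) : dim ({v} : Set E) = 0 :=
  dim_eq_zero_of_subsingleton Set.subsingleton_singleton

theorem vectorSpan_le_ker {S : Set E} (l : E →L[ℝ] ℝ) {β : ℝ} (h : ∀ x ∈ S, l x = β) :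
    vectorSpan ℝ S ≤ LinearMap.ker l.toLinearMap := by
  rw [vectorSpan_def, Submodule.span_le]
  rintro _ ⟨x, hx, y, hy, rfl⟩
  simp [h x hx, h y hy]

theorem IsFace.dim_lt [FiniteDimensional ℝ E] {K F : Set E} (h : IsFace K F) (hne : F ≠ K) :
    dim F < dim K := by
  obtain ⟨⟨x₀, hx₀⟩, l, β, hl, rfl⟩ := isFace_iff.1 h
  refine Submodule.finrank_lt_finrank_of_lt
    (lt_of_le_of_ne (vectorSpan_mono ℝ fun x hx => hx.1) fun heq => hne ?_)
  refine Set.Subset.antisymm (fun x hx => hx.1) fun x hx => ⟨hx, ?_⟩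
  have h1 := vsub_mem_vectorSpan ℝ hx hx₀.1
  rw [← heq] at h1
  have h2 := vectorSpan_le_ker l (fun x hx => hx.2) h1
  have h3 : l (x - x₀) = 0 := h2
  rw [map_sub, hx₀.2] at h3
  linarith

theorem finrank_inf_ker [FiniteDimensional ℝ E] (W : Submodule ℝ E) (l : E →L[ℝ] ℝ) {u : E}
    (hu : u ∈ W) (hlu : l u ≠ 0) :
    Module.finrank ℝ ↥(W ⊓ LinearMap.ker l.toLinearMap) + 1 = Module.finrank ℝ W := by
  have h1 := Submodule.finrank_sup_add_finrank_inf_eq (W ⊓ LinearMap.ker l.toLinearMap)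
    (Submodule.span ℝ {u})
  have hu0 : u ≠ 0 := fun h => hlu (by simp [h])
  rw [finrank_span_singleton hu0] at h1
  have h2 : (W ⊓ LinearMap.ker l.toLinearMap) ⊓ Submodule.span ℝ {u} = ⊥ := by
    rw [eq_bot_iff]
    rintro x ⟨⟨-, h⟩, hx⟩
    obtain ⟨t, rfl⟩ := Submodule.mem_span_singleton.1 hx
    have h' : l (t • u) = 0 := h
    rw [map_smul, smul_eq_mul, mul_eq_zero] at h'
    rcases h' with h' | h'
    · simp [h']
    · exact absurd h' hlu
  have h3 : (W ⊓ LinearMap.ker l.toLinearMap) ⊔ Submodule.span ℝ {u} = W := by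
    apply le_antisymm
    · refine sup_le inf_le_left ?_
      rw [Submodule.span_singleton_le_iff_mem]
      exact hu
    · intro x hx
      have : x = (x - (l x / l u) • u) + (l x / l u) • u := by abel
      rw [this]
      refine Submodule.add_mem_sup ⟨W.sub_mem hx (W.smul_mem _ hu), ?_⟩
        (Submodule.smul_mem _ _ (Submodule.mem_span_singleton_self u))
      change l (x - (l x / l u) • u) = 0
      rw [map_sub, map_smul, smul_eq_mul, div_mul_cancel₀ _ hlu, sub_self]
  rw [h2, h3, finrank_bot] at h1
  omega

/-! ### Relative interior -/

/-- `x` is a point of `K` from which one can move inside `K` in every direction of the affine span. -/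
def IsRelInt (K : Set E) (x : E) : Prop :=
  x ∈ K ∧ ∀ u ∈ vectorSpan ℝ K, ∃ δ : ℝ, 0 < δ ∧ x + δ • u ∈ K

theorem IsRelInt.exists_le [FiniteDimensional ℝ E] {K : Set E} (hK : Convex ℝ K) {x u : E}
    (h : IsRelInt K x)
    (hu : u ∈ vectorSpan ℝ K) : ∃ δ₀ : ℝ, 0 < δ₀ ∧ ∀ δ : ℝ, 0 ≤ δ → δ ≤ δ₀ → x + δ • u ∈ K := by
  obtain ⟨δ₀, h0, h1⟩ := h.2 u hu
  refine ⟨δ₀, h0, fun δ hδ hle => ?_⟩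
  have := hK.add_smul_sub_mem h.1 h1 (t := δ / δ₀) ⟨by positivity, (div_le_one h0).2 hle⟩
  rwa [add_sub_cancel_left, smul_smul, div_mul_cancel₀ _ h0.ne'] at this

/-- Translate `K` into its direction space `V`. If the origin were not interior there, Hahn–Banach
would give a functional that is nonpositive on the translate and negative on its interior. Extended
to `E` by orthogonal projection, it supports `K` along a face through `x` that misses interior
points, contrary to assumption. -/
theorem IsPolytope.isRelInt_of_forall_face [FiniteDimensional ℝ E] {K : Set E}
    (hK : Convex ℝ K) {x : E} (hx : x ∈ K)
    (h : ∀ N, IsFace K N → x ∈ N → N = K) : IsRelInt K x := by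
  refine ⟨hx, ?_⟩
  set V := vectorSpan ℝ K with hV
  let f : V →ᵃ[ℝ] E := V.subtype.toAffineMap + AffineMap.const ℝ V x
  have hf : ∀ w : V, f w = (w : E) + x := fun w => rfl
  let S : Set V := f ⁻¹' K
  have hSc : Convex ℝ S := hK.affine_preimage f
  have h0S : (0 : V) ∈ S := by simpa [S, hf] using hx
  have himg : f '' S = K := by
    rw [Set.image_preimage_eq_iff]
    intro y hy
    exact ⟨⟨y - x, vsub_mem_vectorSpan ℝ hy hx⟩, by simp [hf]⟩
  have hspan : affineSpan ℝ S = ⊤ := by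
    rw [AffineSubspace.affineSpan_eq_top_iff_vectorSpan_eq_top_of_nonempty ℝ V V ⟨0, h0S⟩]
    have h1 := AffineMap.map_vectorSpan f (s := S)
    have h2 : f.linear = V.subtype := by
      ext w; simp [f]
    rw [himg, h2, ← hV] at h1
    apply Submodule.map_injective_of_injective V.injective_subtype
    rw [h1, Submodule.map_subtype_top]
  have hint : (interior S).Nonempty := hSc.interior_nonempty_iff_affineSpan_eq_top.2 hspan
  have h0 : (0 : V) ∈ interior S := by
    by_contra h0
    obtain ⟨g, hg⟩ := geometric_hahn_banach_open_point hSc.interior isOpen_interior h0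
    have hg' : ∀ w ∈ S, g w ≤ 0 := by
      have hcl : S ⊆ closure (interior S) := by
        rw [hSc.closure_interior_eq_closure_of_nonempty_interior hint]
        exact subset_closure
      have : closure (interior S) ⊆ {w | g w ≤ 0} :=
        closure_minimal (fun w hw => by simpa using (hg w hw).le)
          (isClosed_le g.continuous continuous_const)
      exact fun w hw => this (hcl hw)
    let l : E →L[ℝ] ℝ := g.comp V.orthogonalProjectionOnto
    have hl : ∀ y ∈ K, ∀ hy : y - x ∈ V, l y - l x = g ⟨y - x, hy⟩ := by
      intro y _ hy
      rw [← map_sub]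
      simp only [l, ContinuousLinearMap.comp_apply]
      congr 1
      exact Submodule.orthogonalProjectionOnto_mem_subspace_eq_self (⟨y - x, hy⟩ : V)
    have hmem : ∀ y ∈ K, y - x ∈ V := fun y hy => vsub_mem_vectorSpan ℝ hy hx
    have hS : ∀ y (hy : y ∈ K), (⟨y - x, hmem y hy⟩ : V) ∈ S := fun y hy => by
      simpa [S, hf] using hy
    have hN := h _ (isFace_of_support l (β := l x) (fun y hy => by
      have := hl y hy (hmem y hy)
      have := hg' _ (hS y hy)
      linarith) hx rfl) ⟨hx, rfl⟩
    obtain ⟨w, hw⟩ := hint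
    have hwS := interior_subset hw
    have hwK : (w : E) + x ∈ K := hwS
    have h1 : l ((w : E) + x) = l x := by
      have : (w : E) + x ∈ {y ∈ K | l y = l x} := by rw [hN]; exact hwK
      exact this.2
    have h2 := hl _ hwK (hmem _ hwK)
    have h3 := hg w hw
    simp only [add_sub_cancel_right, Subtype.coe_eta] at h2
    rw [map_zero] at h3
    linarith
  intro u hu
  have hcont : Filter.Tendsto (fun δ : ℝ => δ • (⟨u, hu⟩ : V)) (nhds 0) (nhds 0) := by
    have : Continuous fun δ : ℝ => δ • (⟨u, hu⟩ : V) := by fun_prop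
    simpa using this.tendsto 0
  have hev := hcont.eventually (mem_interior_iff_mem_nhds.1 h0)
  obtain ⟨δ, hδ, hpos⟩ := ((hev.filter_mono nhdsWithin_le_nhds).and
    (self_mem_nhdsWithin : Set.Ioi (0 : ℝ) ∈ nhdsWithin 0 (Set.Ioi 0))).exists
  refine ⟨δ, hpos, ?_⟩
  have : f (δ • (⟨u, hu⟩ : V)) ∈ K := hδ
  rw [hf] at this
  rw [add_comm]
  exact this

/-- The segment from a point `y` of `N` to `x` can be prolonged beyond `x` inside `N`, so `x` is
interior to a segment of `K` with endpoint `y`, and extremality puts `y` into `F`. -/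
theorem IsRelInt.subset_of_mem_face {K N : Set E} {x : E} (hx : IsRelInt N x) (hN : N ⊆ K)
    {F : Set E} (hF : IsExtreme ℝ K F) (hxF : x ∈ F) : N ⊆ F := by
  intro y hy
  obtain ⟨δ, hδ, hmem⟩ := hx.2 (x - y) (vsub_mem_vectorSpan ℝ hx.1 hy)
  refine hF.2 (hN hy) (hN hmem) hxF ⟨δ / (1 + δ), 1 / (1 + δ), by positivity, by positivity, ?_, ?_⟩
  · field_simp
    ring
  · rw [smul_add, smul_smul, smul_sub]
    have h1 : 1 / (1 + δ) * δ = δ / (1 + δ) := by ring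
    rw [h1]
    have : (δ / (1 + δ)) • y + ((1 / (1 + δ)) • x + ((δ / (1 + δ)) • x - (δ / (1 + δ)) • y)) =
      (1 / (1 + δ) + δ / (1 + δ)) • x := by rw [add_smul]; abel
    rw [this]
    have : 1 / (1 + δ) + δ / (1 + δ) = 1 := by field_simp
    rw [this, one_smul]

/-! ### Relative interior points and vertices of polytopes. -/

namespace IsPolytope

variable [FiniteDimensional ℝ E] {K : Set E}

theorem exists_face_isRelInt (hK : IsPolytope K) {x : E} (hx : x ∈ K) :
    ∃ N, IsFace K N ∧ IsRelInt N x := by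
  obtain ⟨N, ⟨hN, hxN⟩, hmin⟩ := Set.Finite.exists_minimalFor dim {N | IsFace K N ∧ x ∈ N}
    (hK.finite_faces.subset fun N h => h.1) ⟨K, isFace_self ⟨x, hx⟩, hx⟩
  refine ⟨N, hN, isRelInt_of_forall_face (hK.face hN).convex hxN fun N' hN' hxN' => ?_⟩
  by_contra hne
  have := hmin (j := N') ⟨hK.face_trans hN hN', hxN'⟩ (hN'.dim_lt hne).le
  have := hN'.dim_lt hne
  omega

/-- Among the faces that have a relative interior point take one of largest dimension. The midpoint
of its point `x` and any `y` in `K` is relatively interior to a face that contains both `x` and `y`;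
this face contains `N`, hence equals `N`. -/
theorem exists_isRelInt (hK : IsPolytope K) : ∃ x, IsRelInt K x := by
  obtain ⟨N, hN, hmax⟩ := Set.Finite.exists_maximalFor dim {N | ∃ x, IsFace K N ∧ IsRelInt N x}
    (hK.finite_faces.subset fun N ⟨_, h⟩ => h.1)
    (by
      obtain ⟨x, hx⟩ := hK.nonempty
      obtain ⟨N, h⟩ := hK.exists_face_isRelInt hx
      exact ⟨N, x, h⟩)
  obtain ⟨x, hNK, hx⟩ := hN
  suffices h : N = K from ⟨x, h ▸ hx⟩
  refine Set.Subset.antisymm hNK.subset fun y hy => ?_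
  have hm : midpoint ℝ x y ∈ K := hK.convex.midpoint_mem (hNK.subset hx.1) hy
  obtain ⟨N', hN', hx'⟩ := hK.exists_face_isRelInt hm
  have hxy : x ∈ N' ∧ y ∈ N' := by
    have hseg : midpoint ℝ x y ∈ openSegment ℝ x y :=
      ⟨1 / 2, 1 / 2, by norm_num, by norm_num, by norm_num, by
        rw [midpoint_eq_smul_add, smul_add]; norm_num⟩
    exact ⟨hN'.isExtreme.2 (hNK.subset hx.1) hy hx'.1 hseg,
      hN'.isExtreme.right_mem_of_mem_openSegment (hNK.subset hx.1) hy hx'.1 hseg⟩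
  have hsub : N ⊆ N' := hx.subset_of_mem_face hNK.subset hN'.isExtreme hxy.1
  have heq : N = N' := by
    by_contra hne
    have h1 := (hNK.mono hsub hN'.subset).dim_lt hne
    have h2 := hmax (j := N') ⟨_, hN', hx'⟩ h1.le
    omega
  exact heq ▸ hxy.2

theorem vert_nonempty (hK : IsPolytope K) : (vert K).Nonempty := by
  obtain ⟨N, hN, hmin⟩ := Set.Finite.exists_minimalFor dim {N | IsFace K N}
    hK.finite_faces ⟨K, isFace_self hK.nonempty⟩
  have hN : IsFace K N := hN
  have hsub : N.Subsingleton := by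
    intro x hx y hy
    by_contra hne
    obtain ⟨z, hz, hzmax⟩ := (hK.face hN).isCompact.exists_isMaxOn ⟨x, hx⟩
      (innerSL ℝ (x - y)).continuous.continuousOn
    have hface : IsFace N {w ∈ N | innerSL ℝ (x - y) w = innerSL ℝ (x - y) z} :=
      isFace_of_support _ (fun w hw => hzmax hw) hz rfl
    have hne' : {w ∈ N | innerSL ℝ (x - y) w = innerSL ℝ (x - y) z} ≠ N := by
      intro heq
      have h1 : x ∈ {w ∈ N | innerSL ℝ (x - y) w = innerSL ℝ (x - y) z} := by rw [heq]; exact hx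
      have h2 : y ∈ {w ∈ N | innerSL ℝ (x - y) w = innerSL ℝ (x - y) z} := by rw [heq]; exact hy
      have h3 := h1.2.trans h2.2.symm
      rw [← sub_eq_zero, ← map_sub, innerSL_apply_apply, inner_self_eq_zero, sub_eq_zero] at h3
      exact hne h3
    have h1 := hface.dim_lt hne'
    have h2 := hmin (j := _) (hK.face_trans hN hface) h1.le
    omega
  obtain ⟨v, hv⟩ := hN.2
  exact ⟨v, by rw [hsub.eq_singleton_of_mem hv] at hN; exact hN⟩

theorem exists_vert_max (hK : IsPolytope K) (l : E →L[ℝ] ℝ) :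
    ∃ v ∈ vert K, ∀ x ∈ K, l x ≤ l v := by
  obtain ⟨z, hz, hzmax⟩ := hK.isCompact.exists_isMaxOn hK.nonempty l.continuous.continuousOn
  have hface : IsFace K {w ∈ K | l w = l z} := isFace_of_support _ (fun w hw => hzmax hw) hz rfl
  obtain ⟨v, hv⟩ := (hK.face hface).vert_nonempty
  exact ⟨v, hK.face_trans hface hv, fun x hx => (mem_of_mem_vert hv).2 ▸ hzmax hx⟩

/-- On the face where `l` attains its maximum the only vertex is `v`. A further point `x` is
excluded by maximizing the functional `⟪x - v, ·⟫` on that face: the maximum is attained at a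
vertex, hence at `v`. -/
theorem lt_of_vert_max (hK : IsPolytope K) (l : E →L[ℝ] ℝ) (hl : Set.InjOn l (vert K)) {v : E}
    (hv : v ∈ vert K) (hmax : ∀ x ∈ K, l x ≤ l v) {x : E} (hx : x ∈ K) (hne : x ≠ v) :
    l x < l v := by
  refine lt_of_le_of_ne (hmax x hx) fun heq => ?_
  have hface : IsFace K {w ∈ K | l w = l v} :=
    isFace_of_support _ hmax (mem_of_mem_vert hv) rfl
  obtain ⟨w, hw, hwmax⟩ := (hK.face hface).exists_vert_max (innerSL ℝ (x - v))
  have h1 := hwmax x ⟨hx, heq⟩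
  have hwv : w = v := hl (hK.face_trans hface hw) hv (mem_of_mem_vert hw).2
  rw [hwv, ← sub_nonpos, ← map_sub, innerSL_apply_apply] at h1
  exact hne (sub_eq_zero.1 (inner_self_eq_zero.1 (le_antisymm h1 real_inner_self_nonneg)))

end IsPolytope

end Sweep

namespace Sweep

variable {E : Type*} [NormedAddCommGroup E] [InnerProductSpace ℝ E]

/-! ### The face structure of a completely truncated polytope -/

/-- The combinatorial and metric properties of a section `K` of `P` and of the truncating functions
`c` that determine the face lattice of `T(K)`: the proper faces of `K` are the sections of the faces
of `P` in `L`, the truncating hyperplanes through a common point of `T(K)` belong to a chain of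
faces, and every chain arises in this way. -/
structure IsTruncated (P : Set E) (c : Set E → E → ℝ) (K : Set E) (L : Set (Set E)) : Prop where
  poly : IsPolytope K
  finite : L.Finite
  proper_iff : ∀ N, (IsFace K N ∧ N ≠ K) ↔ ∃ F ∈ L, N = F ∩ K
  hull : ∀ F ∈ L, faceHull P (F ∩ K) = F
  trunc_eq : trunc P c K = {x ∈ K | ∀ F ∈ L, 0 ≤ c F x}
  support : ∀ F ∈ L, ∃ (l : E →L[ℝ] ℝ) (β η : ℝ), 0 < η ∧ (∀ x, c F x = β - l x - η) ∧
    ∀ x ∈ K, l x ≤ β ∧ (l x = β ↔ x ∈ F)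
  comparable : ∀ x ∈ trunc P c K, ∀ F ∈ L, ∀ F' ∈ L, c F x = 0 → c F' x = 0 → F ⊆ F' ∨ F' ⊆ F
  exists_tight : ∀ C ⊆ L, IsChain (· ⊆ ·) C → ∃ x ∈ trunc P c K, ∀ F ∈ L, c F x = 0 ↔ F ∈ C

/-- The part of `T(K)` on which the truncating functions of the faces in `C` vanish. -/
def cell (P : Set E) (c : Set E → E → ℝ) (K : Set E) (C : Set (Set E)) : Set E :=
  {x ∈ trunc P c K | ∀ F ∈ C, c F x = 0}

/-- `C` is a chain of members of `L`. -/
def IsFlag {α : Type*} (L C : Set (Set α)) : Prop := C ⊆ L ∧ IsChain (· ⊆ ·) C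

theorem IsFlag.subset {α : Type*} {L C D : Set (Set α)} (h : IsFlag L D) (hCD : C ⊆ D) :
    IsFlag L C :=
  ⟨hCD.trans h.1, h.2.mono hCD⟩

theorem faceHull_mono {P S S' : Set E} (h : S ⊆ S') : faceHull P S ⊆ faceHull P S' :=
  Set.sInter_subset_sInter fun _ hF => ⟨hF.1, h.trans hF.2⟩

theorem exists_least_of_isChain {α : Type*} {C : Set (Set α)} (hfin : C.Finite)
    (hC : IsChain (· ⊆ ·) C) (hne : C.Nonempty) : ∃ F ∈ C, ∀ F' ∈ C, F ⊆ F' := by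
  obtain ⟨F, hF⟩ := hfin.exists_minimal hne
  refine ⟨F, hF.1, fun F' hF' => ?_⟩
  rcases hC.total hF.1 hF' with h | h
  · exact h
  · exact hF.2 hF' h

theorem cell_anti {P : Set E} {c : Set E → E → ℝ} {K : Set E} {C D : Set (Set E)} (h : C ⊆ D) :
    cell P c K D ⊆ cell P c K C := fun _ hx => ⟨hx.1, fun F hF => hx.2 F (h hF)⟩

theorem cell_empty {P : Set E} {c : Set E → E → ℝ} {K : Set E} :
    cell P c K ∅ = trunc P c K := by
  ext x; simp [cell]

namespace IsTruncated

variable {P K : Set E} {c : Set E → E → ℝ} {L C D : Set (Set E)} {F F' : Set E} {x y u q : E}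

theorem isFace_inter (h : IsTruncated P c K L) (hF : F ∈ L) : IsFace K (F ∩ K) :=
  ((h.proper_iff _).2 ⟨F, hF, rfl⟩).1

theorem inter_ne (h : IsTruncated P c K L) (hF : F ∈ L) : F ∩ K ≠ K :=
  ((h.proper_iff _).2 ⟨F, hF, rfl⟩).2

theorem subset_of_inter_subset (h : IsTruncated P c K L) (hF : F ∈ L) (hF' : F' ∈ L)
    (hs : F ∩ K ⊆ F') : F ⊆ F' := by
  rw [← h.hull F hF, ← h.hull F' hF']
  exact faceHull_mono fun x hx => ⟨hs hx, hx.2⟩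

theorem exists_map_add (h : IsTruncated P c K L) (hF : F ∈ L) :
    ∃ l : E →L[ℝ] ℝ, ∀ x u, c F (x + u) = c F x - l u := by
  obtain ⟨l, β, η, -, hc, -⟩ := h.support F hF
  exact ⟨l, fun x u => by rw [hc, hc, map_add]; ring⟩

theorem map_comb (h : IsTruncated P c K L) (hF : F ∈ L) {s t : ℝ} (hst : s + t = 1) (x y : E) :
    c F (s • x + t • y) = s * c F x + t * c F y := by
  obtain ⟨l, β, η, -, hc, -⟩ := h.support F hF
  simp only [hc, map_add, map_smul, smul_eq_mul]
  have hs : s = 1 - t := by linarith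
  rw [hs]
  ring

theorem continuous (h : IsTruncated P c K L) (hF : F ∈ L) : Continuous (c F) := by
  obtain ⟨l, β, η, -, hc, -⟩ := h.support F hF
  rw [funext hc]
  fun_prop

theorem mem_trunc (h : IsTruncated P c K L) :
    x ∈ trunc P c K ↔ x ∈ K ∧ ∀ F ∈ L, 0 ≤ c F x := by
  rw [h.trunc_eq]; rfl

theorem convex_cell (h : IsTruncated P c K L) (hC : C ⊆ L) : Convex ℝ (cell P c K C) := by
  rintro x ⟨hx, hxC⟩ y ⟨hy, hyC⟩ s t hs ht hst
  rw [h.mem_trunc] at hx hy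
  refine ⟨h.mem_trunc.2 ⟨h.poly.convex hx.1 hy.1 hs ht hst, fun F hF => ?_⟩, fun F hF => ?_⟩
  · rw [h.map_comb hF hst]
    have h1 := hx.2 F hF
    have h2 := hy.2 F hF
    positivity
  · rw [h.map_comb (hC hF) hst, hxC F hF, hyC F hF]
    ring

theorem convex_trunc (h : IsTruncated P c K L) : Convex ℝ (trunc P c K) :=
  cell_empty (P := P) (c := c) (K := K) ▸ h.convex_cell (Set.empty_subset L)

theorem isCompact_cell (h : IsTruncated P c K L) (hC : C ⊆ L) : IsCompact (cell P c K C) := by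
  have : cell P c K C = K ∩ ((⋂ F ∈ L, {x | 0 ≤ c F x}) ∩ ⋂ F ∈ C, {x | c F x = 0}) := by
    ext x
    simp only [cell, h.mem_trunc, Set.mem_ofPred_eq, Set.mem_inter_iff, Set.mem_iInter]
    tauto
  rw [this]
  refine h.poly.isCompact.inter_right (IsClosed.inter ?_ ?_)
  · exact isClosed_biInter fun F hF => isClosed_le continuous_const (h.continuous hF)
  · exact isClosed_biInter fun F hF => isClosed_eq (h.continuous (hC hF)) continuous_const

theorem notMem_of_mem_trunc (h : IsTruncated P c K L) (hx : x ∈ trunc P c K) (hF : F ∈ L) :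
    x ∉ F := by
  intro hxF
  obtain ⟨l, β, η, hη, hc, hs⟩ := h.support F hF
  rw [h.mem_trunc] at hx
  have h1 := hx.2 F hF
  rw [hc, ((hs x hx.1).2).2 hxF] at h1
  linarith

theorem isRelInt_of_mem_trunc [FiniteDimensional ℝ E] (h : IsTruncated P c K L)
    (hx : x ∈ trunc P c K) : IsRelInt K x := by
  refine IsPolytope.isRelInt_of_forall_face h.poly.convex (h.mem_trunc.1 hx).1 fun N hN hxN => ?_
  by_contra hne
  obtain ⟨F, hF, rfl⟩ := (h.proper_iff N).1 ⟨hN, hne⟩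
  exact h.notMem_of_mem_trunc hx hF hxN.1

/-- Functions outside `C` are positive at `x` and survive a small step, those in `C` do not change
along `u`, and `x` is relatively interior to `K`. This turns directions into points of the cell,
both for its dimension and for its extreme subsets. -/
theorem exists_add_smul_mem_cell [FiniteDimensional ℝ E] (h : IsTruncated P c K L) (hC : C ⊆ L)
    (hx : x ∈ cell P c K C) (hxC : ∀ F ∈ L, c F x = 0 → F ∈ C) (hu : u ∈ vectorSpan ℝ K)
    (huC : ∀ F ∈ C, c F (x + u) = c F x) : ∃ δ : ℝ, 0 < δ ∧ x + δ • u ∈ cell P c K C := by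
  obtain ⟨δ₀, hδ₀, hK⟩ := (h.isRelInt_of_mem_trunc hx.1).exists_le h.poly.convex hu
  have hzero : ∀ F ∈ C, ∀ δ : ℝ, c F (x + δ • u) = 0 := by
    intro F hF δ
    obtain ⟨l, hl⟩ := h.exists_map_add (hC hF)
    have h1 := huC F hF
    rw [hl] at h1
    rw [hl, map_smul, hx.2 F hF, smul_eq_mul, show l u = 0 by linarith]
    simp
  have hev : ∀ F ∈ L, ∀ᶠ δ in nhdsWithin (0 : ℝ) (Set.Ioi 0), 0 ≤ c F (x + δ • u) := by
    intro F hF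
    by_cases hFC : F ∈ C
    · exact Filter.Eventually.of_forall fun δ => (hzero F hFC δ).ge
    · have hpos : 0 < c F x := lt_of_le_of_ne ((h.mem_trunc.1 hx.1).2 F hF)
        fun h0 => hFC (hxC F hF h0.symm)
      have hcont : Continuous fun δ : ℝ => c F (x + δ • u) :=
        (h.continuous hF).comp (by fun_prop)
      have h1 := hcont.tendsto 0
      simp only [zero_smul, add_zero] at h1
      exact ((h1.eventually (lt_mem_nhds hpos)).filter_mono nhdsWithin_le_nhds).mono
        fun _ h => h.le
  have hev' := (Filter.eventually_all_finite h.finite).2 hev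
  obtain ⟨δ, ⟨h1, h2⟩⟩ := (hev'.and (Ioc_mem_nhdsGT hδ₀)).exists
  exact ⟨δ, h2.1, h.mem_trunc.2 ⟨hK δ h2.1.le h2.2, h1⟩, fun F hF => hzero F hF δ⟩

/-- All truncating functions are nonnegative on `G`. Averaging with a point where one of them is
positive removes an accidental zero and creates no new one. -/
theorem exists_forall_tight (h : IsTruncated P c K L) {G : Set E} (hG : G ⊆ trunc P c K)
    (hGc : Convex ℝ G) (hne : G.Nonempty) :
    ∃ x ∈ G, ∀ F ∈ L, c F x = 0 → ∀ y ∈ G, c F y = 0 := by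
  suffices ∀ S ⊆ L, ∃ x ∈ G, ∀ F ∈ S, c F x = 0 → ∀ y ∈ G, c F y = 0 from this L subset_rfl
  intro S hS
  induction S, h.finite.subset hS using Set.Finite.induction_on with
  | empty => exact ⟨hne.choose, hne.choose_spec, by simp⟩
  | @insert F S _ _ ih =>
    obtain ⟨x, hx, hxS⟩ := ih ((Set.subset_insert _ _).trans hS)
    by_cases hF : c F x = 0 → ∀ y ∈ G, c F y = 0
    · exact ⟨x, hx, fun F' hF' => (Set.mem_insert_iff.1 hF').elim (fun e => e ▸ hF) (hxS F')⟩
    · push Not at hF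
      obtain ⟨-, y, hy, hne⟩ := hF
      have hst : (1 / 2 : ℝ) + 1 / 2 = 1 := by norm_num
      refine ⟨(1 / 2 : ℝ) • x + (1 / 2 : ℝ) • y,
        hGc hx hy (by norm_num) (by norm_num) hst, fun F' hF' h0 => ?_⟩
      have hF'L : F' ∈ L := hS hF'
      rw [h.map_comb hF'L hst] at h0
      have h1 := (h.mem_trunc.1 (hG hx)).2 F' hF'L
      have h2 := (h.mem_trunc.1 (hG hy)).2 F' hF'L
      rcases Set.mem_insert_iff.1 hF' with rfl | hF'
      · exact absurd (by linarith) hne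
      · exact hxS F' hF' (by linarith)

/-- Let `C` collect the functions that vanish on `G`, and let `x` be a point of `G` with no further
zeros. A segment from any `y` in the cell of `C` to `x` can be prolonged inside the cell, so
extremality puts `y` into `G`. That `C` is a chain is the field `comparable`. -/
theorem eq_cell_of_isExtreme [FiniteDimensional ℝ E] (h : IsTruncated P c K L) {G : Set E}
    (hG : IsExtreme ℝ (trunc P c K) G) (hGc : Convex ℝ G) (hne : G.Nonempty) :
    ∃ C, IsFlag L C ∧ G = cell P c K C := by
  obtain ⟨x, hx, hxt⟩ := h.exists_forall_tight hG.1 hGc hne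
  let C := {F ∈ L | ∀ y ∈ G, c F y = 0}
  have hCL : C ⊆ L := fun F hF => hF.1
  have hxC : x ∈ cell P c K C := ⟨hG.1 hx, fun F hF => hF.2 x hx⟩
  refine ⟨C, ⟨hCL, ?_⟩, Set.Subset.antisymm (fun y hy => ⟨hG.1 hy, fun F hF => hF.2 y hy⟩) ?_⟩
  · intro F hF F' hF' _
    exact h.comparable x (hG.1 hx) F hF.1 F' hF'.1 (hF.2 x hx) (hF'.2 x hx)
  · intro y hy
    have hyK := (h.mem_trunc.1 hy.1).1
    have hxK := (h.mem_trunc.1 hxC.1).1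
    obtain ⟨δ, hδ, hmem⟩ := h.exists_add_smul_mem_cell hCL hxC (u := x - y)
      (fun F hF h0 => ⟨hF, hxt F hF h0⟩) (vsub_mem_vectorSpan ℝ hxK hyK) (fun F hF => by
        obtain ⟨l, hl⟩ := h.exists_map_add (hCL hF)
        have h1 := hl y (x - y)
        rw [add_sub_cancel, hxC.2 F hF, hy.2 F hF] at h1
        rw [hl, show l (x - y) = 0 by linarith, sub_zero])
    refine hG.2 hy.1 hmem.1 hx ⟨δ / (1 + δ), 1 / (1 + δ), by positivity, by positivity, ?_, ?_⟩
    · field_simp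
      ring
    · have h1 : x + δ • (x - y) = (1 + δ) • x - δ • y := by rw [smul_sub, add_smul, one_smul]; abel
      rw [h1, smul_sub, smul_smul, smul_smul, one_div, inv_mul_cancel₀ (by positivity), one_smul,
        div_eq_inv_mul]
      abel

theorem exists_tight_cell (h : IsTruncated P c K L) (hC : IsFlag L C) :
    ∃ x ∈ cell P c K C, ∀ F ∈ L, c F x = 0 → F ∈ C := by
  obtain ⟨x, hx, ht⟩ := h.exists_tight C hC.1 hC.2
  exact ⟨x, ⟨hx, fun F hF => (ht F (hC.1 hF)).2 hF⟩, fun F hF => (ht F hF).1⟩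

theorem cell_nonempty (h : IsTruncated P c K L) (hC : IsFlag L C) : (cell P c K C).Nonempty :=
  let ⟨x, hx, _⟩ := h.exists_tight_cell hC
  ⟨x, hx⟩

theorem mem_of_forall_cell (h : IsTruncated P c K L) (hC : IsFlag L C) (hF : F ∈ L)
    (h0 : ∀ x ∈ cell P c K C, c F x = 0) : F ∈ C := by
  obtain ⟨x, hx, ht⟩ := h.exists_tight_cell hC
  exact ht F hF (h0 x hx)

theorem subset_of_cell_subset (h : IsTruncated P c K L) (hC : IsFlag L C) (hD : D ⊆ L)
    (hs : cell P c K C ⊆ cell P c K D) : D ⊆ C := fun F hF =>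
  h.mem_of_forall_cell hC (hD hF) fun _ hx => (hs hx).2 F hF

theorem cell_injective (h : IsTruncated P c K L) (hC : IsFlag L C) (hD : IsFlag L D)
    (he : cell P c K C = cell P c K D) : C = D :=
  Set.Subset.antisymm (h.subset_of_cell_subset hD hC.1 he.ge)
    (h.subset_of_cell_subset hC hD.1 he.le)

theorem isExposed_cell (h : IsTruncated P c K L) (hC : C ⊆ L) :
    IsExposed ℝ (trunc P c K) (cell P c K C) := by
  induction C, h.finite.subset hC using Set.Finite.induction_on with
  | empty => rw [cell_empty]
  | @insert F S _ _ ih =>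
    have hF : F ∈ L := hC (Set.mem_insert _ _)
    have : cell P c K (insert F S) = {x ∈ trunc P c K | c F x = 0} ∩ cell P c K S := by
      ext x
      simp only [cell, Set.mem_ofPred_eq, Set.mem_insert_iff, forall_eq_or_imp, Set.mem_inter_iff]
      tauto
    rw [this]
    refine IsExposed.inter ?_ (ih ((Set.subset_insert _ _).trans hC))
    intro hne
    obtain ⟨l, β, η, hη, hc, hs⟩ := h.support F hF
    have hset : {x ∈ trunc P c K | c F x = 0} = {x ∈ trunc P c K | l x = β - η} := by
      ext x
      simp only [Set.mem_ofPred_eq, hc]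
      constructor <;> rintro ⟨h1, h2⟩ <;> exact ⟨h1, by linarith⟩
    rw [hset] at hne ⊢
    refine (isFace_iff.2 ⟨hne, l, β - η, fun x hx => ?_, rfl⟩).1 hne
    have := (h.mem_trunc.1 hx).2 F hF
    rw [hc] at this
    linarith

theorem isFace_cell (h : IsTruncated P c K L) (hC : IsFlag L C) :
    IsFace (trunc P c K) (cell P c K C) :=
  ⟨h.isExposed_cell hC.1, h.cell_nonempty hC⟩

theorem exists_eq_cell [FiniteDimensional ℝ E] (h : IsTruncated P c K L) {G : Set E}
    (hG : IsFace (trunc P c K) G) : ∃ C, IsFlag L C ∧ G = cell P c K C :=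
  h.eq_cell_of_isExtreme hG.isExtreme (hG.1.convex h.convex_trunc) hG.2

theorem exists_eq_cell_of_isFace_cell [FiniteDimensional ℝ E] (h : IsTruncated P c K L)
    (hC : IsFlag L C) {G : Set E} (hG : IsFace (cell P c K C) G) :
    ∃ D, IsFlag L D ∧ C ⊆ D ∧ G = cell P c K D := by
  obtain ⟨D, hD, rfl⟩ := h.eq_cell_of_isExtreme ((h.isFace_cell hC).isExtreme.trans hG.isExtreme)
    (hG.1.convex (h.convex_cell hC.1)) hG.2
  exact ⟨D, hD, h.subset_of_cell_subset hD hC.1 hG.subset, rfl⟩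

/-! #### Dimensions and labels -/

section
variable [FiniteDimensional ℝ E]

theorem dim_inter_lt (h : IsTruncated P c K L) (hF : F ∈ L) (hF' : F' ∈ L) (hs : F ⊆ F')
    (hne : F ≠ F') : dim (F ∩ K) < dim (F' ∩ K) := by
  refine ((h.isFace_inter hF).mono (Set.inter_subset_inter_left K hs)
    Set.inter_subset_right).dim_lt fun he => hne ?_
  rw [← h.hull F hF, ← h.hull F' hF', he]

theorem dim_inter_lt_dim (h : IsTruncated P c K L) (hF : F ∈ L) : dim (F ∩ K) < dim K :=
  (h.isFace_inter hF).dim_lt (h.inter_ne hF)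

theorem injOn_dim (h : IsTruncated P c K L) (hC : IsFlag L C) :
    Set.InjOn (fun F => dim (F ∩ K)) C := by
  intro F hF F' hF' he
  by_contra hne
  have he : dim (F ∩ K) = dim (F' ∩ K) := he
  rcases hC.2.total hF hF' with hs | hs
  · exact (h.dim_inter_lt (hC.1 hF) (hC.1 hF') hs hne).ne he
  · exact (h.dim_inter_lt (hC.1 hF') (hC.1 hF) hs (Ne.symm hne)).ne he.symm

/-- Every member of the chain lowers the dimension by exactly one, since on the directions of `K`
the supporting functionals along a chain are independent: a vector from a point of the least member
`F₀` to a point of the next member outside `F₀` is killed by all functionals except that of `F₀`. -/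
theorem dim_cell (h : IsTruncated P c K L) (hC : IsFlag L C) :
    dim (cell P c K C) + C.ncard = dim K := by
  choose! l β η hη hc hs using h.support
  have key : ∀ n, ∀ C, IsFlag L C → C.ncard = n → ∃ W : Submodule ℝ E,
      (∀ u, u ∈ W ↔ u ∈ vectorSpan ℝ K ∧ ∀ F ∈ C, l F u = 0) ∧
      Module.finrank ℝ W + n = dim K := by
    intro n
    induction n with
    | zero =>
      intro C hC h0
      rw [Set.ncard_eq_zero (h.finite.subset hC.1)] at h0
      exact ⟨vectorSpan ℝ K, by simp [h0], rfl⟩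
    | succ n ih =>
      intro C hC hn
      have hfin := h.finite.subset hC.1
      have hne : C.Nonempty := by
        rw [← Set.ncard_pos hfin]; omega
      obtain ⟨F₀, hF₀, hmin⟩ := exists_least_of_isChain hfin hC.2 hne
      have hC' : IsFlag L (C \ {F₀}) := hC.subset Set.sdiff_subset
      obtain ⟨W, hW, hdim⟩ := ih _ hC' (by rw [Set.ncard_sdiff_singleton_of_mem hF₀]; omega)
      obtain ⟨y₀, hy₀⟩ := (h.isFace_inter (hC.1 hF₀)).2
      -- The point is taken in the next member of the chain, or anywhere in `K` if `F₀` is the only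
      -- member.
      obtain ⟨y, hyK, hy, hyF⟩ : ∃ y ∈ K, (∀ F ∈ C \ {F₀}, y ∈ F) ∧ y ∉ F₀ := by
        rcases Set.eq_empty_or_nonempty (C \ {F₀}) with he | hne'
        · have : ¬ K ⊆ F₀ := fun hsub =>
            h.inter_ne (hC.1 hF₀) (Set.inter_eq_self_of_subset_right hsub)
          obtain ⟨y, hy, hyF⟩ := Set.not_subset.1 this
          exact ⟨y, hy, by simp [he], hyF⟩
        · obtain ⟨F₁, hF₁, hmin₁⟩ := exists_least_of_isChain (h.finite.subset hC'.1) hC'.2 hne'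
          have : ¬ F₁ ∩ K ⊆ F₀ := fun hsub => hF₁.2 (Set.Subset.antisymm
            (h.subset_of_inter_subset (hC.1 hF₁.1) (hC.1 hF₀) hsub) (hmin F₁ hF₁.1))
          obtain ⟨y, hy, hyF⟩ := Set.not_subset.1 this
          exact ⟨y, hy.2, fun F hF => hmin₁ F hF hy.1, hyF⟩
      have hu : y - y₀ ∈ W := by
        refine (hW _).2 ⟨vsub_mem_vectorSpan ℝ hyK hy₀.2, fun F hF => ?_⟩
        rw [map_sub, ((hs F (hC'.1 hF) y hyK).2).2 (hy F hF),
          ((hs F (hC'.1 hF) y₀ hy₀.2).2).2 (hmin F hF.1 hy₀.1), sub_self]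
      have hlu : l F₀ (y - y₀) ≠ 0 := by
        rw [map_sub, ((hs F₀ (hC.1 hF₀) y₀ hy₀.2).2).2 hy₀.1, sub_ne_zero]
        exact fun he => hyF (((hs F₀ (hC.1 hF₀) y hyK).2).1 he)
      refine ⟨W ⊓ LinearMap.ker (l F₀).toLinearMap, fun u => ?_, ?_⟩
      · constructor
        · rintro ⟨h1, h2⟩
          refine ⟨((hW u).1 h1).1, fun F hF => ?_⟩
          by_cases he : F = F₀
          · rw [he]; exact h2
          · exact ((hW u).1 h1).2 F ⟨hF, he⟩
        · rintro ⟨h1, h2⟩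
          exact ⟨(hW u).2 ⟨h1, fun F hF => h2 F hF.1⟩, h2 F₀ hF₀⟩
      · have := finrank_inf_ker W (l F₀) hu hlu
        omega
  obtain ⟨W, hW, hdim⟩ := key _ C hC rfl
  suffices vectorSpan ℝ (cell P c K C) = W by rw [dim, this]; exact hdim
  apply le_antisymm
  · rw [vectorSpan_def, Submodule.span_le]
    rintro _ ⟨x, hx, y, hy, rfl⟩
    refine (hW _).2 ⟨vsub_mem_vectorSpan ℝ (h.mem_trunc.1 hx.1).1 (h.mem_trunc.1 hy.1).1,
      fun F hF => ?_⟩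
    have h1 := hx.2 F hF
    have h2 := hy.2 F hF
    rw [hc F (hC.1 hF)] at h1 h2
    change l F (x - y) = 0
    rw [map_sub]
    linarith
  · intro u hu
    obtain ⟨x, hx, ht⟩ := h.exists_tight_cell hC
    obtain ⟨h1, h2⟩ := (hW u).1 hu
    obtain ⟨δ, hδ, hmem⟩ := h.exists_add_smul_mem_cell hC.1 hx ht h1 fun F hF => by
      rw [hc F (hC.1 hF), hc F (hC.1 hF), map_add, h2 F hF, add_zero]
    have h3 := vsub_mem_vectorSpan ℝ hmem hx
    rw [vsub_eq_sub, add_sub_cancel_left] at h3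
    exact (Submodule.smul_mem_iff _ hδ.ne').1 h3

end

theorem labels_cell (h : IsTruncated P c K L) (hC : IsFlag L C) :
    labels P c K (cell P c K C) = (fun F => dim (F ∩ K)) '' C := by
  ext i
  constructor
  · rintro ⟨N, hN, hne, rfl, h0⟩
    obtain ⟨F, hF, rfl⟩ := (h.proper_iff N).1 ⟨hN, hne⟩
    rw [h.hull F hF] at h0
    exact ⟨F, h.mem_of_forall_cell hC hF h0, rfl⟩
  · rintro ⟨F, hF, rfl⟩
    have hFL := hC.1 hF
    refine ⟨F ∩ K, h.isFace_inter hFL, h.inter_ne hFL, rfl, fun x hx => ?_⟩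
    rw [h.hull F hFL]
    exact hx.2 F hF

/-! #### Vertices, top faces and bottom faces -/

theorem mem_vert_cell (h : IsTruncated P c K L) (hD : IsFlag L D) (hCD : C ⊆ D) {w : E}
    (hw : cell P c K D = {w}) : w ∈ vert (cell P c K C) := by
  have h1 := h.isFace_cell hD
  have h2 : cell P c K D ⊆ cell P c K C := cell_anti hCD
  have h3 := h1.mono h2 fun x hx => hx.1
  rw [hw] at h3
  exact h3

section
variable [FiniteDimensional ℝ E]

/-- Take a maximal chain above the chain of the face of maximizers. Two points of its cell could be
separated by a functional, whose maximizers would be the cell of a longer chain; so the cell is a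
point and `dim_cell` gives the number of members. -/
theorem exists_vertex_max (h : IsTruncated P c K L) (hC : IsFlag L C) (l : E →L[ℝ] ℝ) :
    ∃ D w, IsFlag L D ∧ C ⊆ D ∧ D.ncard = dim K ∧ cell P c K D = {w} ∧
      ∀ x ∈ cell P c K C, l x ≤ l w := by
  obtain ⟨z, hz, hzmax⟩ := (h.isCompact_cell hC.1).exists_isMaxOn (h.cell_nonempty hC)
    l.continuous.continuousOn
  obtain ⟨C₁, hC₁, hCC₁, he⟩ := h.exists_eq_cell_of_isFace_cell hC
    (isFace_of_support l (β := l z) (fun w hw => hzmax hw) hz rfl)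
  have hfin : {D | IsFlag L D ∧ C₁ ⊆ D}.Finite :=
    h.finite.finite_subsets.subset fun D hD => hD.1.1
  obtain ⟨D, hD⟩ := hfin.exists_maximal ⟨C₁, hC₁, subset_rfl⟩
  have hsub : (cell P c K D).Subsingleton := by
    intro x hx y hy
    by_contra hne
    obtain ⟨z', hz', hzmax'⟩ := (h.isCompact_cell hD.1.1.1).exists_isMaxOn ⟨x, hx⟩
      (innerSL ℝ (x - y)).continuous.continuousOn
    obtain ⟨D', hD', hDD', he'⟩ := h.exists_eq_cell_of_isFace_cell hD.1.1
      (isFace_of_support (innerSL ℝ (x - y)) (β := innerSL ℝ (x - y) z')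
        (fun w hw => hzmax' hw) hz' rfl)
    have hDeq : D = D' := Set.Subset.antisymm hDD' (hD.2 ⟨hD', hD.1.2.trans hDD'⟩ hDD')
    rw [← hDeq] at he'
    have h1 : innerSL ℝ (x - y) x = innerSL ℝ (x - y) z' := (he'.ge hx).2
    have h2 : innerSL ℝ (x - y) y = innerSL ℝ (x - y) z' := (he'.ge hy).2
    have h3 := h1.trans h2.symm
    rw [← sub_eq_zero, ← map_sub, innerSL_apply_apply, inner_self_eq_zero, sub_eq_zero] at h3
    exact hne h3
  obtain ⟨w, hw⟩ := h.cell_nonempty hD.1.1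
  refine ⟨D, w, hD.1.1, hCC₁.trans hD.1.2, ?_, hsub.eq_singleton_of_mem hw, fun x hx => ?_⟩
  · have h1 := h.dim_cell hD.1.1
    rw [dim_eq_zero_of_subsingleton hsub] at h1
    omega
  · have : w ∈ {x ∈ cell P c K C | l x = l z} := by
      rw [he]
      exact cell_anti hD.1.2 hw
    rw [this.2]
    exact hzmax hx

theorem exists_flag_of_mem_vert (h : IsTruncated P c K L) (hC : IsFlag L C) {w : E}
    (hw : w ∈ vert (cell P c K C)) : ∃ D, IsFlag L D ∧ C ⊆ D ∧ cell P c K D = {w} := by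
  obtain ⟨D, hD, hCD, he⟩ := h.exists_eq_cell_of_isFace_cell hC hw
  exact ⟨D, hD, hCD, he.symm⟩

theorem vert_cell_subset (h : IsTruncated P c K L) (hC : IsFlag L C) :
    vert (cell P c K C) ⊆ vert (trunc P c K) := by
  intro w hw
  obtain ⟨D, hD, hCD, he⟩ := h.exists_flag_of_mem_vert hC hw
  rw [← cell_empty (P := P)]
  exact h.mem_vert_cell hD (Set.empty_subset _) he

/-- A vertex of T(K) belongs to a complete flag, with one member of each dimension. This makes T(K)
simple, and lets a missing label be supplied from the flag of any vertex of a face. -/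
theorem image_dim_eq_of_ncard (h : IsTruncated P c K L) (hD : IsFlag L D)
    (hn : D.ncard = dim K) : (fun F => dim (F ∩ K)) '' D = Set.Iio (dim K) := by
  refine Set.eq_of_subset_of_ncard_le ?_ ?_ (Set.finite_Iio _)
  · rintro _ ⟨F, hF, rfl⟩
    exact h.dim_inter_lt_dim (hD.1 hF)
  · rw [(h.injOn_dim hD).ncard_image, hn, ← Finset.coe_Iio, Set.ncard_coe_finset]
    simp

/-- The smallest missing label of a face of positive dimension. -/
theorem sInf_labels (h : IsTruncated P c K L) (hC : IsFlag L C) (hn : C.ncard < dim K) :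
    sInf {i | i ∉ labels P c K (cell P c K C)} < dim K ∧
      sInf {i | i ∉ labels P c K (cell P c K C)} ∉ labels P c K (cell P c K C) := by
  obtain ⟨i, hi, hiC⟩ : ∃ i < dim K, i ∉ labels P c K (cell P c K C) := by
    by_contra! hcon
    rw [h.labels_cell hC] at hcon
    have h1 : Set.Iio (dim K) ⊆ (fun F => dim (F ∩ K)) '' C := fun i hi => hcon i hi
    have h2 := Set.ncard_le_ncard h1 ((h.finite.subset hC.1).image _)
    rw [(h.injOn_dim hC).ncard_image, ← Finset.coe_Iio, Set.ncard_coe_finset] at h2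
    simp at h2
    omega
  exact ⟨(Nat.sInf_le hiC).trans_lt hi, Nat.sInf_mem (s := {i | i ∉ _}) ⟨i, hiC⟩⟩

/-- The complete flag `D` of a highest vertex contains a member of the smallest missing dimension.
Adding it to `C` gives a face that still contains this vertex. -/
theorem exists_isTopFace (h : IsTruncated P c K L) (hC : IsFlag L C) (hn : C.ncard < dim K)
    (q : E) : ∃ F ∈ L, F ∉ C ∧ IsFlag L (insert F C) ∧
      dim (F ∩ K) = sInf {i | i ∉ labels P c K (cell P c K C)} ∧
      IsTopFace P c K q (cell P c K C) (cell P c K (insert F C)) ∧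
      ∃ w ∈ cell P c K (insert F C), ∀ x ∈ cell P c K C, inner ℝ q x ≤ inner ℝ q w := by
  obtain ⟨D, w, hD, hCD, hDn, hw, hmax⟩ := h.exists_vertex_max hC (innerSL ℝ q)
  obtain ⟨hj, hjC⟩ := h.sInf_labels hC hn
  obtain ⟨F, hF, hFj⟩ : ∃ F ∈ D, dim (F ∩ K) = sInf {i | i ∉ labels P c K (cell P c K C)} := by
    have := (h.image_dim_eq_of_ncard hD hDn).ge hj
    exact this
  have hFC : F ∉ C := fun hFC => by
    rw [← hFj, h.labels_cell hC] at hjC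
    exact hjC ⟨F, hFC, rfl⟩
  have hins : insert F C ⊆ D := Set.insert_subset hF hCD
  have hflag := hD.subset hins
  have hwC : w ∈ cell P c K (insert F C) := cell_anti hins (hw ▸ rfl)
  refine ⟨F, hD.1 hF, hFC, hflag, hFj, ⟨h.isFace_cell hflag, cell_anti (Set.subset_insert _ _),
    ?_, ?_, w, h.mem_vert_cell hD hCD hw, fun x hx => hmax x (mem_of_mem_vert hx), hwC⟩, w, hwC,
    hmax⟩
  · have h1 := h.dim_cell hC
    have h2 := h.dim_cell hflag
    rw [Set.ncard_insert_of_notMem hFC (h.finite.subset hC.1)] at h2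
    omega
  · rw [h.labels_cell hflag, Set.image_insert_eq, ← h.labels_cell hC]
    congr 1

/-- General position makes the highest vertex unique. Both candidates then come from subchains of
the flag of this vertex, and dimension is injective on a flag, so equal label sets give equal
chains. -/
theorem isTopFace_unique (h : IsTruncated P c K L)
    (hq : Set.InjOn (fun x => inner ℝ q x) (vert (trunc P c K))) (hC : IsFlag L C)
    {G G' : Set E} (hG : IsTopFace P c K q (cell P c K C) G)
    (hG' : IsTopFace P c K q (cell P c K C) G') : G = G' := by
  obtain ⟨hf, hs, -, hl, w, hw, hmax, hwG⟩ := hG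
  obtain ⟨hf', hs', -, hl', w', hw', hmax', hwG'⟩ := hG'
  have hww : w = w' := hq (h.vert_cell_subset hC hw) (h.vert_cell_subset hC hw')
    (le_antisymm (hmax' w hw) (hmax w' hw'))
  subst hww
  obtain ⟨C₁, hC₁, rfl⟩ := h.exists_eq_cell hf
  obtain ⟨C₂, hC₂, rfl⟩ := h.exists_eq_cell hf'
  obtain ⟨D, hD, hCD, hwD⟩ := h.exists_flag_of_mem_vert hC hw
  have h1 : C₁ ⊆ D := h.subset_of_cell_subset hD hC₁.1 (by rw [hwD]; simpa using hwG)
  have h2 : C₂ ⊆ D := h.subset_of_cell_subset hD hC₂.1 (by rw [hwD]; simpa using hwG')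
  have h3 : (fun F => dim (F ∩ K)) '' C₁ = (fun F => dim (F ∩ K)) '' C₂ := by
    rw [← h.labels_cell hC₁, ← h.labels_cell hC₂, hl, hl']
  rw [(h.injOn_dim hD).image_eq_image_iff h1 h2] at h3
  rw [h3]

end

end IsTruncated

/-- With `IsSwept.neg` and `IsLink.neg` this derives every statement about bottom faces, or about
points below a level, from its counterpart. -/
theorem isBottomFace_iff {P : Set E} {c : Set E → E → ℝ} {K : Set E} {q : E} {G G' : Set E} :
    IsBottomFace P c K q G G' ↔ IsTopFace P c K (-q) G G' := by
  simp [IsBottomFace, IsTopFace]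

end Sweep

namespace Sweep

variable {E : Type*} [NormedAddCommGroup E] [InnerProductSpace ℝ E]

/-! ### Sweeping a truncated polytope -/

/-- A truncated polytope together with a sweeping vector `q` in general position such that the
faces created by truncating two vertices are separated by `q` in the same way as these vertices. -/
structure IsSwept (P : Set E) (c : Set E → E → ℝ) (K : Set E) (L : Set (Set E)) (q : E) : Prop
    extends IsTruncated P c K L where
  injOn_vert : Set.InjOn (fun x => inner ℝ q x) (vert K)
  injOn_trunc : Set.InjOn (fun x => inner ℝ q x) (vert (trunc P c K))
  separated : ∀ v ∈ vert K, ∀ v' ∈ vert K, inner ℝ q v < inner ℝ q v' →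
    ∀ x ∈ linkAt P c K v, ∀ y ∈ linkAt P c K v', inner ℝ q x < inner ℝ q y

/-- The members of `L` that strictly contain `v`. -/
def linkFaces (P : Set E) (L : Set (Set E)) (v : E) : Set (Set E) :=
  {F ∈ L | faceHull P {v} ⊂ F}

/-- The relation between a swept polytope `K` and the face `Q_v` created by truncating the
vertex `v`. -/
structure IsLink (P : Set E) (c : Set E → E → ℝ) (K : Set E) (L : Set (Set E)) (q v : E) :
    Prop where
  swept : IsSwept P c (linkAt P c K v) (linkFaces P L v) q
  dim_link : dim (linkAt P c K v) + 1 = dim K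
  dim_face : ∀ F ∈ linkFaces P L v, dim (F ∩ linkAt P c K v) + 1 = dim (F ∩ K)
  side_pos : ∀ F ∈ linkFaces P L v, (∀ x ∈ F ∩ linkAt P c K v, inner ℝ q v < inner ℝ q x) →
    ∀ x ∈ linkAt P c K v, c F x = 0 → inner ℝ q v < inner ℝ q x
  side_neg : ∀ F ∈ linkFaces P L v, (∀ x ∈ F ∩ linkAt P c K v, inner ℝ q x < inner ℝ q v) →
    ∀ x ∈ linkAt P c K v, c F x = 0 → inner ℝ q x < inner ℝ q v
  vert_ne : ∀ w ∈ vert (linkAt P c K v), inner ℝ q w ≠ inner ℝ q v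
  radial : ∀ x ∈ K, x ≠ v → ∃ s : ℝ, 0 < s ∧ v + s • (x - v) ∈ linkAt P c K v

theorem IsSwept.neg {P : Set E} {c : Set E → E → ℝ} {K : Set E} {L : Set (Set E)} {q : E}
    (h : IsSwept P c K L q) : IsSwept P c K L (-q) where
  toIsTruncated := h.toIsTruncated
  injOn_vert := fun x hx y hy he => h.injOn_vert hx hy (by simpa using he)
  injOn_trunc := fun x hx y hy he => h.injOn_trunc hx hy (by simpa using he)
  separated := fun v hv v' hv' hlt x hx x' hx' => by
    simp only [inner_neg_left, neg_lt_neg_iff] at hlt ⊢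
    exact h.separated v' hv' v hv hlt x' hx' x hx

theorem IsLink.neg {P : Set E} {c : Set E → E → ℝ} {K : Set E} {L : Set (Set E)} {q v : E}
    (h : IsLink P c K L q v) : IsLink P c K L (-q) v where
  swept := h.swept.neg
  dim_link := h.dim_link
  dim_face := h.dim_face
  side_pos := by simpa only [inner_neg_left, neg_lt_neg_iff] using h.side_neg
  side_neg := by simpa only [inner_neg_left, neg_lt_neg_iff] using h.side_pos
  vert_ne := by simpa only [inner_neg_left, ne_eq, neg_inj] using h.vert_ne
  radial := h.radial

theorem cell_insert_subset_linkAt {P : Set E} {c : Set E → E → ℝ} {K : Set E} {v : E}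
    {C : Set (Set E)} : cell P c K (insert (faceHull P {v}) C) ⊆ linkAt P c K v :=
  fun _ hx => ⟨hx.1.1, hx.2 _ (Set.mem_insert _ _)⟩

/-- Sections are truncated by the hyperplanes of `P` itself, so a face of T(Q_v) is literally a face
of T(K) whose chain contains the face of `P` at `v`. -/
theorem cell_linkAt {P : Set E} {c : Set E → E → ℝ} {K : Set E} {v : E} {C : Set (Set E)} :
    cell P c (linkAt P c K v) C = cell P c K (insert (faceHull P {v}) C) := by
  ext x
  simp only [cell, trunc, linkAt, Set.mem_ofPred_eq, Set.mem_insert_iff, forall_eq_or_imp]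
  tauto

/-- The section by `K` of the least member of the chain `C`, or `K` if `C` is empty. -/
def core (K : Set E) (C : Set (Set E)) : Set E := K ∩ ⋂₀ C

namespace IsTruncated

variable {P K : Set E} {c : Set E → E → ℝ} {L C D : Set (Set E)} {F F' : Set E} {x y u q v w : E}

theorem isFace_core (h : IsTruncated P c K L) (hC : IsFlag L C) : IsFace K (core K C) := by
  rcases C.eq_empty_or_nonempty with rfl | hne
  · simpa [core] using isFace_self h.poly.nonempty
  · obtain ⟨F, hF, hmin⟩ := exists_least_of_isChain (h.finite.subset hC.1) hC.2 hne
    have : core K C = F ∩ K := by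
      ext x
      exact ⟨fun hx => ⟨hx.2 F hF, hx.1⟩, fun hx => ⟨hx.2, fun F' hF' => hmin F' hF' hx.1⟩⟩
    rw [this]
    exact h.isFace_inter (hC.1 hF)

theorem faceHull_mem_of_ne (h : IsTruncated P c K L) (hv : v ∈ vert K) (hne : {v} ≠ K) :
    faceHull P {v} ∈ L ∧ faceHull P {v} ∩ K = {v} := by
  obtain ⟨F, hF, he⟩ := (h.proper_iff {v}).1 ⟨hv, hne⟩
  rw [he, h.hull F hF]
  exact ⟨hF, rfl⟩

theorem faceHull_mem (h : IsTruncated P c K L) (hd : 0 < dim K) (hv : v ∈ vert K) :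
    faceHull P {v} ∈ L ∧ faceHull P {v} ∩ K = {v} := by
  refine h.faceHull_mem_of_ne hv fun he => ?_
  rw [← he, dim_singleton] at hd
  exact hd.false

theorem notMem_linkAt (h : IsTruncated P c K L) (hd : 0 < dim K) (hv : v ∈ vert K) :
    v ∉ linkAt P c K v := by
  intro hvl
  obtain ⟨hL, hi⟩ := h.faceHull_mem hd hv
  obtain ⟨l, β, η, hη, hc, hs⟩ := h.support _ hL
  have h1 := hvl.2
  have h2 : v ∈ faceHull P {v} := (hi.ge rfl).1
  rw [hc, ((hs v hvl.1).2).2 h2] at h1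
  linarith

theorem exists_vert_of_dim_eq_zero [FiniteDimensional ℝ E] (h : IsTruncated P c K L) (hF : F ∈ L)
    (h0 : dim (F ∩ K) = 0) : ∃ v ∈ vert K, F = faceHull P {v} := by
  obtain ⟨v, hv⟩ := (h.isFace_inter hF).2
  have he := (subsingleton_of_dim_eq_zero h0).eq_singleton_of_mem hv
  refine ⟨v, ?_, ?_⟩
  · have := h.isFace_inter hF
    rw [he] at this
    exact this
  · rw [← he, h.hull F hF]

theorem notMem_of_zero_notMem_labels (h : IsTruncated P c K L) (hd : 0 < dim K)
    (hC : IsFlag L C) (h0 : 0 ∉ labels P c K (cell P c K C)) (hv : v ∈ vert K) :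
    faceHull P {v} ∉ C := by
  intro hvC
  rw [h.labels_cell hC] at h0
  refine h0 ⟨_, hvC, ?_⟩
  change dim _ = 0
  rw [(h.faceHull_mem hd hv).2, dim_singleton]

theorem isFlag_insert_of_mem_core (h : IsTruncated P c K L) (hF : F ∈ L)
    (hC : IsFlag L C) (hs : F ∩ K ⊆ core K C) : IsFlag L (insert F C) := by
  refine ⟨Set.insert_subset hF hC.1, hC.2.insert fun F' hF' _ => Or.inl ?_⟩
  exact h.subset_of_inter_subset hF (hC.1 hF') fun x hx => (hs hx).2 F' hF'

theorem mem_core_of_isFlag_insert (h : IsTruncated P c K L) (hd : 0 < dim K)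
    (hv : v ∈ vert K) (hC : IsFlag L (insert (faceHull P {v}) C)) : v ∈ core K C := by
  obtain ⟨hL, hi⟩ := h.faceHull_mem hd hv
  refine ⟨mem_of_mem_vert hv, fun F hF => ?_⟩
  rcases hC.2.total (Set.mem_insert _ _) (Set.mem_insert_of_mem _ hF) with hs | hs
  · exact hs (hi.ge rfl).1
  · obtain ⟨x, hx⟩ := (h.isFace_inter (hC.1 (Set.mem_insert_of_mem _ hF))).2
    have : x = v := by
      have : x ∈ faceHull P {v} ∩ K := ⟨hs hx.1, hx.2⟩
      rw [hi] at this
      exact this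
    exact this ▸ hx.1

theorem isFlag_insert_of_mem_vert (h : IsTruncated P c K L) (hd : 0 < dim K) (hv : v ∈ vert K)
    (hC : IsFlag L C) (hvC : v ∈ core K C) : IsFlag L (insert (faceHull P {v}) C) := by
  obtain ⟨hL, hi⟩ := h.faceHull_mem hd hv
  exact h.isFlag_insert_of_mem_core hL hC (by rw [hi]; simpa using hvC)

/-- The chains of faces of `Q_v` are the chains of faces of `K` that strictly contain `v`. -/
theorem isFlag_linkFaces_iff (h : IsTruncated P c K L) (hd : 0 < dim K) (hv : v ∈ vert K)
    (hvC : faceHull P {v} ∉ C) :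
    IsFlag (linkFaces P L v) C ↔ IsFlag L (insert (faceHull P {v}) C) := by
  obtain ⟨hL, hi⟩ := h.faceHull_mem hd hv
  constructor
  · intro hC
    refine ⟨Set.insert_subset hL fun F hF => (hC.1 hF).1, hC.2.insert fun F hF _ => Or.inl ?_⟩
    exact (hC.1 hF).2.1
  · intro hC
    refine ⟨fun F hF => ⟨hC.1 (Set.mem_insert_of_mem _ hF), ?_⟩, hC.2.mono (Set.subset_insert _ _)⟩
    have hFL := hC.1 (Set.mem_insert_of_mem _ hF)
    have hvF := (h.mem_core_of_isFlag_insert hd hv hC).2 F hF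
    have hsub : faceHull P {v} ⊆ F := h.subset_of_inter_subset hL hFL (by rw [hi]; simpa using hvF)
    exact hsub.ssubset_of_ne fun he => hvC (he ▸ hF)

theorem faceHull_notMem_linkFaces (hC : C ⊆ linkFaces P L v) : faceHull P {v} ∉ C :=
  fun hvC => (hC hvC).2.ne rfl

theorem isFace_trunc_linkAt_iff [FiniteDimensional ℝ E] (h : IsTruncated P c K L) (hd : 0 < dim K)
    (hv : v ∈ vert K) (hl : IsTruncated P c (linkAt P c K v) (linkFaces P L v)) {G : Set E} :
    IsFace (trunc P c (linkAt P c K v)) G ↔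
      IsFace (trunc P c K) G ∧ G ⊆ linkAt P c K v := by
  constructor
  · intro hG
    obtain ⟨C, hC, rfl⟩ := hl.exists_eq_cell hG
    rw [cell_linkAt]
    exact ⟨h.isFace_cell ((h.isFlag_linkFaces_iff hd hv (faceHull_notMem_linkFaces hC.1)).1 hC),
      cell_insert_subset_linkAt⟩
  · rintro ⟨hG, hs⟩
    exact hG.mono (fun x hx => ⟨hs hx, (hG.subset hx).2⟩) fun x hx => ⟨hx.1.1, hx.2⟩

theorem add_smul_sub_mem_core (h : IsTruncated P c K L) (hC : C ⊆ L) (hv : v ∈ core K C)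
    (hx : x ∈ core K C) {s : ℝ} (hs : v + s • (x - v) ∈ K) : v + s • (x - v) ∈ core K C := by
  refine ⟨hs, fun F hF => ?_⟩
  obtain ⟨l, β, η, -, -, hsupp⟩ := h.support F (hC hF)
  refine ((hsupp _ hs).2).1 ?_
  have h1 := ((hsupp _ hv.1).2).2 (hv.2 F hF)
  have h2 := ((hsupp _ hx.1).2).2 (hx.2 F hF)
  rw [map_add, map_smul, map_sub, h1, h2, sub_self, smul_zero, add_zero]

end IsTruncated

/-- A point of the convex set `S` at height `t`, between points above and below. -/
theorem exists_inner_eq {S : Set E} (hS : Convex ℝ S) {q x y : E} {t : ℝ} (hx : x ∈ S)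
    (hy : y ∈ S) (hxt : inner ℝ q x < t) (hyt : t < inner ℝ q y) :
    ∃ z ∈ S, inner ℝ q z = t := by
  have := hS.isPreconnected.image (fun z => inner ℝ q z) (by fun_prop)
  obtain ⟨z, hz, he⟩ := this.Icc_subset ⟨x, hx, rfl⟩ ⟨y, hy, rfl⟩ ⟨hxt.le, hyt.le⟩
  exact ⟨z, hz, he⟩

section
variable [FiniteDimensional ℝ E] {P K : Set E} {c : Set E → E → ℝ} {L C D : Set (Set E)}
  {F F' : Set E} {x y u q v w : E}

/-! ### Highest and lowest vertices of faces, top and bottom faces. -/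

namespace IsSwept

theorem linkAt_injective (h : IsSwept P c K L q) (hv : v ∈ vert K) (hw : w ∈ vert K)
    (hx : x ∈ linkAt P c K v) (hx' : x ∈ linkAt P c K w) : v = w := by
  rcases lt_trichotomy (inner ℝ q v) (inner ℝ q w) with hlt | he | hlt
  · exact absurd (h.separated v hv w hw hlt x hx x hx') (lt_irrefl _)
  · exact h.injOn_vert hv hw he
  · exact absurd (h.separated w hw v hv hlt x hx' x hx) (lt_irrefl _)

/-- The top face of a face of `T(K)` without label `0` lies in the face created by truncating the
highest vertex. -/
theorem exists_top (h : IsSwept P c K L q) (hd : 0 < dim K) (hC : IsFlag L C)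
    (h0 : 0 ∉ labels P c K (cell P c K C)) : ∃ v ∈ vert K, v ∈ core K C ∧
      (∀ x ∈ core K C, x ≠ v → inner ℝ q x < inner ℝ q v) ∧
      IsFlag L (insert (faceHull P {v}) C) ∧
      IsTopFace P c K q (cell P c K C) (cell P c K (insert (faceHull P {v}) C)) := by
  have hT := h.toIsTruncated
  have hcore := hT.isFace_core hC
  have hpoly := hT.poly.face hcore
  obtain ⟨v, hv, hvmax⟩ := hpoly.exists_vert_max (innerSL ℝ q)
  have hvK : v ∈ vert K := hT.poly.face_trans hcore hv
  have hvC := mem_of_mem_vert hv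
  have hflag := hT.isFlag_insert_of_mem_vert hd hvK hC hvC
  have hn : C.ncard < dim K := by
    have h1 := hT.dim_cell hC
    refine lt_of_le_of_ne (by omega) fun he => h0 ?_
    rw [hT.labels_cell hC, hT.image_dim_eq_of_ncard hC he]
    exact hd
  obtain ⟨F, hF, hFC, hFflag, hFdim, htop, w, hw, hwmax⟩ := hT.exists_isTopFace hC hn q
  rw [Nat.sInf_eq_zero.2 (Or.inl h0)] at hFdim
  obtain ⟨v', hv', rfl⟩ := hT.exists_vert_of_dim_eq_zero hF hFdim
  have hstrict : ∀ x ∈ core K C, x ≠ v → inner ℝ q x < inner ℝ q v := fun x hx hne =>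
    hpoly.lt_of_vert_max (innerSL ℝ q)
      (h.injOn_vert.mono fun w hw => hT.poly.face_trans hcore hw) hv hvmax hx hne
  -- If the added vertex were not the highest vertex of the core, the field `separated` would put
  -- the truncation face at `v'` strictly below the one at `v`. The latter contains points of the
  -- cell, against the maximality of `w`.
  have hvv : v' = v := by
    by_contra hne
    have h1 := hstrict v' (hT.mem_core_of_isFlag_insert hd hv' hFflag) hne
    obtain ⟨y, hy⟩ := hT.cell_nonempty hflag
    have h2 := h.separated v' hv' v hvK h1 w (cell_insert_subset_linkAt hw) y
      (cell_insert_subset_linkAt hy)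
    have h3 := hwmax y (cell_anti (Set.subset_insert _ _) hy)
    linarith
  subst hvv
  exact ⟨v', hvK, hvC, hstrict, hflag, htop⟩

theorem exists_bottom (h : IsSwept P c K L q) (hd : 0 < dim K) (hC : IsFlag L C)
    (h0 : 0 ∉ labels P c K (cell P c K C)) : ∃ v ∈ vert K, v ∈ core K C ∧
      (∀ x ∈ core K C, x ≠ v → inner ℝ q v < inner ℝ q x) ∧
      IsFlag L (insert (faceHull P {v}) C) ∧
      IsBottomFace P c K q (cell P c K C) (cell P c K (insert (faceHull P {v}) C)) := by
  simpa only [isBottomFace_iff, inner_neg_left, neg_lt_neg_iff] using h.neg.exists_top hd hC h0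

theorem isTopFace_unique (h : IsSwept P c K L q) {G G₁ G₂ : Set E} (hG : IsFace (trunc P c K) G)
    (h₁ : IsTopFace P c K q G G₁) (h₂ : IsTopFace P c K q G G₂) : G₁ = G₂ := by
  obtain ⟨C, hC, rfl⟩ := h.exists_eq_cell hG
  exact h.toIsTruncated.isTopFace_unique h.injOn_trunc hC h₁ h₂

theorem isBottomFace_unique (h : IsSwept P c K L q) {G G₁ G₂ : Set E}
    (hG : IsFace (trunc P c K) G)
    (h₁ : IsBottomFace P c K q G G₁) (h₂ : IsBottomFace P c K q G G₂) : G₁ = G₂ :=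
  h.neg.isTopFace_unique hG (isBottomFace_iff.1 h₁) (isBottomFace_iff.1 h₂)

/-- A vertex of a face of `K` is its lowest vertex, its highest vertex, or neither. -/
theorem core_trichotomy (h : IsSwept P c K L q) (hC : IsFlag L C) (hv : v ∈ vert K)
    (hvC : v ∈ core K C) :
    (∀ x ∈ core K C, x ≠ v → inner ℝ q v < inner ℝ q x) ∨
    (∀ x ∈ core K C, x ≠ v → inner ℝ q x < inner ℝ q v) ∨
    (∃ x ∈ core K C, inner ℝ q x < inner ℝ q v) ∧ ∃ x ∈ core K C, inner ℝ q v < inner ℝ q x := by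
  have hcore := h.toIsTruncated.isFace_core hC
  have hpoly := h.poly.face hcore
  have hv' : v ∈ vert (core K C) := hv.mono (by simpa using hvC) hcore.subset
  have hsub : vert (core K C) ⊆ vert K := fun w hw => h.poly.face_trans hcore hw
  by_cases h1 : ∃ x ∈ core K C, inner ℝ q x < inner ℝ q v
  · by_cases h2 : ∃ x ∈ core K C, inner ℝ q v < inner ℝ q x
    · exact Or.inr (Or.inr ⟨h1, h2⟩)
    · push Not at h2
      exact Or.inr (Or.inl fun x hx hne =>
        hpoly.lt_of_vert_max (innerSL ℝ q) (h.injOn_vert.mono hsub) hv' h2 hx hne)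
  · push Not at h1
    refine Or.inl fun x hx hne => ?_
    have := hpoly.lt_of_vert_max (innerSL ℝ (-q)) (h.neg.injOn_vert.mono hsub) hv'
      (fun x hx => by simpa using h1 x hx) hx hne
    simpa using this

end IsSwept

/-! ### Position of the faces of T(Q_v) relative to H_v. -/

namespace IsLink

/-- If `v` is the lowest vertex of the least face of `C`, the corresponding face of `T(Q_v)` lies
above `v`. -/
theorem above (hl : IsLink P c K L q v) (h : IsTruncated P c K L) (hd : 0 < dim K)
    (hv : v ∈ vert K) (hC : IsFlag L (insert (faceHull P {v}) C)) (hvC : faceHull P {v} ∉ C)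
    (hlow : ∀ x ∈ core K C, x ≠ v → inner ℝ q v < inner ℝ q x) :
    ∀ x ∈ cell P c K (insert (faceHull P {v}) C), inner ℝ q v < inner ℝ q x := by
  intro x hx
  have hxl := cell_insert_subset_linkAt hx
  have hnot := h.notMem_linkAt hd hv
  rcases C.eq_empty_or_nonempty with rfl | hne
  · exact hlow x (by simpa [core] using hxl.1) (fun he => hnot (he ▸ hxl))
  · have hCl := (h.isFlag_linkFaces_iff hd hv hvC).2 hC
    obtain ⟨F, hF, hmin⟩ := exists_least_of_isChain (h.finite.subset
      fun F hF => hC.1 (Set.mem_insert_of_mem _ hF)) (hCl.2) hne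
    -- The section of the least member `F` by Q_v lies in the core and avoids `v`, hence is above
    -- `v`; `side_pos` carries this over to the hyperplane that truncates `F`.
    refine hl.side_pos F (hCl.1 hF) (fun y hy => ?_) x hxl (hx.2 F (Set.mem_insert_of_mem _ hF))
    exact hlow y ⟨hy.2.1, fun F' hF' => hmin F' hF' hy.1⟩ (fun he => hnot (he ▸ hy.2))

theorem below (hl : IsLink P c K L q v) (h : IsTruncated P c K L) (hd : 0 < dim K)
    (hv : v ∈ vert K) (hC : IsFlag L (insert (faceHull P {v}) C)) (hvC : faceHull P {v} ∉ C)
    (hhigh : ∀ x ∈ core K C, x ≠ v → inner ℝ q x < inner ℝ q v) :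
    ∀ x ∈ cell P c K (insert (faceHull P {v}) C), inner ℝ q x < inner ℝ q v := by
  have := hl.neg.above h hd hv hC hvC (by simpa using hhigh)
  simpa using this

/-- A face of `K` that reaches above its vertex `v` has an edge at `v` that goes up. -/
theorem exists_above (hl : IsLink P c K L q v) (h : IsTruncated P c K L) (hd : 0 < dim K)
    (hv : v ∈ vert K) (hC : IsFlag L (insert (faceHull P {v}) C))
    (hx : ∃ x ∈ core K C, inner ℝ q v < inner ℝ q x) :
    ∃ x ∈ core (linkAt P c K v) C, inner ℝ q v < inner ℝ q x := by
  obtain ⟨x, hx, hlt⟩ := hx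
  obtain ⟨s, hs, hmem⟩ := hl.radial x hx.1 (by rintro rfl; exact hlt.false)
  have := h.add_smul_sub_mem_core (fun F hF => hC.1 (Set.mem_insert_of_mem _ hF))
    (h.mem_core_of_isFlag_insert hd hv hC) hx hmem.1
  refine ⟨_, ⟨hmem, this.2⟩, ?_⟩
  rw [inner_add_right, inner_smul_right, inner_sub_right]
  nlinarith

/-- Truncating the highest vertex `w` of the section leaves a face of the cell that is still above
`v`. The point below `v` ensures that `w` is not all of Q_v, so that it is a proper face and does
get truncated. -/
theorem exists_mem_cell_above (hl : IsLink P c K L q v)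
    (hC : IsFlag (linkFaces P L v) C) (hx : ∃ x ∈ core (linkAt P c K v) C, inner ℝ q v < inner ℝ q x)
    (hy : ∃ y ∈ core (linkAt P c K v) C, inner ℝ q y < inner ℝ q v) :
    ∃ x ∈ cell P c K (insert (faceHull P {v}) C), inner ℝ q v < inner ℝ q x := by
  obtain ⟨x, hx, hxlt⟩ := hx
  obtain ⟨y, hy, hylt⟩ := hy
  have hT := hl.swept.toIsTruncated
  have hcore := hT.isFace_core hC
  obtain ⟨w, hw, hwmax⟩ := (hT.poly.face hcore).exists_vert_max (innerSL ℝ q)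
  have hwlt : inner ℝ q v < inner ℝ q w := hxlt.trans_le (hwmax x hx)
  have hwK : w ∈ vert (linkAt P c K v) := hT.poly.face_trans hcore hw
  obtain ⟨hF, hFi⟩ := hT.faceHull_mem_of_ne hwK (fun he => by
    have : y ∈ ({w} : Set E) := by rw [he]; exact hy.1
    rw [this] at hylt
    linarith)
  have hflag := hT.isFlag_insert_of_mem_core hF hC (by
    rw [hFi]; simpa using mem_of_mem_vert hw)
  obtain ⟨z, hz⟩ := hT.cell_nonempty hflag
  refine ⟨z, ?_, hl.side_pos _ hF (by rw [hFi]; simpa using hwlt) z hz.1.1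
    (hz.2 _ (Set.mem_insert _ _))⟩
  rw [← cell_linkAt]
  exact cell_anti (Set.subset_insert _ _) hz

end IsLink

end

end Sweep

namespace Sweep

variable {E : Type*} [NormedAddCommGroup E] [InnerProductSpace ℝ E] [FiniteDimensional ℝ E]
  {P K : Set E} {c : Set E → E → ℝ} {L C D : Set (Set E)}
  {F F' G M N X : Set E} {x y u q v w : E}

/-! ### Labels and top faces in `Q_v` -/

theorem sInf_notMem_insert_zero_succ {A : Set ℕ} (hA : ∃ i, i ∉ A) :
    sInf {i | i ∉ insert 0 (Nat.succ '' A)} = sInf {i | i ∉ A} + 1 := by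
  have h1 : sInf {i | i ∉ A} ∉ A := Nat.sInf_mem (s := {i | i ∉ A}) hA
  have hmem : sInf {i | i ∉ A} + 1 ∈ {i | i ∉ insert 0 (Nat.succ '' A)} := by
    rintro (h | ⟨i, hi, he⟩)
    · exact Nat.succ_ne_zero _ h
    · exact h1 (Nat.succ_injective he ▸ hi)
  refine le_antisymm (Nat.sInf_le hmem) (le_csInf ⟨_, hmem⟩ fun i hi => ?_)
  rcases i with _ | i
  · simp at hi
  · have : i ∉ A := fun h => hi (Set.mem_insert_of_mem _ ⟨i, h, rfl⟩)
    exact Nat.succ_le_succ (Nat.sInf_le this)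

theorem insert_zero_succ_inj {A B : Set ℕ} :
    insert 0 (Nat.succ '' A) = insert 0 (Nat.succ '' B) ↔ A = B := by
  refine ⟨fun h => ?_, fun h => h ▸ rfl⟩
  ext i
  have := Set.ext_iff.1 h (i + 1)
  simpa using this

namespace IsLink

theorem labels_eq (hl : IsLink P c K L q v) (h : IsTruncated P c K L) (hd : 0 < dim K)
    (hv : v ∈ vert K) (hG : IsFace (trunc P c (linkAt P c K v)) G) :
    labels P c K G = insert 0 (Nat.succ '' labels P c (linkAt P c K v) G) := by
  obtain ⟨C, hC, rfl⟩ := hl.swept.exists_eq_cell hG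
  have hvC := IsTruncated.faceHull_notMem_linkFaces hC.1
  rw [hl.swept.labels_cell hC, cell_linkAt,
    h.labels_cell ((h.isFlag_linkFaces_iff hd hv hvC).1 hC), Set.image_insert_eq,
    (h.faceHull_mem hd hv).2, dim_singleton, Set.image_image]
  congr 1
  exact Set.image_congr fun F hF => (hl.dim_face F (hC.1 hF)).symm

/-- From Q_v to K all labels go up by one and the label 0 is added. The smallest missing label
therefore goes up by one as well, and the two notions of top face agree. -/
theorem isTopFace_iff (hl : IsLink P c K L q v) (h : IsTruncated P c K L) (hd : 0 < dim K)
    (hv : v ∈ vert K) (hM : IsFace (trunc P c (linkAt P c K v)) M) :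
    IsTopFace P c K q M N ↔ IsTopFace P c (linkAt P c K v) q M N := by
  have hface := fun G => h.isFace_trunc_linkAt_iff hd hv hl.swept.toIsTruncated (G := G)
  have hex : ∃ i, i ∉ labels P c (linkAt P c K v) M := by
    obtain ⟨C, hC, rfl⟩ := hl.swept.exists_eq_cell hM
    refine ⟨dim (linkAt P c K v), ?_⟩
    rw [hl.swept.labels_cell hC]
    rintro ⟨F, hF, he⟩
    exact (hl.swept.dim_inter_lt_dim (hC.1 hF)).ne he
  have hlab : ∀ A : Set ℕ, insert 0 (Nat.succ '' A) = insert (sInf {i | i ∉ labels P c K M})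
      (labels P c K M) ↔ A = insert (sInf {i | i ∉ labels P c (linkAt P c K v) M})
        (labels P c (linkAt P c K v) M) := by
    intro A
    rw [hl.labels_eq h hd hv hM, sInf_notMem_insert_zero_succ hex, Set.insert_comm,
      ← Nat.succ_eq_add_one, ← Set.image_insert_eq, insert_zero_succ_inj]
  constructor
  · rintro ⟨h1, h2, h3, h4, h5⟩
    have hN : IsFace (trunc P c (linkAt P c K v)) N :=
      (hface N).2 ⟨h1, h2.trans ((hface M).1 hM).2⟩
    rw [hl.labels_eq h hd hv hN, hlab] at h4
    exact ⟨hN, h2, h3, h4, h5⟩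
  · rintro ⟨h1, h2, h3, h4, h5⟩
    refine ⟨((hface N).1 h1).1, h2, h3, ?_, h5⟩
    rw [hl.labels_eq h hd hv h1, hlab]
    exact h4

/-! ### Middle faces -/

/-- By `above` and `below`, a face of T(Q_v) that meets H_v forces `v` to be neither the lowest nor
the highest vertex of its core, and radial projection moves the witnesses into Q_v. Label 0 is
impossible, because truncating a vertex `w` of Q_v gives a face entirely on the side of H_v on which
`w` lies. -/
theorem middle_cases (hl : IsLink P c K L q v) (h : IsSwept P c K L q) (hd : 0 < dim K)
    (hv : v ∈ vert K) (hM : IsMiddle P c K q v M) : ∃ C, IsFlag (linkFaces P L v) C ∧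
      M = cell P c (linkAt P c K v) C ∧ 0 ∉ labels P c (linkAt P c K v) M ∧
      0 < dim (linkAt P c K v) ∧
      (∃ x ∈ core (linkAt P c K v) C, inner ℝ q x < inner ℝ q v) ∧
      ∃ x ∈ core (linkAt P c K v) C, inner ℝ q v < inner ℝ q x := by
  obtain ⟨hMf, z, hzM, hz⟩ := hM
  have hz : inner ℝ q z = inner ℝ q v := hz
  have hT := h.toIsTruncated
  obtain ⟨C, hC, rfl⟩ := hl.swept.exists_eq_cell hMf
  have hvC := IsTruncated.faceHull_notMem_linkFaces hC.1
  have hflag := (hT.isFlag_linkFaces_iff hd hv hvC).1 hC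
  have hcross : (∃ x ∈ core K C, inner ℝ q x < inner ℝ q v) ∧
      ∃ x ∈ core K C, inner ℝ q v < inner ℝ q x := by
    have hzM' := hzM
    rw [cell_linkAt] at hzM'
    rcases h.core_trichotomy (hflag.subset (Set.subset_insert _ _)) hv
      (hT.mem_core_of_isFlag_insert hd hv hflag) with h1 | h1 | h1
    · exact absurd hz (hl.above hT hd hv hflag hvC h1 z hzM').ne'
    · exact absurd hz (hl.below hT hd hv hflag hvC h1 z hzM').ne
    · exact h1
  have h1 : ∃ x ∈ core (linkAt P c K v) C, inner ℝ q x < inner ℝ q v := by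
    have := hl.neg.exists_above hT hd hv hflag (by simpa using hcross.1)
    simpa using this
  have h2 := hl.exists_above hT hd hv hflag hcross.2
  refine ⟨C, hC, rfl, ?_, ?_, h1, h2⟩
  · rw [hl.swept.labels_cell hC]
    rintro ⟨F, hF, h0⟩
    obtain ⟨w, hw, rfl⟩ := hl.swept.exists_vert_of_dim_eq_zero (hC.1 hF) h0
    have hi : faceHull P {w} ∩ linkAt P c K v = {w} := by
      refine (hl.swept.faceHull_mem_of_ne hw fun he => ?_).2
      have h3 := h1.choose_spec
      have h4 := h2.choose_spec
      have h5 : h1.choose ∈ ({w} : Set E) := by rw [he]; exact h3.1.1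
      have h6 : h2.choose ∈ ({w} : Set E) := by rw [he]; exact h4.1.1
      rw [Set.mem_singleton_iff] at h5 h6
      rw [h5] at h3
      rw [h6] at h4
      linarith [h3.2, h4.2]
    rcases lt_or_gt_of_ne (hl.vert_ne w hw) with hlt | hlt
    · exact absurd hz (hl.side_neg _ (hC.1 hF) (by rw [hi]; simpa using hlt) z hzM.1.1
        (hzM.2 _ hF)).ne
    · exact absurd hz (hl.side_pos _ (hC.1 hF) (by rw [hi]; simpa using hlt) z hzM.1.1
        (hzM.2 _ hF)).ne'
  · rw [Nat.pos_iff_ne_zero]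
    intro h0
    obtain ⟨x, hx, hx'⟩ := h1
    obtain ⟨y, hy, hy'⟩ := h2
    rw [subsingleton_of_dim_eq_zero h0 hx.1 hy.1] at hx'
    linarith

/-- The top face of a middle face of `T(Q_v)` belongs to an edge of `K` that goes up from `v`. -/
theorem middle_top (hl : IsLink P c K L q v) (h : IsSwept P c K L q) (hd : 0 < dim K)
    (hv : v ∈ vert K) (hM : IsMiddle P c K q v M) : ∃ C w, IsFlag (linkFaces P L v) C ∧
      M = cell P c (linkAt P c K v) C ∧ w ∈ vert (linkAt P c K v) ∧ inner ℝ q v < inner ℝ q w ∧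
      faceHull P {w} ∩ linkAt P c K v = {w} ∧
      IsFlag (linkFaces P L v) (insert (faceHull P {w}) C) ∧
      IsTopFace P c K q M (cell P c (linkAt P c K v) (insert (faceHull P {w}) C)) := by
  obtain ⟨C, hC, rfl, h0, hdl, h1, x, hx, hlt⟩ := hl.middle_cases h hd hv hM
  obtain ⟨w, hw, hwC, hmax, hflag, htop⟩ := hl.swept.exists_top hdl hC h0
  refine ⟨C, w, hC, rfl, hw, ?_, (hl.swept.faceHull_mem hdl hw).2, hflag,
    (hl.isTopFace_iff h.toIsTruncated hd hv hM.1).2 htop⟩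
  by_cases he : x = w
  · exact he ▸ hlt
  · exact hlt.trans (hmax x hx he)

theorem above_of_isTopFace_middle (hl : IsLink P c K L q v) (h : IsSwept P c K L q)
    (hd : 0 < dim K) (hv : v ∈ vert K) (hM : IsMiddle P c K q v M)
    (hN : IsTopFace P c K q M N) : ∀ x ∈ N, inner ℝ q v < inner ℝ q x := by
  obtain ⟨C, w, hC, rfl, hw, hlt, hi, hflag, htop⟩ := hl.middle_top h hd hv hM
  have hMK := ((h.isFace_trunc_linkAt_iff hd hv hl.swept.toIsTruncated).1 hM.1).1
  rw [h.isTopFace_unique hMK hN htop]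
  intro x hx
  exact hl.side_pos _ (hflag.1 (Set.mem_insert _ _)) (by rw [hi]; simpa using hlt) x hx.1.1
    (hx.2 _ (Set.mem_insert _ _))

/-- A middle face is determined by its top face. -/
theorem middle_unique (hl : IsLink P c K L q v) (h : IsSwept P c K L q)
    (hd : 0 < dim K) (hv : v ∈ vert K) {M' : Set E} (hM : IsMiddle P c K q v M)
    (hM' : IsMiddle P c K q v M') (hN : IsTopFace P c K q M N) (hN' : IsTopFace P c K q M' N) :
    M = M' := by
  -- In Q_v the labels of `N` are those of `M` together with 0. So the chain of `M` consists of the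
  -- members of positive dimension in the chain of `N`.
  have key : ∀ M, IsMiddle P c K q v M → IsTopFace P c K q M N → ∃ C, IsFlag (linkFaces P L v) C ∧
      M = cell P c (linkAt P c K v) C ∧ (fun F => dim (F ∩ linkAt P c K v)) '' C =
        labels P c (linkAt P c K v) N \ {0} := by
    intro M hM hN
    obtain ⟨C, hC, rfl, h0, -⟩ := hl.middle_cases h hd hv hM
    refine ⟨C, hC, rfl, ?_⟩
    obtain ⟨-, -, -, h4, -⟩ := (hl.isTopFace_iff h.toIsTruncated hd hv hM.1).1 hN
    rw [h4, Nat.sInf_eq_zero.2 (Or.inl h0), Set.insert_sdiff_self_of_notMem h0,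
      hl.swept.labels_cell hC]
  obtain ⟨C, hC, rfl, he⟩ := key M hM hN
  obtain ⟨C', hC', rfl, he'⟩ := key M' hM' hN'
  obtain ⟨h1, h2, -⟩ := (hl.isTopFace_iff h.toIsTruncated hd hv hM.1).1 hN
  obtain ⟨-, h2', -⟩ := (hl.isTopFace_iff h.toIsTruncated hd hv hM'.1).1 hN'
  obtain ⟨D, hD, rfl⟩ := hl.swept.exists_eq_cell h1
  rw [← he', (hl.swept.injOn_dim hD).image_eq_image_iff
    (hl.swept.subset_of_cell_subset hD hC.1 h2) (hl.swept.subset_of_cell_subset hD hC'.1 h2')] at he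
  rw [he]

end IsLink

/-! ### Pre-blocks -/

/-- The elements of the pre-block of the face belonging to a chain `C` of faces that are not
vertices. -/
theorem preBlock_cases (h : IsSwept P c K L q) (hd : 0 < dim K)
    (hl : ∀ v ∈ vert K, IsLink P c K L q v) (hC : IsFlag L C)
    (h0 : 0 ∉ labels P c K (cell P c K C)) (hX : X ∈ preBlock P c K q (cell P c K C)) :
    X = cell P c K C ∨ ∃ v ∈ vert K, IsFlag L (insert (faceHull P {v}) C) ∧
      ((X = cell P c K (insert (faceHull P {v}) C) ∧ IsTopFace P c K q (cell P c K C) X ∧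
        ∀ x ∈ X, inner ℝ q x < inner ℝ q v) ∨
      (IsBottomFace P c K q (cell P c K C) (cell P c K (insert (faceHull P {v}) C)) ∧
        (∀ x ∈ cell P c K (insert (faceHull P {v}) C), inner ℝ q v < inner ℝ q x) ∧
        (X = cell P c K (insert (faceHull P {v}) C) ∨
          IsMiddle P c K q v X ∧ IsTopFace P c K q X (cell P c K (insert (faceHull P {v}) C))))) := by
  have hT := h.toIsTruncated
  have hface := hT.isFace_cell hC
  obtain ⟨v, hv, hvC, hhigh, hvflag, htop⟩ := h.exists_top hd hC h0
  obtain ⟨u, hu, huC, hlow, huflag, hbot⟩ := h.exists_bottom hd hC h0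
  have hbelow := (hl v hv).below hT hd hv hvflag (hT.notMem_of_zero_notMem_labels hd hC h0 hv) hhigh
  have habove := (hl u hu).above hT hd hu huflag (hT.notMem_of_zero_notMem_labels hd hC h0 hu) hlow
  rcases hX with (rfl | hX | hX) | ⟨w, hw, hM, N, hN, hXN⟩
  · exact Or.inl rfl
  · rw [h.isTopFace_unique hface hX htop]
    exact Or.inr ⟨v, hv, hvflag, Or.inl ⟨rfl, htop, hbelow⟩⟩
  · rw [h.isBottomFace_unique hface hX hbot]
    exact Or.inr ⟨u, hu, huflag, Or.inr ⟨hbot, habove, Or.inl rfl⟩⟩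
  · have hab := (hl w hw).above_of_isTopFace_middle h hd hw hM hXN
    have hXw := ((hT.isFace_trunc_linkAt_iff hd hw (hl w hw).swept.toIsTruncated).1 hM.1).2
    obtain ⟨y, hy⟩ := hXN.1.2
    have hyw := hXw (hXN.2.1 hy)
    -- A middle face hangs from a face with label 0 that is above its vertex. This excludes the face
    -- itself, which lacks label 0, and its top face, which lies below the vertex; only the bottom
    -- face remains.
    rcases hN with rfl | hN | hN
    · refine absurd ?_ h0
      rw [hXN.2.2.2.1, (hl w hw).labels_eq hT hd hw hM.1]
      exact Set.mem_insert_of_mem _ (Set.mem_insert _ _)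
    · obtain rfl := h.isTopFace_unique hface hN htop
      obtain rfl := h.linkAt_injective hw hv hyw (cell_insert_subset_linkAt hy)
      exact absurd (hab y hy) (hbelow y hy).not_gt
    · obtain rfl := h.isBottomFace_unique hface hN hbot
      obtain rfl := h.linkAt_injective hw hu hyw (cell_insert_subset_linkAt hy)
      exact Or.inr ⟨w, hw, huflag, Or.inr ⟨hbot, habove, Or.inr ⟨hM, hXN⟩⟩⟩

/-- A member with label 0 reveals its role by its position: below H_v it is a top face, above H_v a
bottom face, and crossing H_v a middle face. In the first two cases deleting `v` from its chain
recovers `C`; in the third this is done with its unique top face. -/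
theorem preBlock_unique (h : IsSwept P c K L q) (hd : 0 < dim K)
    (hl : ∀ v ∈ vert K, IsLink P c K L q v) {G' : Set E} (hG : IsFace (trunc P c K) G)
    (hG' : IsFace (trunc P c K) G') (h0 : 0 ∉ labels P c K G) (h0' : 0 ∉ labels P c K G')
    (hX : X ∈ preBlock P c K q G) (hX' : X ∈ preBlock P c K q G') : G = G' := by
  have hT := h.toIsTruncated
  obtain ⟨C, hC, rfl⟩ := h.exists_eq_cell hG
  obtain ⟨C', hC', rfl⟩ := h.exists_eq_cell hG'
  have hzero : ∀ {v}, v ∈ vert K → ∀ {C}, IsFlag L (insert (faceHull P {v}) C) →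
      0 ∈ labels P c K (cell P c K (insert (faceHull P {v}) C)) := by
    intro v hv C hC
    rw [h.labels_cell hC]
    refine ⟨_, Set.mem_insert _ _, ?_⟩
    change dim _ = 0
    rw [(hT.faceHull_mem hd hv).2, dim_singleton]
  have hzeroM : ∀ {v}, v ∈ vert K → IsMiddle P c K q v X → 0 ∈ labels P c K X := by
    intro v hv hM
    rw [(hl v hv).labels_eq hT hd hv hM.1]
    exact Set.mem_insert _ _
  have hne : ∀ {v}, v ∈ vert K → faceHull P {v} ∉ C ∧ faceHull P {v} ∉ C' := fun hv =>
    ⟨hT.notMem_of_zero_notMem_labels hd hC h0 hv, hT.notMem_of_zero_notMem_labels hd hC' h0' hv⟩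
  have hinj : ∀ {v}, v ∈ vert K → IsFlag L (insert (faceHull P {v}) C) →
      IsFlag L (insert (faceHull P {v}) C') → cell P c K (insert (faceHull P {v}) C) =
        cell P c K (insert (faceHull P {v}) C') → cell P c K C = cell P c K C' := by
    intro v hv h1 h2 he
    have := h.cell_injective h1 h2 he
    have h3 : C = C' := by
      rw [← Set.insert_sdiff_self_of_notMem (hne hv).1, this,
        Set.insert_sdiff_self_of_notMem (hne hv).2]
    rw [h3]
  rcases preBlock_cases h hd hl hC h0 hX with rfl | ⟨v, hv, hf, hcase⟩
  · rcases preBlock_cases h hd hl hC' h0' hX' with he | ⟨v, hv, hf, ⟨he, -⟩ | ⟨-, -, he | ⟨hM, -⟩⟩⟩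
    · exact he
    · exact absurd (he ▸ hzero hv hf) h0
    · exact absurd (he ▸ hzero hv hf) h0
    · exact absurd (hzeroM hv hM) h0
  rcases preBlock_cases h hd hl hC' h0' hX' with rfl | ⟨v', hv', hf', hcase'⟩
  · rcases hcase with ⟨he, -⟩ | ⟨-, -, he | ⟨hM, -⟩⟩
    · exact absurd (he ▸ hzero hv hf) h0'
    · exact absurd (he ▸ hzero hv hf) h0'
    · exact absurd (hzeroM hv hM) h0'
  have hsub : ∀ {v}, v ∈ vert K → IsMiddle P c K q v X → X ⊆ linkAt P c K v := fun hv hM =>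
    ((hT.isFace_trunc_linkAt_iff hd hv (hl _ hv).swept.toIsTruncated).1 hM.1).2
  have hXv : X ⊆ linkAt P c K v ∧ X.Nonempty := by
    rcases hcase with ⟨rfl, -⟩ | ⟨-, -, rfl | ⟨hM, -⟩⟩
    · exact ⟨cell_insert_subset_linkAt, h.cell_nonempty hf⟩
    · exact ⟨cell_insert_subset_linkAt, h.cell_nonempty hf⟩
    · exact ⟨hsub hv hM, hM.1.2⟩
  have hXv' : X ⊆ linkAt P c K v' := by
    rcases hcase' with ⟨rfl, -⟩ | ⟨-, -, rfl | ⟨hM, -⟩⟩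
    · exact cell_insert_subset_linkAt
    · exact cell_insert_subset_linkAt
    · exact hsub hv' hM
  obtain ⟨hXv, y, hy⟩ := hXv
  obtain rfl := h.linkAt_injective hv hv' (hXv hy) (hXv' hy)
  rcases hcase with ⟨rfl, -, hlt⟩ | ⟨-, hlt, rfl | ⟨hM, htop⟩⟩
  · rcases hcase' with ⟨he, -⟩ | ⟨-, hlt', he | ⟨hM', -⟩⟩
    · exact hinj hv hf hf' he
    · exact absurd (hlt y hy) (hlt' y (he ▸ hy)).not_gt
    · obtain ⟨z, hz, hz'⟩ := hM'.2
      exact absurd hz' (hlt z hz).ne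
  · rcases hcase' with ⟨he, -, hlt'⟩ | ⟨-, hlt', he | ⟨hM', -⟩⟩
    · exact absurd (hlt y hy) (hlt' y hy).not_gt
    · exact hinj hv hf hf' he
    · obtain ⟨z, hz, hz'⟩ := hM'.2
      exact absurd hz' (hlt z hz).ne'
  · obtain ⟨z, hz, hz'⟩ := hM.2
    rcases hcase' with ⟨he, -, hlt'⟩ | ⟨-, hlt', rfl | ⟨hM', htop'⟩⟩
    · exact absurd hz' (hlt' z hz).ne
    · exact absurd hz' (hlt' z hz).ne'
    · have hXK := ((hT.isFace_trunc_linkAt_iff hd hv (hl v hv).swept.toIsTruncated).1 hM.1).1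
      exact hinj hv hf hf' (h.isTopFace_unique hXK htop htop')

/-- A middle face belongs to the pre-block of an edge that goes up from `v`. -/
theorem IsLink.exists_preBlock_of_middle (hlv : IsLink P c K L q v) (h : IsSwept P c K L q)
    (hd : 0 < dim K) (hv : v ∈ vert K) (hM : IsMiddle P c K q v M) :
    ∃ G, IsFace (trunc P c K) G ∧ 0 ∉ labels P c K G ∧ M ∈ preBlock P c K q G := by
  have hT := h.toIsTruncated
  obtain ⟨C, w, hC, rfl, hw, hlt, hi, hflag, htop⟩ := hlv.middle_top h hd hv hM
  have hf := (hT.isFlag_linkFaces_iff hd hv (IsTruncated.faceHull_notMem_linkFaces hflag.1)).1 hflag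
  have hCf := hf.subset (Set.subset_insert _ _)
  have h0 : 0 ∉ labels P c K (cell P c K (insert (faceHull P {w}) C)) := by
    rw [h.labels_cell hCf]
    rintro ⟨F, hF, he⟩
    have := hlv.dim_face F (hflag.1 hF)
    change dim (F ∩ K) = 0 at he
    omega
  refine ⟨_, h.isFace_cell hCf, h0, Or.inr ⟨v, hv, hM, _, Or.inr (Or.inr ?_), htop⟩⟩
  obtain ⟨v', hv', hvC', hlow, hf', hbot⟩ := h.exists_bottom hd hCf h0
  have hvC := hT.mem_core_of_isFlag_insert hd hv hf
  -- The added face meets Q_v only in `w`. If its lowest point were a vertex `v'` other than `v`,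
  -- the ray from `v` to `v'` would also hit Q_v in `w`, putting `w` below `v`.
  have hvv : v' = v := by
    by_contra hne
    have h1 := hlow v hvC (Ne.symm hne)
    obtain ⟨s, hs, hmem⟩ := hlv.radial v' (mem_of_mem_vert hv') hne
    have h2 := hT.add_smul_sub_mem_core hCf.1 hvC hvC' hmem.1
    have h3 : v + s • (v' - v) ∈ faceHull P {w} ∩ linkAt P c K v :=
      ⟨h2.2 _ (Set.mem_insert _ _), hmem⟩
    rw [hi, Set.mem_singleton_iff] at h3
    rw [← h3, inner_add_right, inner_smul_right, inner_sub_right] at hlt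
    nlinarith
  subst hvv
  rw [cell_linkAt]
  exact hbot

/-- A face with label 0 has a chain with a vertex `v`. Deleting `v` leaves a chain in whose core `v`
is lowest, highest or neither, which makes the face a bottom face, a top face or a middle face; in
the last case the cell has points on both sides of H_v. -/
theorem exists_preBlock (h : IsSwept P c K L q) (hd : 0 < dim K)
    (hl : ∀ v ∈ vert K, IsLink P c K L q v) (hX : IsFace (trunc P c K) X) :
    ∃ G, IsFace (trunc P c K) G ∧ 0 ∉ labels P c K G ∧ X ∈ preBlock P c K q G := by
  have hT := h.toIsTruncated
  by_cases h0 : 0 ∈ labels P c K X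
  swap
  · exact ⟨X, hX, h0, Or.inl (Or.inl rfl)⟩
  obtain ⟨D, hD, rfl⟩ := h.exists_eq_cell hX
  rw [h.labels_cell hD] at h0
  obtain ⟨F, hF, hF0⟩ := h0
  obtain ⟨v, hv, rfl⟩ := hT.exists_vert_of_dim_eq_zero (hD.1 hF) hF0
  obtain ⟨C, hvC, rfl⟩ : ∃ C, faceHull P {v} ∉ C ∧ D = insert (faceHull P {v}) C :=
    ⟨D \ {faceHull P {v}}, by simp, by rw [Set.insert_sdiff_singleton, Set.insert_eq_of_mem hF]⟩
  have hC := hD.subset (Set.subset_insert _ _)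
  have h0 : 0 ∉ labels P c K (cell P c K C) := by
    rw [h.labels_cell hC]
    rintro ⟨F, hFC, hF1⟩
    exact hvC (hT.injOn_dim hD (Set.mem_insert_of_mem _ hFC) hF (hF1.trans hF0.symm) ▸ hFC)
  have hvcore := hT.mem_core_of_isFlag_insert hd hv hD
  rcases h.core_trichotomy hC hv hvcore with hlow | hhigh | ⟨h1, h2⟩
  · obtain ⟨u, hu, huC, hlow', -, hbot⟩ := h.exists_bottom hd hC h0
    have : u = v := by
      by_contra hne
      exact absurd (hlow u huC hne) (hlow' v hvcore (Ne.symm hne)).not_gt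
    subst this
    exact ⟨_, h.isFace_cell hC, h0, Or.inl (Or.inr (Or.inr hbot))⟩
  · obtain ⟨u, hu, huC, hhigh', -, htop⟩ := h.exists_top hd hC h0
    have : u = v := by
      by_contra hne
      exact absurd (hhigh u huC hne) (hhigh' v hvcore (Ne.symm hne)).not_gt
    subst this
    exact ⟨_, h.isFace_cell hC, h0, Or.inl (Or.inr (Or.inl htop))⟩
  · have hCl := (hT.isFlag_linkFaces_iff hd hv hvC).2 hD
    have hlv := hl v hv
    have h1' := hlv.neg.exists_above hT hd hv hD (by simpa using h1)
    have h2' := hlv.exists_above hT hd hv hD h2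
    obtain ⟨x, hx, hxlt⟩ := hlv.exists_mem_cell_above hCl h2' (by simpa using h1')
    obtain ⟨y, hy, hylt⟩ := hlv.neg.exists_mem_cell_above hCl h1' (by simpa using h2')
    obtain ⟨z, hz, hze⟩ := exists_inner_eq (hT.convex_cell hD.1) hy hx (by simpa using hylt) hxlt
    refine hlv.exists_preBlock_of_middle h hd hv ⟨?_, z, hz, hze⟩
    rw [← cell_linkAt]
    exact hlv.swept.isFace_cell hCl

end Sweep

namespace Sweep

variable {E : Type*} [NormedAddCommGroup E] [InnerProductSpace ℝ E] [FiniteDimensional ℝ E]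
  {P K : Set E} {c : Set E → E → ℝ} {L C D : Set (Set E)} {dir : List (Set E) → E} {n : ℕ}
  {π : List (Set E)} {F F' G G₀ M N X : Set E} {B S : Set (Set E)} {x y u q v w : E} {t : ℝ}

/-! ### The partition into blocks -/

/-- The families `𝓑_v(K)` form a partition of the set of faces of `T(K)` into unions of pre-blocks,
and `𝓑_v(K)` consists of the pre-blocks whose bottom face lies above `v` in `Q_v`. -/
structure IsPartitioned (P : Set E) (c : Set E → E → ℝ) (dir : List (Set E) → E) (n : ℕ)
    (K : Set E) (π : List (Set E)) (q : E) : Prop where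
  isFace : ∀ v ∈ vert K, ∀ B ∈ blocksAt P c dir n K π q v,
    B.Nonempty ∧ ∀ G ∈ B, IsFace (trunc P c K) G
  cover : ∀ G, IsFace (trunc P c K) G → ∃ v ∈ vert K, ∃ B ∈ blocksAt P c dir n K π q v, G ∈ B
  unique : ∀ v ∈ vert K, ∀ v' ∈ vert K, ∀ B ∈ blocksAt P c dir n K π q v,
    ∀ B' ∈ blocksAt P c dir n K π q v', ∀ G ∈ B, G ∈ B' → v = v' ∧ B = B'
  top : 0 < n → ∀ G, IsFace (trunc P c K) G → 0 ∉ labels P c K G →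
    ∀ v ∈ vert K, ∀ B ∈ blocksAt P c dir n K π q v, G ∈ B →
    ∀ G', IsTopFace P c K q G G' → G' ∈ B
  bottom : 0 < n → ∀ v ∈ vert K, ∀ B ∈ blocksAt P c dir n K π q v, ∀ G ∈ B,
    ∃ G₀ N, IsFace (trunc P c K) G₀ ∧ 0 ∉ labels P c K G₀ ∧ G ∈ preBlock P c K q G₀ ∧
      IsBottomFace P c K q G₀ N ∧ N ⊆ linkAt P c K v ∧ ∀ x ∈ N, inner ℝ q v < inner ℝ q x

theorem isPartitioned_zero (h : IsTruncated P c K L) (hd : dim K = 0) :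
    IsPartitioned P c dir 0 K π q := by
  obtain ⟨v, hv⟩ := h.poly.nonempty
  have hK := (subsingleton_of_dim_eq_zero hd).eq_singleton_of_mem hv
  have hT : trunc P c K = {v} := by
    rw [h.trunc_eq]
    have hL : ∀ F, F ∉ L := fun F hF => by
      have := h.dim_inter_lt_dim hF
      omega
    simp [hL, hK]
  have hface : IsFace (trunc P c K) {v} := by rw [hT]; exact isFace_self ⟨v, rfl⟩
  have hvert : ∀ w ∈ vert K, w = v := fun w hw => by
    have := mem_of_mem_vert hw
    rw [hK] at this
    exact this
  refine ⟨?_, ?_, ?_, fun h => absurd h (lt_irrefl _), fun h => absurd h (lt_irrefl _)⟩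
  · rintro w hw B rfl
    rw [hvert w hw]
    exact ⟨⟨_, rfl⟩, fun G hG => hG ▸ hface⟩
  · intro G hG
    refine ⟨v, ?_, _, rfl, ?_⟩
    · change IsFace K {v}
      rw [hK]
      exact isFace_self ⟨v, rfl⟩
    · have h1 := hG.subset
      rw [hT] at h1
      exact (Set.subset_singleton_iff_eq.1 h1).resolve_left hG.2.ne_empty
  · rintro w hw w' hw' B rfl B' rfl G - -
    rw [hvert w hw, hvert w' hw']
    exact ⟨rfl, rfl⟩

/-- If the bottom face of `G₀` lies in `Q_w` and `T(Q_w)` is above height `t`, then so is every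
element of the pre-block of `G₀`. -/
theorem lt_of_mem_preBlock (h : IsSwept P c K L q) (hd : 0 < dim K)
    (hl : ∀ v ∈ vert K, IsLink P c K L q v) (hG₀ : IsFace (trunc P c K) G₀)
    (h0 : 0 ∉ labels P c K G₀) (hX : X ∈ preBlock P c K q G₀) (hN : IsBottomFace P c K q G₀ N)
    (hw : w ∈ vert K) (hNw : N ⊆ linkAt P c K w)
    (ht : ∀ x ∈ trunc P c (linkAt P c K w), t < inner ℝ q x) : ∀ x ∈ X, t < inner ℝ q x := by
  obtain ⟨C, hC, rfl⟩ := h.exists_eq_cell hG₀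
  have hcell : ∀ x ∈ cell P c K C, t < inner ℝ q x := by
    intro x hx
    obtain ⟨D, z, hD, hCD, -, hz, hmax⟩ := h.exists_vertex_max hC (innerSL ℝ (-q))
    obtain ⟨hNf, -, -, -, w₀, hw₀, hmin, hwN⟩ := hN
    have h1 := hmin z (h.toIsTruncated.mem_vert_cell hD hCD hz)
    have h2 := ht w₀ ⟨hNw hwN, (hNf.subset hwN).2⟩
    have h3 : inner ℝ (-q) x ≤ inner ℝ (-q) z := hmax x hx
    simp only [inner_neg_left] at h3
    linarith
  rcases preBlock_cases h hd hl hC h0 hX with rfl | ⟨v, hv, hf, ⟨rfl, -⟩ | ⟨hbot, -, rfl | ⟨hM, -⟩⟩⟩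
  · exact hcell
  · exact fun x hx => hcell x (cell_anti (Set.subset_insert _ _) hx)
  · exact fun x hx => hcell x (cell_anti (Set.subset_insert _ _) hx)
  · obtain rfl := h.isBottomFace_unique (h.isFace_cell hC) hN hbot
    obtain ⟨y, hy⟩ := h.cell_nonempty hf
    obtain rfl := h.linkAt_injective hw hv (hNw hy) (cell_insert_subset_linkAt hy)
    exact fun x hx => ht x (hM.1.subset hx)

namespace IsPartitioned

theorem above (hp : IsPartitioned P c dir n K π q) (h : IsSwept P c K L q) (hn : dim K = n)
    (hl : 0 < n → ∀ v ∈ vert K, IsLink P c K L q v) (hw : w ∈ vert K) (hwt : t < inner ℝ q w)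
    (ht : 0 < n → ∀ x ∈ trunc P c (linkAt P c K w), t < inner ℝ q x)
    (hB : B ∈ blocksAt P c dir n K π q w) (hG : G ∈ B) : ∀ x ∈ G, t < inner ℝ q x := by
  rcases Nat.eq_zero_or_pos n with rfl | hpos
  · obtain rfl : B = {{w}} := by simpa [blocksAt] using hB
    rw [hG]
    simpa using hwt
  · obtain ⟨G₀, N, h1, h2, h3, h4, h5, -⟩ := hp.bottom hpos w hw B hB G hG
    exact lt_of_mem_preBlock h (by omega) (hl hpos) h1 h2 h3 h4 hw h5 (ht hpos)

/-- The bottom face of the pre-block of `G` lies in T(Q_w), below `t`. The face `G₀` contains this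
bottom face, and middle faces of the pre-block also lie in T(Q_w), so a member entirely above `t`
can only be the top face of `G₀`. -/
theorem exists_top_of_below (hp : IsPartitioned P c dir n K π q) (h : IsSwept P c K L q)
    (hn : dim K = n) (hl : 0 < n → ∀ v ∈ vert K, IsLink P c K L q v) (hw : w ∈ vert K)
    (hwt : inner ℝ q w < t)
    (ht : 0 < n → ∀ x ∈ trunc P c (linkAt P c K w), inner ℝ q x < t)
    (hB : B ∈ blocksAt P c dir n K π q w) (hG : G ∈ B) (hGt : ∀ x ∈ G, t < inner ℝ q x) :
    ∃ M, IsFace (trunc P c K) M ∧ 0 ∉ labels P c K M ∧ IsTopFace P c K q M G ∧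
      ∃ x ∈ M, inner ℝ q x < t := by
  rcases Nat.eq_zero_or_pos n with rfl | hpos
  · obtain rfl : B = {{w}} := by simpa [blocksAt] using hB
    obtain rfl : G = {w} := hG
    exact absurd (hGt w rfl) hwt.not_gt
  · obtain ⟨G₀, N, h1, h2, h3, h4, h5, -⟩ := hp.bottom hpos w hw B hB G hG
    obtain ⟨y, hy⟩ := h4.1.2
    have hyt := ht hpos y ⟨h5 hy, (h4.1.subset hy).2⟩
    obtain ⟨C, hC, rfl⟩ := h.exists_eq_cell h1
    have hd : 0 < dim K := by omega
    rcases preBlock_cases h hd (hl hpos) hC h2 h3 with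
      rfl | ⟨v, hv, hf, ⟨-, htop, -⟩ | ⟨hbot, -, rfl | ⟨hM, -⟩⟩⟩
    · exact absurd (hGt y (h4.2.1 hy)) hyt.not_gt
    · exact ⟨_, h1, h2, htop, y, h4.2.1 hy, hyt⟩
    · obtain rfl := h.isBottomFace_unique h1 h4 hbot
      exact absurd (hGt y hy) hyt.not_gt
    · obtain rfl := h.isBottomFace_unique h1 h4 hbot
      obtain rfl := h.linkAt_injective hw hv (h5 hy) (cell_insert_subset_linkAt hy)
      obtain ⟨z, hz⟩ := hM.1.2
      exact absurd (hGt z hz) (ht hpos z (hM.1.subset hz)).not_gt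

end IsPartitioned

/-- The sets of faces of `T(Q_v)` whose pre-blocks are merged into a block. -/
def IsSeed (P : Set E) (c : Set E → E → ℝ) (dir : List (Set E) → E) (n : ℕ) (K : Set E)
    (π : List (Set E)) (q v : E) (S : Set (Set E)) : Prop :=
  (2 ≤ n ∧ ∃ w ∈ vert (sliceAt P c K q v),
    ∃ B ∈ blocksAt P c dir (n - 2) (sliceAt P c K q v) (faceHull P {v} :: π)
      (dir (faceHull P {v} :: π)) w, S = {M | IsMiddle P c K q v M ∧ M ∩ sweepPlane q v ∈ B}) ∨
  ∃ w ∈ vert (linkAt P c K v), inner ℝ q v < inner ℝ q w ∧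
    S ∈ blocksAt P c dir (n - 1) (linkAt P c K v) (faceHull P {v} :: π) q w

/-- This merges the recursive clauses in positive dimension into one description. In dimension 1 no
blocks come from slices, which is why `IsSeed` requires `2 ≤ n` for them. -/
theorem mem_blocksAt_iff (hn : 0 < n) : B ∈ blocksAt P c dir n K π q v ↔
    ∃ S, IsSeed P c dir n K π q v S ∧ B = merge P c K q S := by
  match n, hn with
  | 1, _ =>
    simp only [blocksAt, assemble, IsSeed, Set.mem_union, Set.mem_ofPred_eq]
    constructor
    · rintro (⟨B, h, -⟩ | ⟨w, hw, hlt, B, hB, rfl⟩)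
      · exact absurd h (Set.notMem_empty _)
      · exact ⟨B, Or.inr ⟨w, hw, hlt, hB⟩, rfl⟩
    · rintro ⟨S, ⟨h, -⟩ | ⟨w, hw, hlt, hS⟩, rfl⟩
      · omega
      · exact Or.inr ⟨w, hw, hlt, S, hS, rfl⟩
  | m + 2, _ =>
    simp only [blocksAt, assemble, IsSeed, Set.mem_union, Set.mem_ofPred_eq, Set.mem_iUnion]
    constructor
    · rintro (⟨B, ⟨w, hw, hB⟩, rfl⟩ | ⟨w, hw, hlt, B, hB, rfl⟩)
      · exact ⟨_, Or.inl ⟨by omega, w, hw, B, hB, rfl⟩, rfl⟩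
      · exact ⟨B, Or.inr ⟨w, hw, hlt, hB⟩, rfl⟩
    · rintro ⟨S, ⟨-, w, hw, B, hB, rfl⟩ | ⟨w, hw, hlt, hS⟩, rfl⟩
      · exact Or.inl ⟨B, ⟨w, hw, hB⟩, rfl⟩
      · exact Or.inr ⟨w, hw, hlt, S, hS, rfl⟩

/-- The members of `L` whose sections by `Q_v` have points on both sides of `H_v`. -/
def sliceFaces (P : Set E) (c : Set E → E → ℝ) (K : Set E) (L : Set (Set E)) (q v : E) :
    Set (Set E) :=
  {F ∈ linkFaces P L v | (∃ x ∈ F ∩ linkAt P c K v, inner ℝ q v < inner ℝ q x) ∧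
    ∃ x ∈ F ∩ linkAt P c K v, inner ℝ q x < inner ℝ q v}

/-- `H_v` passes between points of `Q_v`. -/
def IsCrossing (P : Set E) (c : Set E → E → ℝ) (K : Set E) (q v : E) : Prop :=
  (∃ x ∈ linkAt P c K v, inner ℝ q v < inner ℝ q x) ∧
    ∃ x ∈ linkAt P c K v, inner ℝ q x < inner ℝ q v

theorem cell_sliceAt : cell P c (sliceAt P c K q v) C =
    cell P c (linkAt P c K v) C ∩ sweepPlane q v := by
  ext x
  simp only [cell, trunc, sliceAt, Set.mem_ofPred_eq, Set.mem_inter_iff]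
  tauto

theorem IsLink.isCrossing_of_nonempty (hl : IsLink P c K L q v)
    (hne : (sliceAt P c K q v).Nonempty) : IsCrossing P c K q v := by
  obtain ⟨z, hz, hzq⟩ := hne
  have hzq : inner ℝ q z = inner ℝ q v := hzq
  constructor
  · obtain ⟨w, hw, hmax⟩ := hl.swept.poly.exists_vert_max (innerSL ℝ q)
    have h1 : inner ℝ q z ≤ inner ℝ q w := hmax z hz
    exact ⟨w, mem_of_mem_vert hw, lt_of_le_of_ne (hzq ▸ h1) (hl.vert_ne w hw).symm⟩
  · obtain ⟨w, hw, hmax⟩ := hl.swept.poly.exists_vert_max (innerSL ℝ (-q))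
    have h1 : inner ℝ (-q) z ≤ inner ℝ (-q) w := hmax z hz
    simp only [inner_neg_left, neg_le_neg_iff] at h1
    exact ⟨w, mem_of_mem_vert hw, lt_of_le_of_ne (hzq ▸ h1) (hl.vert_ne w hw)⟩

/-- Every member of the chain of a middle face contains the least one, whose section has points on
both sides of H_v. So the same chain describes a face of T(R_v). -/
theorem IsLink.isFace_slice_of_middle (hl : IsLink P c K L q v) (h : IsSwept P c K L q)
    (hd : 0 < dim K) (hv : v ∈ vert K)
    (hs : IsTruncated P c (sliceAt P c K q v) (sliceFaces P c K L q v))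
    (hM : IsMiddle P c K q v M) :
    IsFace (trunc P c (sliceAt P c K q v)) (M ∩ sweepPlane q v) := by
  obtain ⟨C, hC, rfl, -, -, ⟨x, hx, hx'⟩, y, hy, hy'⟩ := hl.middle_cases h hd hv hM
  rw [← cell_sliceAt]
  exact hs.isFace_cell ⟨fun F hF => ⟨hC.1 hF, ⟨y, ⟨hy.2 F hF, hy.1⟩, hy'⟩,
    x, ⟨hx.2 F hF, hx.1⟩, hx'⟩, hC.2⟩

theorem IsLink.exists_middle_of_isFace_slice (hl : IsLink P c K L q v)
    (hs : IsTruncated P c (sliceAt P c K q v) (sliceFaces P c K L q v))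
    (hN : IsFace (trunc P c (sliceAt P c K q v)) N) :
    ∃ M, IsMiddle P c K q v M ∧ M ∩ sweepPlane q v = N := by
  obtain ⟨C, hC, rfl⟩ := hs.exists_eq_cell hN
  refine ⟨cell P c (linkAt P c K v) C, ⟨hl.swept.isFace_cell ⟨fun F hF => (hC.1 hF).1, hC.2⟩, ?_⟩,
    cell_sliceAt.symm⟩
  rw [← cell_sliceAt]
  exact hN.2

/-- Everything about the links and slices of `K` that enters the construction of its blocks. -/
structure IsStep (P : Set E) (c : Set E → E → ℝ) (dir : List (Set E) → E) (n : ℕ)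
    (K : Set E) (L : Set (Set E)) (π : List (Set E)) (q : E) : Prop where
  swept : IsSwept P c K L q
  dim_eq : dim K = n
  pos : 0 < n
  link : ∀ v ∈ vert K, IsLink P c K L q v
  link_link : 1 < n → ∀ v ∈ vert K, ∀ w ∈ vert (linkAt P c K v),
    IsLink P c (linkAt P c K v) (linkFaces P L v) q w
  slice : ∀ v ∈ vert K, IsCrossing P c K q v →
    IsTruncated P c (sliceAt P c K q v) (sliceFaces P c K L q v)
  link_part : ∀ v ∈ vert K,
    IsPartitioned P c dir (n - 1) (linkAt P c K v) (faceHull P {v} :: π) q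
  slice_part : ∀ v ∈ vert K, IsCrossing P c K q v →
    IsPartitioned P c dir (n - 2) (sliceAt P c K q v) (faceHull P {v} :: π)
      (dir (faceHull P {v} :: π))

/-! ### From the partitions of the links and slices to the partition of `K`. -/

namespace IsStep

theorem dim_pos (h : IsStep P c dir n K L π q) : 0 < dim K := h.dim_eq ▸ h.pos

theorem dim_linkAt (h : IsStep P c dir n K L π q) (hv : v ∈ vert K) :
    dim (linkAt P c K v) = n - 1 := by
  have h1 := (h.link v hv).dim_link
  have h2 := h.dim_eq
  omega

theorem isFace_of_linkAt (h : IsStep P c dir n K L π q) (hv : v ∈ vert K)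
    (hG : IsFace (trunc P c (linkAt P c K v)) G) :
    IsFace (trunc P c K) G ∧ G ⊆ linkAt P c K v :=
  (h.swept.isFace_trunc_linkAt_iff h.dim_pos hv (h.link v hv).swept.toIsTruncated).1 hG

theorem isFace_of_mem_preBlock (h : IsStep P c dir n K L π q) (hG : IsFace (trunc P c K) G)
    (hX : X ∈ preBlock P c K q G) : IsFace (trunc P c K) X := by
  rcases hX with (rfl | hX | hX) | ⟨w, hw, hM, -⟩
  · exact hG
  · exact hX.1
  · exact hX.1
  · exact (h.isFace_of_linkAt hw hM.1).1

theorem side_pos (h : IsStep P c dir n K L π q) (hv : v ∈ vert K)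
    (hw : w ∈ vert (linkAt P c K v)) (hlt : inner ℝ q v < inner ℝ q w) (hn : 0 < n - 1) :
    ∀ x ∈ trunc P c (linkAt P c (linkAt P c K v) w), inner ℝ q v < inner ℝ q x := by
  obtain ⟨hF, hi⟩ := (h.link v hv).swept.faceHull_mem (h.dim_linkAt hv ▸ hn) hw
  intro x hx
  exact (h.link v hv).side_pos _ hF (by rw [hi]; simpa using hlt) x hx.1.1 hx.1.2

theorem side_neg (h : IsStep P c dir n K L π q) (hv : v ∈ vert K)
    (hw : w ∈ vert (linkAt P c K v)) (hlt : inner ℝ q w < inner ℝ q v) (hn : 0 < n - 1) :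
    ∀ x ∈ trunc P c (linkAt P c (linkAt P c K v) w), inner ℝ q x < inner ℝ q v := by
  obtain ⟨hF, hi⟩ := (h.link v hv).swept.faceHull_mem (h.dim_linkAt hv ▸ hn) hw
  intro x hx
  exact (h.link v hv).side_neg _ hF (by rw [hi]; simpa using hlt) x hx.1.1 hx.1.2

theorem link_above (h : IsStep P c dir n K L π q) (hv : v ∈ vert K)
    (hw : w ∈ vert (linkAt P c K v)) (hlt : inner ℝ q v < inner ℝ q w)
    (hB : B ∈ blocksAt P c dir (n - 1) (linkAt P c K v) (faceHull P {v} :: π) q w) (hG : G ∈ B) :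
    ∀ x ∈ G, inner ℝ q v < inner ℝ q x :=
  (h.link_part v hv).above (h.link v hv).swept (h.dim_linkAt hv)
    (fun hn => h.link_link (by omega) v hv) hw hlt (h.side_pos hv hw hlt) hB hG

theorem exists_bottom (h : IsStep P c dir n K L π q) (hG : IsFace (trunc P c K) G)
    (h0 : 0 ∉ labels P c K G) : ∃ v ∈ vert K, ∃ N, IsBottomFace P c K q G N ∧
      IsFace (trunc P c (linkAt P c K v)) N ∧ ∀ x ∈ N, inner ℝ q v < inner ℝ q x := by
  obtain ⟨C, hC, rfl⟩ := h.swept.exists_eq_cell hG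
  obtain ⟨v, hv, hvC, hlow, hf, hbot⟩ := h.swept.exists_bottom h.dim_pos hC h0
  have hT := h.swept.toIsTruncated
  refine ⟨v, hv, _, hbot, ?_, (h.link v hv).above hT h.dim_pos hv hf
    (hT.notMem_of_zero_notMem_labels h.dim_pos hC h0 hv) hlow⟩
  exact (hT.isFace_trunc_linkAt_iff h.dim_pos hv (h.link v hv).swept.toIsTruncated).2
    ⟨hbot.1, cell_insert_subset_linkAt⟩

/-- Every pre-block meets the seed of some block. -/
theorem exists_seed (h : IsStep P c dir n K L π q) (hG : IsFace (trunc P c K) G)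
    (h0 : 0 ∉ labels P c K G) : ∃ v ∈ vert K, ∃ S, IsSeed P c dir n K π q v S ∧
      ∃ M ∈ S, M ∈ preBlock P c K q G := by
  obtain ⟨v, hv, N, hbot, hN, habove⟩ := h.exists_bottom hG h0
  have hlv := h.link v hv
  obtain ⟨w, hw, B, hB, hNB⟩ := (h.link_part v hv).cover N hN
  refine ⟨v, hv, ?_⟩
  -- If `w` is below `v`, then `N`, being above H_v, is the top face of some `M` that reaches below
  -- H_v. Then `M` is a middle face, and its slice selects a block of R_v. If `w` is above `v`, the
  -- block of Q_v that contains `N` is itself a seed.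
  rcases lt_or_gt_of_ne (hlv.vert_ne w hw) with hlt | hlt
  · obtain ⟨M, hM, hM0, htop, x, hx, hxlt⟩ := (h.link_part v hv).exists_top_of_below hlv.swept
      (h.dim_linkAt hv) (fun hn => h.link_link (by omega) v hv) hw hlt (h.side_neg hv hw hlt)
      hB hNB habove
    obtain ⟨y, hy⟩ := hN.2
    obtain ⟨z, hz, hze⟩ := exists_inner_eq (hM.1.convex hlv.swept.convex_trunc) hx (htop.2.1 hy)
      hxlt (habove y hy)
    have hmid : IsMiddle P c K q v M := ⟨hM, z, hz, hze⟩
    have hcross : IsCrossing P c K q v := hlv.isCrossing_of_nonempty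
      ⟨z, (h.isFace_of_linkAt hv hM).2 hz, hze⟩
    have hn : 2 ≤ n := by
      obtain ⟨-, -, -, -, h1, -⟩ := hlv.middle_cases h.swept h.dim_pos hv hmid
      rw [h.dim_linkAt hv] at h1
      omega
    obtain ⟨w', hw', B', hB', hMB'⟩ := (h.slice_part v hv hcross).cover _
      (hlv.isFace_slice_of_middle h.swept h.dim_pos hv (h.slice v hv hcross) hmid)
    exact ⟨_, Or.inl ⟨hn, w', hw', B', hB', rfl⟩, M, ⟨hmid, hMB'⟩, Or.inr ⟨v, hv, hmid, N,
      Or.inr (Or.inr hbot), (hlv.isTopFace_iff h.swept.toIsTruncated h.dim_pos hv hM).2 htop⟩⟩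
  · exact ⟨B, Or.inr ⟨w, hw, hlt, hB⟩, N, hNB, Or.inl (Or.inr (Or.inr hbot))⟩

/-- The position of a seed relative to a pre-block it meets. -/
theorem seed_cases (h : IsStep P c dir n K L π q) (hG : IsFace (trunc P c K) G)
    (h0 : 0 ∉ labels P c K G) (hv : v ∈ vert K) (hS : IsSeed P c dir n K π q v S)
    (hMS : M ∈ S) (hM : M ∈ preBlock P c K q G) :
    ∃ N, IsBottomFace P c K q G N ∧ IsFace (trunc P c (linkAt P c K v)) N ∧
      (∀ x ∈ N, inner ℝ q v < inner ℝ q x) ∧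
      ((∃ M', IsMiddle P c K q v M' ∧ IsTopFace P c K q M' N ∧
        ∃ w ∈ vert (sliceAt P c K q v), ∃ B ∈ blocksAt P c dir (n - 2) (sliceAt P c K q v)
          (faceHull P {v} :: π) (dir (faceHull P {v} :: π)) w, M' ∩ sweepPlane q v ∈ B ∧
          S = {M | IsMiddle P c K q v M ∧ M ∩ sweepPlane q v ∈ B}) ∨
      ∃ w ∈ vert (linkAt P c K v), inner ℝ q v < inner ℝ q w ∧ N ∈ S ∧
        S ∈ blocksAt P c dir (n - 1) (linkAt P c K v) (faceHull P {v} :: π) q w) := by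
  have hT := h.swept.toIsTruncated
  have hlv := h.link v hv
  obtain ⟨C, hC, rfl⟩ := h.swept.exists_eq_cell hG
  have hface : IsFace (trunc P c (linkAt P c K v)) M ∧
      ((∀ x ∈ M, inner ℝ q v < inner ℝ q x) ∨ IsMiddle P c K q v M) := by
    rcases hS with ⟨-, w, hw, B, hB, rfl⟩ | ⟨w, hw, hlt, hS⟩
    · exact ⟨hMS.1.1, Or.inr hMS.1⟩
    · exact ⟨((h.link_part v hv).isFace w hw S hS).2 M hMS,
        Or.inl (h.link_above hv hw hlt hS hMS)⟩
  obtain ⟨hMf, hside⟩ := hface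
  have hMv := (h.isFace_of_linkAt hv hMf).2
  obtain ⟨z, hz, hzv⟩ : ∃ z ∈ M, inner ℝ q v ≤ inner ℝ q z := by
    rcases hside with hs | ⟨-, z, hz, he⟩
    · obtain ⟨z, hz⟩ := hMf.2
      exact ⟨z, hz, (hs z hz).le⟩
    · exact ⟨z, hz, le_of_eq (Eq.symm he)⟩
  -- A member of a seed lies in Q_v and has a point at the height of `v` or higher. So it is neither
  -- `G`, which lacks label 0, nor the top face, which is below its vertex; only the bottom face and
  -- the middle faces remain.
  rcases preBlock_cases h.swept h.dim_pos h.link hC h0 hM with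
    rfl | ⟨v', hv', hf, ⟨rfl, -, hlt⟩ | ⟨hbot, habove, hcase⟩⟩
  · refine absurd ?_ h0
    rw [hlv.labels_eq hT h.dim_pos hv hMf]
    exact Set.mem_insert _ _
  · obtain rfl := h.swept.linkAt_injective hv hv' (hMv hz) (cell_insert_subset_linkAt hz)
    exact absurd (hlt z hz) hzv.not_gt
  · have hvv : v = v' := by
      rcases hcase with rfl | ⟨hM', -⟩
      · exact h.swept.linkAt_injective hv hv' (hMv hz) (cell_insert_subset_linkAt hz)
      · exact h.swept.linkAt_injective hv hv' (hMv hz) ((h.isFace_of_linkAt hv' hM'.1).2 hz)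
    subst hvv
    refine ⟨_, hbot, (hT.isFace_trunc_linkAt_iff h.dim_pos hv hlv.swept.toIsTruncated).2
      ⟨hbot.1, cell_insert_subset_linkAt⟩, habove, ?_⟩
    rcases hS with ⟨-, w, hw, B, hB, rfl⟩ | ⟨w, hw, hlt, hS⟩
    · refine Or.inl ⟨M, hMS.1, ?_, w, hw, B, hB, hMS.2, rfl⟩
      rcases hcase with rfl | ⟨-, htop⟩
      · obtain ⟨y, hy, hyv⟩ := hMS.1.2
        exact absurd hyv (habove y hy).ne'
      · exact htop
    · refine Or.inr ⟨w, hw, hlt, ?_, hS⟩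
      rcases hcase with rfl | ⟨hM', -⟩
      · exact hMS
      · obtain ⟨y, hy, hyv⟩ := hM'.2
        exact absurd hyv (h.link_above hv hw hlt hS hMS y hy).ne'

/-- A pre-block meets only one seed. -/
theorem seed_unique (h : IsStep P c dir n K L π q) (hG : IsFace (trunc P c K) G)
    (h0 : 0 ∉ labels P c K G) {v' : E} {S' : Set (Set E)} {M' : Set E} (hv : v ∈ vert K)
    (hv' : v' ∈ vert K) (hS : IsSeed P c dir n K π q v S) (hS' : IsSeed P c dir n K π q v' S')
    (hMS : M ∈ S) (hM : M ∈ preBlock P c K q G) (hMS' : M' ∈ S') (hM' : M' ∈ preBlock P c K q G) :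
    v = v' ∧ S = S' := by
  obtain ⟨N, hbot, hN, habove, hcase⟩ := h.seed_cases hG h0 hv hS hMS hM
  obtain ⟨N', hbot', hN', habove', hcase'⟩ := h.seed_cases hG h0 hv' hS' hMS' hM'
  obtain rfl := h.swept.isBottomFace_unique hG hbot hbot'
  have hvv : v = v' := by
    obtain ⟨y, hy⟩ := hN.2
    exact h.swept.linkAt_injective hv hv' ((h.isFace_of_linkAt hv hN).2 hy)
      ((h.isFace_of_linkAt hv' hN').2 hy)
  subst hvv
  refine ⟨rfl, ?_⟩
  have hlv := h.link v hv
  -- A middle face and its top face share a block of Q_v, by P2 in lower dimension. A block of Q_v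
  -- contributed by a vertex above `v` lies above H_v, whereas `M` meets H_v. So `N` cannot be
  -- claimed by both kinds of seeds.
  have hmixed : ∀ {M w S}, IsMiddle P c K q v M → IsTopFace P c K q M N →
      w ∈ vert (linkAt P c K v) → inner ℝ q v < inner ℝ q w → N ∈ S →
      S ∈ blocksAt P c dir (n - 1) (linkAt P c K v) (faceHull P {v} :: π) q w → False := by
    intro M w S hmid htop hw hlt hNS hS
    obtain ⟨w', hw', B, hB, hMB⟩ := (h.link_part v hv).cover M hmid.1
    obtain ⟨-, -, -, h1, h2, -⟩ := hlv.middle_cases h.swept h.dim_pos hv hmid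
    have hNB := (h.link_part v hv).top (h.dim_linkAt hv ▸ h2) M hmid.1 h1 w' hw' B hB hMB N
      ((hlv.isTopFace_iff h.swept.toIsTruncated h.dim_pos hv hmid.1).1 htop)
    obtain ⟨rfl, rfl⟩ := (h.link_part v hv).unique w hw w' hw' S hS B hB N hNS hNB
    obtain ⟨y, hy, hyv⟩ := hmid.2
    exact absurd hyv (h.link_above hv hw hlt hS hMB y hy).ne'
  rcases hcase with ⟨M₁, hmid, htop, w, hw, B, hB, hMB, rfl⟩ | ⟨w, hw, hlt, hNS, hS⟩
  · rcases hcase' with ⟨M₂, hmid', htop', w', hw', B', hB', hMB', rfl⟩ | ⟨w', hw', hlt', hNS', hS'⟩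
    · obtain rfl := hlv.middle_unique h.swept h.dim_pos hv hmid hmid' htop htop'
      have hcross := hlv.isCrossing_of_nonempty ⟨w, mem_of_mem_vert hw⟩
      rw [((h.slice_part v hv hcross).unique w hw w' hw' B hB B' hB' _ hMB hMB').2]
    · exact (hmixed hmid htop hw' hlt' hNS' hS').elim
  · rcases hcase' with ⟨M₂, hmid', htop', -⟩ | ⟨w', hw', hlt', hNS', hS'⟩
    · exact (hmixed hmid' htop' hw hlt hNS hS).elim
    · exact ((h.link_part v hv).unique w hw w' hw' S hS S' hS' N hNS hNS').2

theorem isPartitioned (h : IsStep P c dir n K L π q) : IsPartitioned P c dir n K π q where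
  isFace := by
    intro v hv B hB
    obtain ⟨S, hS, rfl⟩ := (mem_blocksAt_iff h.pos).1 hB
    have hlv := h.link v hv
    refine ⟨?_, ?_⟩
    · obtain ⟨M, hMS, hM⟩ : ∃ M ∈ S, IsFace (trunc P c (linkAt P c K v)) M := by
        rcases hS with ⟨-, w, hw, B₀, hB₀, rfl⟩ | ⟨w, hw, hlt, hS⟩
        · have hcross := hlv.isCrossing_of_nonempty ⟨w, mem_of_mem_vert hw⟩
          obtain ⟨⟨N, hN⟩, hBf⟩ := (h.slice_part v hv hcross).isFace w hw B₀ hB₀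
          obtain ⟨M, hM, rfl⟩ := hlv.exists_middle_of_isFace_slice (h.slice v hv hcross) (hBf N hN)
          exact ⟨M, ⟨hM, hN⟩, hM.1⟩
        · obtain ⟨⟨N, hN⟩, hBf⟩ := (h.link_part v hv).isFace w hw S hS
          exact ⟨N, hN, hBf N hN⟩
      obtain ⟨G, hG, h0, hMG⟩ := exists_preBlock h.swept h.dim_pos h.link
        (h.isFace_of_linkAt hv hM).1
      exact ⟨M, G, hG, h0, ⟨M, hMS, hMG⟩, hMG⟩
    · rintro X ⟨G, hG, -, -, hX⟩
      exact h.isFace_of_mem_preBlock hG hX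
  cover := by
    intro X hX
    obtain ⟨G, hG, h0, hXG⟩ := exists_preBlock h.swept h.dim_pos h.link hX
    obtain ⟨v, hv, S, hS, M, hMS, hM⟩ := h.exists_seed hG h0
    exact ⟨v, hv, _, (mem_blocksAt_iff h.pos).2 ⟨S, hS, rfl⟩, G, hG, h0, ⟨M, hMS, hM⟩, hXG⟩
  unique := by
    intro v hv v' hv' B hB B' hB' X hX hX'
    obtain ⟨S, hS, rfl⟩ := (mem_blocksAt_iff h.pos).1 hB
    obtain ⟨S', hS', rfl⟩ := (mem_blocksAt_iff h.pos).1 hB'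
    obtain ⟨G, hG, h0, ⟨M, hMS, hM⟩, hXG⟩ := hX
    obtain ⟨G', hG', h0', ⟨M', hMS', hM'⟩, hXG'⟩ := hX'
    obtain rfl := preBlock_unique h.swept h.dim_pos h.link hG hG' h0 h0' hXG hXG'
    obtain ⟨rfl, rfl⟩ := h.seed_unique hG h0 hv hv' hS hS' hMS hM hMS' hM'
    exact ⟨rfl, rfl⟩
  top := by
    intro _ G hG h0 v hv B hB hGB G' hG'
    obtain ⟨S, hS, rfl⟩ := (mem_blocksAt_iff h.pos).1 hB
    obtain ⟨G₁, hG₁, h01, hM, hGG₁⟩ := hGB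
    obtain rfl := preBlock_unique h.swept h.dim_pos h.link hG hG₁ h0 h01 (Or.inl (Or.inl rfl)) hGG₁
    exact ⟨G, hG, h0, hM, Or.inl (Or.inr (Or.inl hG'))⟩
  bottom := by
    intro _ v hv B hB G hGB
    obtain ⟨S, hS, rfl⟩ := (mem_blocksAt_iff h.pos).1 hB
    obtain ⟨G₁, hG₁, h01, ⟨M, hMS, hM⟩, hGG₁⟩ := hGB
    obtain ⟨N, hbot, hN, habove, -⟩ := h.seed_cases hG₁ h01 hv hS hMS hM
    exact ⟨G₁, N, hG₁, h01, hGG₁, hbot, (h.isFace_of_linkAt hv hN).2, habove⟩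

end IsStep

end Sweep

namespace Sweep

variable {E : Type*} [NormedAddCommGroup E] [InnerProductSpace ℝ E]

/-! ### Vertex figures -/

/-- The central projection of `S` from `v` to the hyperplane `l = -1`, with `v` as origin. Here
`β = l v` is the maximum of `l` on `S`. -/
def vertexFigure (l : E →L[ℝ] ℝ) (β : ℝ) (v : E) (S : Set E) : Set E :=
  {y | ∃ x ∈ S, x ≠ v ∧ y = (β - l x)⁻¹ • (x - v)}

section VertexFigure

variable {l : E →L[ℝ] ℝ} {β : ℝ} {v y : E} {K N : Set E}

theorem apply_vertexFigure (hlv : l v = β) (hl : ∀ x ∈ K, x ≠ v → l x < β)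
    (hy : y ∈ vertexFigure l β v K) : l y = -1 := by
  obtain ⟨x, hx, hne, rfl⟩ := hy
  have := hl x hx hne
  rw [map_smul, map_sub, hlv, smul_eq_mul]
  field_simp [show β - l x ≠ 0 by linarith]
  ring

theorem convex_vertexFigure (hK : Convex ℝ K) (hlv : l v = β) (hl : ∀ x ∈ K, x ≠ v → l x < β) :
    Convex ℝ (vertexFigure l β v K) := by
  rw [convex_iff_forall_pos]
  rintro _ ⟨x₁, hx₁, hne₁, rfl⟩ _ ⟨x₂, hx₂, hne₂, rfl⟩ s t hs ht hst
  have h₁ := hl x₁ hx₁ hne₁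
  have h₂ := hl x₂ hx₂ hne₂
  set g₁ := β - l x₁ with hg₁
  set g₂ := β - l x₂ with hg₂
  have hg₁' : 0 < g₁ := by linarith
  have hg₂' : 0 < g₂ := by linarith
  -- Projection divides by the depth, so the weights on the original points must be proportional to
  -- `s / g₁` and `t / g₂`. The point with these normalized weights has depth `σ⁻¹`.
  set σ := s / g₁ + t / g₂ with hσ
  have hσ0 : 0 < σ := by positivity
  have hsum : (s / g₁) / σ + (t / g₂) / σ = 1 := by rw [← add_div, ← hσ, div_self hσ0.ne']
  have hx := hK hx₁ hx₂ (by positivity : 0 ≤ (s / g₁) / σ) (by positivity : 0 ≤ (t / g₂) / σ) hsum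
  set x := ((s / g₁) / σ) • x₁ + ((t / g₂) / σ) • x₂ with hxdef
  have hlx : β - l x = σ⁻¹ := by
    have e1 : l x₁ = β - g₁ := by rw [hg₁]; ring
    have e2 : l x₂ = β - g₂ := by rw [hg₂]; ring
    rw [hxdef, map_add, map_smul, map_smul, smul_eq_mul, smul_eq_mul, e1, e2]
    have e3 : (s / g₁) / σ * g₁ + (t / g₂) / σ * g₂ = σ⁻¹ := by
      field_simp
      exact hst
    linear_combination e3 - β * hsum
  refine ⟨x, hx, fun he => ?_, ?_⟩
  · rw [he, hlv, sub_self] at hlx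
    exact (inv_pos.2 hσ0).ne hlx
  · have hxv : x - v = ((s / g₁) / σ) • (x₁ - v) + ((t / g₂) / σ) • (x₂ - v) := by
      rw [hxdef, smul_sub, smul_sub]
      have : v = ((s / g₁) / σ) • v + ((t / g₂) / σ) • v := by rw [← add_smul, hsum, one_smul]
      nth_rewrite 1 [this]
      abel
    rw [hlx, inv_inv, hxv, smul_add, smul_smul, smul_smul, smul_smul, smul_smul,
      mul_div_cancel₀ _ hσ0.ne', mul_div_cancel₀ _ hσ0.ne', div_eq_mul_inv, div_eq_mul_inv]

/-- The figure is spanned by the projections of the generators other than `v`. With `η₀` the least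
depth among these, scaling by `η₀` puts each projected generator on the segment from `v` to the
original one. -/
theorem vertexFigure_polytope (hK : IsPolytope K) (hv : v ∈ K) (hlv : l v = β)
    (hl : ∀ x ∈ K, x ≠ v → l x < β) (hne : ∃ x ∈ K, x ≠ v) :
    IsPolytope (vertexFigure l β v K) ∧
      ∃ η₀ : ℝ, 0 < η₀ ∧ ∀ y ∈ vertexFigure l β v K, v + η₀ • y ∈ K := by
  classical
  have hconv := hK.convex
  have hVc := convex_vertexFigure hconv hlv hl
  obtain ⟨s, hs, rfl⟩ := hK
  have hsK : ∀ x ∈ s, x ∈ convexHull ℝ (s : Set E) := fun x hx => subset_convexHull ℝ _ hx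
  set Y := (s.erase v).image fun x => (β - l x)⁻¹ • (x - v) with hY
  have hg : ∀ x ∈ s.erase v, 0 < β - l x := fun x hx => by
    have := hl x (hsK x (Finset.mem_of_mem_erase hx)) (Finset.ne_of_mem_erase hx)
    linarith
  have hVY : vertexFigure l β v (convexHull ℝ (s : Set E)) = convexHull ℝ (Y : Set E) := by
    apply Set.Subset.antisymm
    · rintro _ ⟨x, hx, hxv, rfl⟩
      have hlx := hl x hx hxv
      obtain ⟨w, hw0, hw1, hwx⟩ := Finset.mem_convexHull'.1 hx
      set g := β - l x with hgdef
      have hgpos : 0 < g := by linarith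
      have hxs : x - v = ∑ y ∈ s.erase v, w y • (y - v) := by
        rw [Finset.sum_erase _ (by simp)]
        simp only [smul_sub, Finset.sum_sub_distrib, ← Finset.sum_smul, hw1, one_smul, hwx]
      have hgs : g = ∑ y ∈ s.erase v, w y * (β - l y) := by
        have := congrArg l hxs
        simp only [map_sub, map_sum, map_smul, hlv, smul_eq_mul] at this
        have h2 : g = -(l x - β) := by rw [hgdef]; ring
        rw [h2, this, ← Finset.sum_neg_distrib]
        exact Finset.sum_congr rfl fun y _ => by ring
      have : g⁻¹ • (x - v) = ∑ y ∈ s.erase v, (w y * (β - l y) / g) • ((β - l y)⁻¹ • (y - v)) := by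
        rw [hxs, Finset.smul_sum]
        refine Finset.sum_congr rfl fun y hy => ?_
        have := (hg y hy).ne'
        rw [smul_smul, smul_smul]
        congr 1
        field_simp
      rw [this]
      refine (convex_convexHull ℝ _).sum_mem (fun y hy => ?_) ?_ fun y hy => ?_
      · have h1 := hw0 y (Finset.mem_of_mem_erase hy)
        have h2 := hg y hy
        positivity
      · rw [← Finset.sum_div, ← hgs, div_self hgpos.ne']
      · exact subset_convexHull ℝ _ (Finset.mem_coe.2 (Finset.mem_image_of_mem _ hy))
    · refine convexHull_min (fun y hy => ?_) hVc
      obtain ⟨x, hx, rfl⟩ := Finset.mem_image.1 (Finset.mem_coe.1 hy)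
      exact ⟨x, hsK x (Finset.mem_of_mem_erase hx), Finset.ne_of_mem_erase hx, rfl⟩
  have hYne : (s.erase v).Nonempty := by
    by_contra hemp
    rw [Finset.not_nonempty_iff_eq_empty] at hemp
    obtain ⟨x, hx, hxv⟩ := hne
    have hsub : (s : Set E) ⊆ {v} := fun y hy => by
      by_contra hyv
      have : y ∈ s.erase v := Finset.mem_erase.2 ⟨hyv, hy⟩
      rw [hemp] at this
      exact Finset.notMem_empty _ this
    exact hxv (convexHull_min hsub (convex_singleton v) hx)
  refine ⟨⟨Y, hYne.image _, hVY⟩, ?_⟩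
  obtain ⟨x₀, hx₀, hmin⟩ := (s.erase v).exists_min_image (fun x => β - l x) hYne
  refine ⟨β - l x₀, hg x₀ hx₀, ?_⟩
  rw [hVY]
  have hc : Convex ℝ ((AffineMap.const ℝ E v + (β - l x₀) • (AffineMap.id ℝ E)) ⁻¹'
    convexHull ℝ (s : Set E)) := hconv.affine_preimage _
  refine fun y hy => convexHull_min (fun y hy => ?_) hc hy
  obtain ⟨x, hx, rfl⟩ := Finset.mem_image.1 (Finset.mem_coe.1 hy)
  change v + (β - l x₀) • ((β - l x)⁻¹ • (x - v)) ∈ convexHull ℝ (s : Set E)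
  rw [smul_smul]
  have h1 := hg x hx
  have h2 := hg x₀ hx₀
  refine hconv.add_smul_sub_mem hv (hsK x (Finset.mem_of_mem_erase hx)) ⟨by positivity, ?_⟩
  rw [← div_eq_mul_inv, div_le_one h1]
  exact hmin x hx

theorem vertexFigure_eq_of_face {l' : E →L[ℝ] ℝ} (hl : ∀ x ∈ K, x ≠ v → l x < β)
    (hN : N = {x ∈ K | l' x = l' v}) :
    vertexFigure l β v N = {y ∈ vertexFigure l β v K | l' y = 0} := by
  have key : ∀ x ∈ K, x ≠ v → (l' ((β - l x)⁻¹ • (x - v)) = 0 ↔ l' x = l' v) := by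
    intro x hx hne
    have := hl x hx hne
    rw [map_smul, map_sub, smul_eq_mul, mul_eq_zero, inv_eq_zero, sub_eq_zero, sub_eq_zero]
    exact ⟨fun h => h.resolve_left this.ne', Or.inr⟩
  ext y
  constructor
  · rintro ⟨x, hx, hne, rfl⟩
    rw [hN] at hx
    exact ⟨⟨x, hx.1, hne, rfl⟩, (key x hx.1 hne).2 hx.2⟩
  · rintro ⟨⟨x, hx, hne, rfl⟩, h0⟩
    exact ⟨x, hN ▸ ⟨hx, (key x hx hne).1 h0⟩, hne, rfl⟩

theorem isFace_vertexFigure (hl : ∀ x ∈ K, x ≠ v → l x < β) (hN : IsFace K N) (hvN : v ∈ N)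
    (hne : N ≠ {v}) : IsFace (vertexFigure l β v K) (vertexFigure l β v N) := by
  obtain ⟨-, l', β', hl', hNe⟩ := isFace_iff.1 hN
  have hv' : l' v = β' := by rw [hNe] at hvN; exact hvN.2
  obtain ⟨x, hxN, hxv⟩ : ∃ x ∈ N, x ≠ v := by
    by_contra! hcon
    exact hne (Set.eq_singleton_iff_unique_mem.2 ⟨hvN, hcon⟩)
  rw [← hv'] at hNe hl'
  refine isFace_iff.2 ⟨⟨_, x, hxN, hxv, rfl⟩, l', 0, ?_, vertexFigure_eq_of_face hl hNe⟩
  rintro _ ⟨x, hx, hxv, rfl⟩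
  have h1 := hl' x hx
  have h2 := hl x hx hxv
  rw [map_smul, map_sub, smul_eq_mul]
  exact mul_nonpos_of_nonneg_of_nonpos (inv_nonneg.2 (by linarith)) (by linarith)

/-- Since `l = -1` on the figure, a functional `l'` with maximum `μ` there may be replaced by `l' +
μ • l`, whose maximum there is 0. The new functional attains its maximum over `K` at `v` and defines
the required face. -/
theorem exists_face_of_isFace_vertexFigure (hv : v ∈ K) (hlv : l v = β)
    (hl : ∀ x ∈ K, x ≠ v → l x < β) {N' : Set E} (hN' : IsFace (vertexFigure l β v K) N') :
    ∃ N, IsFace K N ∧ v ∈ N ∧ N ≠ {v} ∧ N' = vertexFigure l β v N := by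
  obtain ⟨⟨y, hy⟩, l', μ, hl', rfl⟩ := isFace_iff.1 hN'
  have hval : ∀ y ∈ vertexFigure l β v K, (l' + μ • l) y = l' y - μ := fun y hy => by
    rw [add_apply, smul_apply, apply_vertexFigure hlv hl hy, smul_eq_mul]
    ring
  have hle : ∀ x ∈ K, (l' + μ • l) x ≤ (l' + μ • l) v := by
    intro x hx
    by_cases hxv : x = v
    · rw [hxv]
    · have hg := hl x hx hxv
      have h1 := hval _ ⟨x, hx, hxv, rfl⟩
      have h2 := hl' _ ⟨x, hx, hxv, rfl⟩
      rw [map_smul, map_sub, smul_eq_mul] at h1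
      have h3 : (β - l x)⁻¹ * ((l' + μ • l) x - (l' + μ • l) v) ≤ 0 := by linarith
      have h4 : 0 < (β - l x)⁻¹ := inv_pos.2 (by linarith)
      nlinarith
  have heq := vertexFigure_eq_of_face (l' := l' + μ • l) hl (N := {x ∈ K | (l' + μ • l) x =
    (l' + μ • l) v}) rfl
  have heq' : {y ∈ vertexFigure l β v K | l' y = μ} = vertexFigure l β v
      {x ∈ K | (l' + μ • l) x = (l' + μ • l) v} := by
    rw [heq]
    ext y
    constructor
    · rintro ⟨h1, h2⟩
      exact ⟨h1, by rw [hval y h1, h2, sub_self]⟩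
    · rintro ⟨h1, h2⟩
      exact ⟨h1, by rw [hval y h1] at h2; linarith⟩
  refine ⟨_, isFace_of_support _ hle hv rfl, ⟨hv, rfl⟩, fun he => ?_, heq'⟩
  rw [he] at heq'
  obtain ⟨x, hx, hxv, -⟩ := heq'.le hy
  exact hxv hx

theorem eq_of_vertexFigure_eq (hl : ∀ x ∈ K, x ≠ v → l x < β) (hN : IsFace K N) (hvN : v ∈ N)
    (he : vertexFigure l β v N = vertexFigure l β v K) : N = K := by
  obtain ⟨-, l', β', hl', hNe⟩ := isFace_iff.1 hN
  have hv' : l' v = β' := by rw [hNe] at hvN; exact hvN.2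
  rw [← hv'] at hNe
  refine Set.Subset.antisymm hN.subset fun x hx => ?_
  by_cases hxv : x = v
  · exact hxv ▸ hvN
  have h1 : (β - l x)⁻¹ • (x - v) ∈ vertexFigure l β v N := he ▸ ⟨x, hx, hxv, rfl⟩
  rw [vertexFigure_eq_of_face hl hNe] at h1
  have h2 := h1.2
  have h3 := hl x hx hxv
  rw [map_smul, map_sub, smul_eq_mul, mul_eq_zero, inv_eq_zero, sub_eq_zero, sub_eq_zero] at h2
  rw [hNe]
  exact ⟨hx, h2.resolve_left h3.ne'⟩

/-- The linear span of the figure is the direction space of `S`. The figure lies in the hyperplane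
`l = -1`, so its own direction space is the kernel of `l` in that span, one dimension less. -/
theorem dim_vertexFigure [FiniteDimensional ℝ E] {S : Set E} (hv : v ∈ S) (hlv : l v = β)
    (hl : ∀ x ∈ S, x ≠ v → l x < β) (hne : ∃ x ∈ S, x ≠ v) :
    dim (vertexFigure l β v S) + 1 = dim S := by
  set Y := vertexFigure l β v S with hY
  have hly : ∀ y ∈ Y, l y = -1 := fun y hy => apply_vertexFigure hlv hl hy
  have hspan : Submodule.span ℝ Y = vectorSpan ℝ S := by
    rw [vectorSpan_eq_span_vsub_set_right ℝ hv]
    apply le_antisymm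
    · rw [Submodule.span_le]
      rintro _ ⟨x, hx, -, rfl⟩
      exact Submodule.smul_mem _ _ (Submodule.subset_span ⟨x, hx, rfl⟩)
    · rw [Submodule.span_le]
      rintro _ ⟨x, hx, rfl⟩
      change x - v ∈ Submodule.span ℝ Y
      by_cases hxv : x = v
      · rw [hxv, sub_self]; exact Submodule.zero_mem _
      · have hg := hl x hx hxv
        have : x - v = (β - l x) • ((β - l x)⁻¹ • (x - v)) := by
          rw [smul_smul, mul_inv_cancel₀ (by linarith), one_smul]
        rw [this]
        exact Submodule.smul_mem _ _ (Submodule.subset_span ⟨x, hx, hxv, rfl⟩)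
  obtain ⟨x₀, hx₀, hx₀v⟩ := hne
  have hy₀ : (β - l x₀)⁻¹ • (x₀ - v) ∈ Y := ⟨x₀, hx₀, hx₀v, rfl⟩
  set y₀ := (β - l x₀)⁻¹ • (x₀ - v)
  have hinf : Submodule.span ℝ Y ⊓ LinearMap.ker l.toLinearMap = vectorSpan ℝ Y := by
    apply le_antisymm
    · rintro u ⟨hu, hlu⟩
      have key : u + l u • y₀ ∈ vectorSpan ℝ Y := by
        clear hlu
        induction hu using Submodule.span_induction with
        | mem y hy =>
          rw [hly y hy, neg_one_smul, ← sub_eq_add_neg]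
          exact vsub_mem_vectorSpan ℝ hy hy₀
        | zero => simp
        | add x y _ _ hx hy =>
          rw [map_add, add_smul, add_add_add_comm]
          exact Submodule.add_mem _ hx hy
        | smul r x _ hx =>
          rw [map_smul, smul_eq_mul, mul_smul, ← smul_add]
          exact Submodule.smul_mem _ _ hx
      have hlu : l u = 0 := hlu
      rwa [hlu, zero_smul, add_zero] at key
    · refine le_inf ?_ (vectorSpan_le_ker l hly)
      rw [vectorSpan_def, Submodule.span_le]
      rintro _ ⟨x, hx, y, hy, rfl⟩
      exact Submodule.sub_mem _ (Submodule.subset_span hx) (Submodule.subset_span hy)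
  have := finrank_inf_ker (Submodule.span ℝ Y) l (Submodule.subset_span hy₀)
    (by rw [hly y₀ hy₀]; norm_num)
  rw [hinf, hspan] at this
  exact this

end VertexFigure

/-! ### Hyperplane sections -/

theorem isFace_section {Q N : Set E} {l : E →L[ℝ] ℝ} (hN : IsFace Q N) (hne : ∃ x ∈ N, l x = 0) :
    IsFace {x ∈ Q | l x = 0} {x ∈ N | l x = 0} := by
  obtain ⟨-, l', β, hl', rfl⟩ := isFace_iff.1 hN
  obtain ⟨x, hx, hx0⟩ := hne
  refine isFace_iff.2 ⟨⟨x, hx, hx0⟩, l', β, fun x hx => hl' x hx.1, ?_⟩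
  ext y
  simp only [Set.mem_ofPred_eq]
  tauto

section Section

variable [FiniteDimensional ℝ E] {Q N : Set E} {l : E →L[ℝ] ℝ}

/-- Start from a relative interior point `z₀`. A segment from `z₀` to any point stays relatively
interior up to its far end, and one towards the opposite side crosses the hyperplane before that
end. -/
theorem exists_isRelInt_section (hQ : IsPolytope Q) (hpos : ∃ x ∈ Q, 0 < l x)
    (hneg : ∃ x ∈ Q, l x < 0) : ∃ z, IsRelInt Q z ∧ l z = 0 := by
  obtain ⟨z₀, hz₀⟩ := hQ.exists_isRelInt
  have key : ∀ y ∈ Q, ∀ s : ℝ, 0 ≤ s → s < 1 → IsRelInt Q (z₀ + s • (y - z₀)) := by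
    intro y hy s hs0 hs1
    have hmem : z₀ + s • (y - z₀) ∈ Q := hQ.convex.add_smul_sub_mem hz₀.1 hy ⟨hs0, hs1.le⟩
    refine ⟨hmem, fun u hu => ?_⟩
    obtain ⟨δ, hδ, h1⟩ := hz₀.2 u hu
    refine ⟨(1 - s) * δ, mul_pos (by linarith) hδ, ?_⟩
    have := hQ.convex h1 hy (by linarith : 0 ≤ 1 - s) hs0 (by ring)
    convert this using 1
    rw [smul_add, smul_smul, smul_sub, sub_smul, one_smul]
    abel
  have cross : ∀ y ∈ Q, l z₀ * l y < 0 → ∃ z, IsRelInt Q z ∧ l z = 0 := by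
    intro y hy hlt
    have hne : l z₀ - l y ≠ 0 := by
      intro h0
      have : l z₀ = l y := by linarith
      rw [this] at hlt
      nlinarith [mul_self_nonneg (l y)]
    refine ⟨_, key y hy (l z₀ / (l z₀ - l y)) ?_ ?_, ?_⟩
    · rcases lt_or_gt_of_ne hne with h1 | h1
      · exact div_nonneg_of_nonpos (by nlinarith) h1.le
      · exact div_nonneg (by nlinarith) h1.le
    · rcases lt_or_gt_of_ne hne with h1 | h1
      · rw [div_lt_one_of_neg h1]; nlinarith
      · rw [div_lt_one h1]; nlinarith
    · rw [map_add, map_smul, map_sub, smul_eq_mul]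
      field_simp
      ring
  rcases lt_trichotomy (l z₀) 0 with h0 | h0 | h0
  · obtain ⟨x, hx, hx'⟩ := hpos
    exact cross x hx (mul_neg_of_neg_of_pos h0 hx')
  · exact ⟨z₀, hz₀, h0⟩
  · obtain ⟨x, hx, hx'⟩ := hneg
    exact cross x hx (mul_neg_of_pos_of_neg h0 hx')

theorem dim_section (hQ : IsPolytope Q) (hpos : ∃ x ∈ Q, 0 < l x) (hneg : ∃ x ∈ Q, l x < 0) :
    dim {x ∈ Q | l x = 0} + 1 = dim Q := by
  obtain ⟨z, hz, hlz⟩ := exists_isRelInt_section hQ hpos hneg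
  obtain ⟨x, hx, hxl⟩ := hpos
  have := finrank_inf_ker (vectorSpan ℝ Q) l (vsub_mem_vectorSpan ℝ hx hz.1)
    (by rw [vsub_eq_sub, map_sub, hlz, sub_zero]; exact hxl.ne')
  have heq : vectorSpan ℝ {x ∈ Q | l x = 0} = vectorSpan ℝ Q ⊓ LinearMap.ker l.toLinearMap := by
    apply le_antisymm
    · exact le_inf (vectorSpan_mono ℝ fun x hx => hx.1) (vectorSpan_le_ker l fun x hx => hx.2)
    · rintro u ⟨hu, hlu⟩
      have hlu : l u = 0 := hlu
      obtain ⟨δ, hδ, h1⟩ := hz.2 u hu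
      have h2 : z + δ • u ∈ {x ∈ Q | l x = 0} := ⟨h1, by rw [map_add, map_smul, hlz, hlu]; simp⟩
      have h3 := vsub_mem_vectorSpan ℝ h2 (⟨hz.1, hlz⟩ : z ∈ {x ∈ Q | l x = 0})
      rw [vsub_eq_sub, add_sub_cancel_left] at h3
      exact (Submodule.smul_mem_iff _ hδ.ne').1 h3
  rw [dim, dim, heq, this]

/-- Extreme subsets of a hyperplane section are sections of faces. -/
theorem exists_face_of_isExtreme_section (hQ : IsPolytope Q) {S : Set E}
    (hS : IsExtreme ℝ {x ∈ Q | l x = 0} S) {z : E} (hz : z ∈ S) :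
    ∃ N, IsFace Q N ∧ IsRelInt N z ∧ N ∩ {x | l x = 0} ⊆ S := by
  have hzQ := hS.1 hz
  obtain ⟨N, hN, hzN⟩ := hQ.exists_face_isRelInt hzQ.1
  refine ⟨N, hN, hzN, fun y hy => ?_⟩
  obtain ⟨δ, hδ, hmem⟩ := hzN.2 (z - y) (vsub_mem_vectorSpan ℝ hzN.1 hy.1)
  have hly : l y = 0 := hy.2
  refine hS.2 (⟨hN.subset hy.1, hly⟩ : y ∈ {x ∈ Q | l x = 0}) (y := z + δ • (z - y))
    ⟨hN.subset hmem, by rw [map_add, map_smul, map_sub, hzQ.2, hly]; simp⟩ hz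
    ⟨δ / (1 + δ), 1 / (1 + δ), by positivity, by positivity, ?_, ?_⟩
  · field_simp
    ring
  · have h1 : z + δ • (z - y) = (1 + δ) • z - δ • y := by rw [smul_sub, add_smul, one_smul]; abel
    rw [h1, smul_sub, smul_smul, smul_smul, one_div, inv_mul_cancel₀ (by positivity), one_smul,
      div_eq_inv_mul]
    abel

/-- An extreme point of the section is the only point in which the hyperplane meets the face of `Q`
having that point in its relative interior. So there are finitely many extreme points, and
Krein–Milman applies. -/
theorem isPolytope_section (hQ : IsPolytope Q) (hne : ∃ x ∈ Q, l x = 0) :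
    IsPolytope {x ∈ Q | l x = 0} := by
  have hcomp : IsCompact {x ∈ Q | l x = 0} :=
    hQ.isCompact.inter_right (isClosed_eq l.continuous continuous_const)
  have hconv : Convex ℝ {x ∈ Q | l x = 0} :=
    hQ.convex.inter ((convex_singleton (0 : ℝ)).linear_preimage l.toLinearMap)
  have hfin : ({x ∈ Q | l x = 0}.extremePoints ℝ).Finite := by
    have hex : ∀ z ∈ {x ∈ Q | l x = 0}.extremePoints ℝ, ∃ N, IsFace Q N ∧
        N ∩ {x | l x = 0} = {z} := by
      intro z hz
      obtain ⟨N, hN, hzN, hsub⟩ := exists_face_of_isExtreme_section hQ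
        (isExtreme_singleton.2 hz) rfl
      exact ⟨N, hN, Set.Subset.antisymm hsub (by simpa using ⟨hzN.1, hz.1.2⟩)⟩
    choose! f hf hfz using hex
    refine Set.Finite.of_finite_image (f := f) (hQ.finite_faces.subset ?_) ?_
    · rintro _ ⟨z, hz, rfl⟩
      exact hf z hz
    · intro z hz z' hz' he
      have h1 := hfz z hz
      rw [he, hfz z' hz'] at h1
      exact (Set.singleton_injective h1).symm
  refine ⟨hfin.toFinset, ?_, ?_⟩
  · obtain ⟨x, hx⟩ := hne
    obtain ⟨z, hz⟩ := hcomp.extremePoints_nonempty ⟨x, hx⟩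
    exact ⟨z, by simpa using hz⟩
  · have h1 := closure_convexHull_extremePoints hcomp hconv
    rw [Set.Finite.coe_toFinset]
    rw [(hfin.isClosed_convexHull ℝ).closure_eq] at h1
    exact h1.symm

/-- A face without vertices on the hyperplane that meets the hyperplane has points on both sides. -/
theorem crossing_of_nonempty (hQ : IsPolytope Q) (hvert : ∀ w ∈ vert Q, l w ≠ 0)
    (hne : ∃ x ∈ Q, l x = 0) : (∃ x ∈ Q, 0 < l x) ∧ ∃ x ∈ Q, l x < 0 := by
  obtain ⟨z, hz, hlz⟩ := hne
  constructor
  · obtain ⟨w, hw, hmax⟩ := hQ.exists_vert_max l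
    exact ⟨w, mem_of_mem_vert hw, lt_of_le_of_ne (hlz ▸ hmax z hz) (hvert w hw).symm⟩
  · obtain ⟨w, hw, hmax⟩ := hQ.exists_vert_max (-l)
    have := hmax z hz
    simp only [neg_apply, hlz, neg_zero] at this
    exact ⟨w, mem_of_mem_vert hw, lt_of_le_of_ne (by linarith) (hvert w hw)⟩

theorem section_ne (hQ : IsPolytope Q) (hpos : ∃ x ∈ Q, 0 < l x) (hneg : ∃ x ∈ Q, l x < 0)
    (hN : IsFace Q N) (hne : N ≠ Q) : {x ∈ N | l x = 0} ≠ {x ∈ Q | l x = 0} := by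
  intro he
  obtain ⟨z, hz, hlz⟩ := exists_isRelInt_section hQ hpos hneg
  have hzN : z ∈ {x ∈ N | l x = 0} := by rw [he]; exact ⟨hz.1, hlz⟩
  exact hne (Set.Subset.antisymm hN.subset
    (hz.subset_of_mem_face subset_rfl hN.isExtreme hzN.1))

theorem exists_face_of_isFace_section (hQ : IsPolytope Q) {N' : Set E}
    (hN' : IsFace {x ∈ Q | l x = 0} N') :
    ∃ N, IsFace Q N ∧ N' = {x ∈ N | l x = 0} := by
  have hS := isPolytope_section hQ (by
    obtain ⟨x, hx⟩ := hN'.2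
    exact ⟨x, hN'.subset hx⟩)
  obtain ⟨z, hz⟩ := (hS.face hN').exists_isRelInt
  obtain ⟨N, hN, hzN, hsub⟩ := exists_face_of_isExtreme_section hQ hN'.isExtreme hz.1
  refine ⟨N, hN, Set.Subset.antisymm (fun x hx => ⟨?_, (hN'.subset hx).2⟩) hsub⟩
  exact hz.subset_of_mem_face (fun x hx => (hN'.subset hx).1) hN.isExtreme hzN.1 hx

end Section

end Sweep

namespace Sweep

open Filter Topology

variable {E : Type*} [NormedAddCommGroup E] [InnerProductSpace ℝ E]

/-! ### Homothetic copies -/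

/-- The copy of `S` scaled by `r` and translated by `z`. -/
def place (z : E) (r : ℝ) (S : Set E) : Set E := (fun y => z + r • y) '' S

section Place

variable {z : E} {r : ℝ} {S S' K N : Set E} {x y : E}

theorem place_injective (hr : r ≠ 0) : Function.Injective fun y : E => z + r • y := fun x y h => by
  simpa [hr] using h

theorem mem_place_iff (hr : r ≠ 0) : z + r • y ∈ place z r S ↔ y ∈ S :=
  (place_injective hr).mem_set_image

theorem mem_place (hy : y ∈ S) : z + r • y ∈ place z r S := ⟨y, hy, rfl⟩

theorem place_subset_iff (hr : r ≠ 0) : place z r S ⊆ place z r S' ↔ S ⊆ S' :=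
  Set.image_subset_image_iff (place_injective hr)

theorem place_inj (hr : r ≠ 0) : place z r S = place z r S' ↔ S = S' :=
  (place_injective hr).image_injective.eq_iff

theorem vectorSpan_place (hr : r ≠ 0) : vectorSpan ℝ (place z r S) = vectorSpan ℝ S := by
  apply le_antisymm
  · rw [vectorSpan_def, Submodule.span_le]
    rintro _ ⟨_, ⟨x, hx, rfl⟩, _, ⟨y, hy, rfl⟩, rfl⟩
    change z + r • x - (z + r • y) ∈ vectorSpan ℝ S
    rw [add_sub_add_left_eq_sub, ← smul_sub]
    exact Submodule.smul_mem _ _ (vsub_mem_vectorSpan ℝ hx hy)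
  · rw [vectorSpan_def, Submodule.span_le]
    rintro _ ⟨x, hx, y, hy, rfl⟩
    change x - y ∈ vectorSpan ℝ (place z r S)
    have := vsub_mem_vectorSpan ℝ (mem_place (z := z) (r := r) hx) (mem_place hy)
    rw [vsub_eq_sub, add_sub_add_left_eq_sub, ← smul_sub] at this
    exact (Submodule.smul_mem_iff _ hr).1 this

theorem dim_place (hr : r ≠ 0) : dim (place z r S) = dim S := by
  rw [dim, dim, vectorSpan_place hr]

theorem isFace_place_iff (hr : r ≠ 0) : IsFace (place z r K) (place z r N) ↔ IsFace K N := by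
  rw [isFace_iff, isFace_iff]
  refine and_congr Set.image_nonempty ⟨?_, ?_⟩
  · rintro ⟨l, β, hl, he⟩
    refine ⟨r • l, β - l z, fun y hy => ?_, ?_⟩
    · have := hl _ (mem_place hy)
      rw [map_add, map_smul, smul_eq_mul] at this
      rw [smul_apply, smul_eq_mul]
      linarith
    · ext y
      rw [← mem_place_iff (z := z) hr, he]
      simp only [Set.mem_ofPred_eq, mem_place_iff hr, map_add, map_smul, smul_apply, smul_eq_mul]
      exact and_congr_right fun _ => ⟨fun h => by linarith, fun h => by linarith⟩
  · rintro ⟨l, β, hl, rfl⟩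
    have hval : ∀ y, (r⁻¹ • l) (z + r • y) = r⁻¹ * l z + l y := fun y => by
      rw [smul_apply, map_add, map_smul, smul_eq_mul, smul_eq_mul]
      field_simp
    refine ⟨r⁻¹ • l, r⁻¹ * l z + β, ?_, ?_⟩
    · rintro _ ⟨y, hy, rfl⟩
      rw [hval]
      linarith [hl y hy]
    · ext x
      constructor
      · rintro ⟨y, ⟨hy, hyβ⟩, rfl⟩
        exact ⟨mem_place hy, by rw [hval, hyβ]⟩
      · rintro ⟨⟨y, hy, rfl⟩, h⟩
        rw [hval] at h
        exact ⟨y, ⟨hy, by linarith⟩, rfl⟩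

theorem exists_isFace_of_isFace_place (hr : r ≠ 0) (hN : IsFace (place z r K) N) :
    ∃ N', IsFace K N' ∧ N = place z r N' := by
  obtain ⟨N', -, rfl⟩ := Set.subset_image_iff.1 hN.subset
  exact ⟨N', (isFace_place_iff hr).1 hN, rfl⟩

theorem place_singleton : place z r {y} = {z + r • y} := Set.image_singleton

theorem mem_vert_place_iff (hr : r ≠ 0) : z + r • y ∈ vert (place z r K) ↔ y ∈ vert K := by
  change IsFace _ _ ↔ IsFace _ _
  rw [← place_singleton, isFace_place_iff hr]

theorem exists_of_mem_vert_place (hr : r ≠ 0) (hx : x ∈ vert (place z r K)) :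
    ∃ v ∈ vert K, x = z + r • v := by
  obtain ⟨v, hv, rfl⟩ := mem_of_mem_vert hx
  exact ⟨v, (mem_vert_place_iff hr).1 hx, rfl⟩

theorem isPolytope_place (hK : IsPolytope K) : IsPolytope (place z r K) := by
  classical
  obtain ⟨s, hs, rfl⟩ := hK
  refine ⟨s.image fun y => z + r • y, hs.image _, ?_⟩
  have := (AffineMap.const ℝ E z + r • AffineMap.id ℝ E).image_convexHull (s : Set E)
  rw [Finset.coe_image]
  exact this

theorem isRelInt_place (hr : 0 < r) (hy : IsRelInt S y) : IsRelInt (place z r S) (z + r • y) := by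
  refine ⟨mem_place hy.1, fun u hu => ?_⟩
  rw [vectorSpan_place hr.ne'] at hu
  obtain ⟨δ, hδ, h⟩ := hy.2 u hu
  refine ⟨r * δ, by positivity, ?_⟩
  have := mem_place (z := z) (r := r) h
  rwa [smul_add, ← add_assoc, smul_smul] at this

end Place

theorem IsPolytope.exists_two_vert [FiniteDimensional ℝ E] {K : Set E} (hK : IsPolytope K)
    (hd : 0 < dim K) : ∃ v ∈ vert K, ∃ w ∈ vert K, v ≠ w := by
  have : ¬ K.Subsingleton := fun h => hd.ne' (dim_eq_zero_of_subsingleton h)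
  obtain ⟨x, hx, y, hy, hne⟩ := Set.not_subsingleton_iff.1 this
  obtain ⟨v, hv, hmax⟩ := hK.exists_vert_max (innerSL ℝ (x - y))
  obtain ⟨w, hw, hmin⟩ := hK.exists_vert_max (innerSL ℝ (y - x))
  refine ⟨v, hv, w, hw, fun he => hne ?_⟩
  subst he
  have h1 : inner ℝ (x - y) x ≤ inner ℝ (x - y) v := hmax x hx
  have h2 : inner ℝ (y - x) y ≤ inner ℝ (y - x) v := hmin y hy
  have h3 : inner ℝ (x - y) (x - y) ≤ 0 := by
    rw [← neg_sub x y, inner_neg_left, inner_neg_left] at h2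
    rw [inner_sub_right]
    linarith
  exact sub_eq_zero.1 (inner_self_eq_zero.1 (le_antisymm h3 real_inner_self_nonneg))

theorem tendsto_pow_nhdsGT_zero {n : ℕ} (hn : n ≠ 0) :
    Tendsto (fun ε : ℝ => ε ^ n) (𝓝[>] 0) (𝓝 0) := by
  have : Continuous fun ε : ℝ => ε ^ n := continuous_pow n
  have h := this.tendsto 0
  rw [zero_pow hn] at h
  exact h.mono_left nhdsWithin_le_nhds

theorem eventually_pos : ∀ᶠ ε : ℝ in 𝓝[>] 0, 0 < ε := self_mem_nhdsWithin

/-! ### Families of sections of `P` -/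

/-- Data for a family of sections `z ε + ε ^ k • K` of `P`: the section of a face `F` in `L`
corresponds to the face `⟪a F, y⟫ = β F` of `K`, and a face of dimension `i` of `K` is truncated at
depth `ε ^ (i + m)`. -/
structure Germ (E : Type*) where
  /-- the rescaled section -/
  K : Set E
  /-- the position of its origin -/
  z : ℝ → E
  /-- the exponent of the scale -/
  k : ℕ
  /-- the exponent of the depth at which vertices are truncated -/
  m : ℕ
  /-- the faces of `P` that correspond to the proper faces of `K` -/
  L : Set (Set E)
  /-- the constant terms of the equations of these faces -/
  β : Set E → ℝ

namespace Germ

/-- The section of `P` with parameter `ε`. -/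
def sect (g : Germ E) (ε : ℝ) : Set E := place (g.z ε) (ε ^ g.k) g.K

/-- The face of `K` that corresponds to `F`. -/
def face (g : Germ E) (a : Set E → E) (F : Set E) : Set E := {y ∈ g.K | inner ℝ (a F) y = g.β F}

end Germ

/-- The properties of the families of sections that occur in the recursion. -/
structure IsGerm (P : Set E) (a : Set E → E) (b : Set E → ℝ) (g : Germ E) : Prop where
  poly : IsPolytope g.K
  m_pos : 1 ≤ g.m
  proper : ∀ F ∈ g.L, IsFace P F ∧ F ≠ P
  supp : ∀ F ∈ g.L, ∀ y ∈ g.K, inner ℝ (a F) y ≤ g.β F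
  faces : ∀ N, (IsFace g.K N ∧ N ≠ g.K) ↔ ∃ F ∈ g.L, N = g.face a F
  dim_eq : ∀ F ∈ g.L, dim F + 1 = g.k + dim (g.face a F) + g.m
  shift : ∀ F ∈ g.L, ∀ ε, b F - inner ℝ (a F) (g.z ε) = ε ^ g.k * g.β F
  sub : ∀ᶠ ε in 𝓝[>] 0, g.sect ε ⊆ P
  out : ∀ᶠ ε in 𝓝[>] 0, ∀ F, IsFace P F → F ≠ P → F ∉ g.L → ∀ x ∈ g.sect ε, 0 ≤ cut a b ε F x
  hull : ∀ᶠ ε in 𝓝[>] 0, ∀ F ∈ g.L, ∀ F', IsFace P F' → F ∩ g.sect ε ⊆ F' → F ⊆ F'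

namespace IsGerm

variable {P : Set E} {a : Set E → E} {b : Set E → ℝ} {g : Germ E} {F F' : Set E} {y v : E} {ε : ℝ}

theorem isFace (h : IsGerm P a b g) (hF : F ∈ g.L) : IsFace g.K (g.face a F) :=
  ((h.faces _).2 ⟨F, hF, rfl⟩).1

theorem face_ne (h : IsGerm P a b g) (hF : F ∈ g.L) : g.face a F ≠ g.K :=
  ((h.faces _).2 ⟨F, hF, rfl⟩).2

theorem finite (h : IsGerm P a b g) (hP : IsPolytope P) : g.L.Finite :=
  hP.finite_faces.subset fun F hF => (h.proper F hF).1

theorem sub_inner (h : IsGerm P a b g) (hF : F ∈ g.L) :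
    b F - inner ℝ (a F) (g.z ε + ε ^ g.k • y) = ε ^ g.k * (g.β F - inner ℝ (a F) y) := by
  rw [inner_add_right, inner_smul_right]
  linear_combination h.shift F hF ε

/-- Up to the positive factor `ε ^ g.k` the truncation takes place on the fixed polytope `g.K` with
fixed functionals; only the depth still depends on `ε`. All estimates are made in these coordinates.
-/
theorem cut_eq (h : IsGerm P a b g) (hF : F ∈ g.L) :
    cut a b ε F (g.z ε + ε ^ g.k • y) =
      ε ^ g.k * (g.β F - inner ℝ (a F) y - ε ^ (dim (g.face a F) + g.m)) := by
  rw [cut, h.sub_inner hF, h.dim_eq F hF, add_assoc, pow_add]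
  ring

theorem inter_sect (hab : IsSupportFamily P a b) (h : IsGerm P a b g) :
    ∀ᶠ ε in 𝓝[>] 0, ∀ F ∈ g.L, F ∩ g.sect ε = place (g.z ε) (ε ^ g.k) (g.face a F) := by
  filter_upwards [h.sub, eventually_pos] with ε hsub hε F hF
  obtain ⟨hP, hne⟩ := h.proper F hF
  have hFe := (hab F hP hne).2
  have hpos : ε ^ g.k ≠ 0 := by positivity
  ext x
  constructor
  · rintro ⟨hx, y, hy, rfl⟩
    refine mem_place ⟨hy, ?_⟩
    rw [hFe] at hx
    have h1 := h.sub_inner (ε := ε) (y := y) hF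
    rw [hx.2, sub_self, eq_comm, mul_eq_zero] at h1
    linarith [h1.resolve_left hpos]
  · rintro ⟨y, ⟨hy, hyF⟩, rfl⟩
    have hmem : g.z ε + ε ^ g.k • y ∈ g.sect ε := mem_place hy
    refine ⟨?_, hmem⟩
    rw [hFe]
    refine ⟨hsub hmem, ?_⟩
    have h1 := h.sub_inner (ε := ε) (y := y) hF
    rw [hyF, sub_self, mul_zero] at h1
    linarith

theorem face_subset_iff (hab : IsSupportFamily P a b) (h : IsGerm P a b g) (hF : F ∈ g.L)
    (hF' : F' ∈ g.L) : g.face a F ⊆ g.face a F' ↔ F ⊆ F' := by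
  obtain ⟨ε, ⟨h1, h2⟩, hε⟩ := (((h.inter_sect hab).and h.hull).and eventually_pos).exists
  have hpos : ε ^ g.k ≠ 0 := by positivity
  rw [← place_subset_iff (z := g.z ε) hpos, ← h1 F hF, ← h1 F' hF']
  constructor
  · intro hs
    exact h2 F hF F' (h.proper F' hF').1 (hs.trans Set.inter_subset_left)
  · exact fun hs => Set.inter_subset_inter_left _ hs

/-- Points on the hyperplane that truncates `F` are close to the section of `F`. -/
theorem eventually_lt (h : IsGerm P a b g) (hF : F ∈ g.L) (l : E →L[ℝ] ℝ) {μ : ℝ}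
    (hl : ∀ y ∈ g.face a F, μ < l y) : ∀ᶠ ε in 𝓝[>] 0, ∀ y ∈ g.K,
      cut a b ε F (g.z ε + ε ^ g.k • y) = 0 → μ < l y := by
  have hface := h.isFace hF
  obtain ⟨y₀, hy₀, hmin⟩ := (h.poly.face hface).isCompact.exists_isMinOn hface.2
    l.continuous.continuousOn
  obtain ⟨M, hM, hdom⟩ := h.poly.exists_dominate (l := innerSL ℝ (a F)) (β := g.β F) (l' := -l)
    (β' := -l y₀) (h.supp F hF) (fun y hy he => by
      have : l y₀ ≤ l y := hmin (⟨hy, he⟩ : y ∈ g.face a F)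
      simpa using this)
  have hn : dim (g.face a F) + g.m ≠ 0 := by have := h.m_pos; omega
  have hμ := hl y₀ hy₀
  have ht := (tendsto_pow_nhdsGT_zero hn).const_mul M
  rw [mul_zero] at ht
  filter_upwards [eventually_pos, ht.eventually (gt_mem_nhds (sub_pos.2 hμ))] with ε hε hlt y hy h0
  rw [h.cut_eq hF, mul_eq_zero] at h0
  have h1 := h0.resolve_left (by positivity)
  have h2 := hdom y hy
  rw [innerSL_apply_apply, neg_apply, show g.β F - inner ℝ (a F) y =
    ε ^ (dim (g.face a F) + g.m) by linarith] at h2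
  linarith

/-- At a common zero the slacks of `F` and `F'` are powers of ε with exponents governed by their
dimensions. Their sum vanishes only on the intersection and hence dominates, up to a constant, the
slack of the intersection `F₀`. If `F` and `F'` are incomparable, `F₀` has smaller dimension, so its
slack would be below its own truncation depth. -/
theorem comparable [FiniteDimensional ℝ E] (hP : IsPolytope P) (hab : IsSupportFamily P a b)
    (h : IsGerm P a b g) :
    ∀ᶠ ε in 𝓝[>] 0, ∀ x ∈ g.sect ε, (∀ F ∈ g.L, 0 ≤ cut a b ε F x) → ∀ F ∈ g.L, ∀ F' ∈ g.L,
      cut a b ε F x = 0 → cut a b ε F' x = 0 → F ⊆ F' ∨ F' ⊆ F := by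
  have hfin := h.finite hP
  suffices hs : ∀ F ∈ g.L, ∀ F' ∈ g.L, ¬ (F ⊆ F' ∨ F' ⊆ F) → ∀ᶠ ε in 𝓝[>] 0, ∀ y ∈ g.K,
      (∀ F ∈ g.L, 0 ≤ cut a b ε F (g.z ε + ε ^ g.k • y)) →
      cut a b ε F (g.z ε + ε ^ g.k • y) = 0 → cut a b ε F' (g.z ε + ε ^ g.k • y) = 0 → False by
    have hs' : ∀ᶠ ε in 𝓝[>] 0, ∀ F ∈ g.L, ∀ F' ∈ g.L, ¬ (F ⊆ F' ∨ F' ⊆ F) → ∀ y ∈ g.K,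
        (∀ F ∈ g.L, 0 ≤ cut a b ε F (g.z ε + ε ^ g.k • y)) →
        cut a b ε F (g.z ε + ε ^ g.k • y) = 0 → cut a b ε F' (g.z ε + ε ^ g.k • y) = 0 → False := by
      refine (eventually_all_finite hfin).2 fun F hF => (eventually_all_finite hfin).2
        fun F' hF' => ?_
      by_cases hc : F ⊆ F' ∨ F' ⊆ F
      · exact Eventually.of_forall fun _ hn => absurd hc hn
      · exact (hs F hF F' hF' hc).mono fun _ h _ => h
    filter_upwards [hs'] with ε hε x hx hnn F hF F' hF' h0 h0'
    obtain ⟨y, hy, rfl⟩ := hx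
    by_contra hc
    exact hε F hF F' hF' hc y hy hnn h0 h0'
  intro F hF F' hF' hc
  have hm := h.m_pos
  have hn : dim (g.face a F) + g.m ≠ 0 := by omega
  have hn' : dim (g.face a F') + g.m ≠ 0 := by omega
  have hzero : ∀ {ε : ℝ}, 0 < ε → ∀ {F y}, F ∈ g.L →
      cut a b ε F (g.z ε + ε ^ g.k • y) = 0 →
      g.β F - inner ℝ (a F) y = ε ^ (dim (g.face a F) + g.m) := by
    intro ε hε F y hF h0
    rw [h.cut_eq hF, mul_eq_zero] at h0
    linarith [h0.resolve_left (by positivity)]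
  set l := innerSL ℝ (a F) + innerSL ℝ (a F') with hl
  have hle : ∀ y ∈ g.K, l y ≤ g.β F + g.β F' := fun y hy =>
    add_le_add (h.supp F hF y hy) (h.supp F' hF' y hy)
  have hleq : ∀ y ∈ g.K, l y = g.β F + g.β F' → y ∈ g.face a F ∩ g.face a F' := by
    intro y hy he
    have h1 := h.supp F hF y hy
    have h2 := h.supp F' hF' y hy
    have he : inner ℝ (a F) y + inner ℝ (a F') y = g.β F + g.β F' := he
    exact ⟨⟨hy, by linarith⟩, hy, by linarith⟩
  rcases (g.face a F ∩ g.face a F').eq_empty_or_nonempty with hemp | hne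
  -- With an empty intersection the dominated function may be the constant 1, encoded by `l' = 0`
  -- and `β' = -1`: the sum of the slacks is then bounded away from 0.
  · obtain ⟨M, hM, hdom⟩ := h.poly.exists_dominate (l := l) (l' := 0) (β' := -1) hle
      (fun y hy he => by
        have := hleq y hy he
        rw [hemp] at this
        exact absurd this (Set.notMem_empty _))
    have ht := ((tendsto_pow_nhdsGT_zero hn).add (tendsto_pow_nhdsGT_zero hn')).const_mul M
    rw [add_zero, mul_zero] at ht
    filter_upwards [eventually_pos, ht.eventually (gt_mem_nhds one_pos)] with ε hε hlt y hy _ h0 h0'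
    have h1 := hdom y hy
    have h2 : g.β F + g.β F' - l y = ε ^ (dim (g.face a F) + g.m) +
        ε ^ (dim (g.face a F') + g.m) := by
      rw [← hzero hε hF h0, ← hzero hε hF' h0', hl, add_apply, innerSL_apply_apply,
        innerSL_apply_apply]
      ring
    rw [h2, zero_apply] at h1
    linarith
  · have hint := (h.isFace hF).inter (h.isFace hF') hne
    have hintne : g.face a F ∩ g.face a F' ≠ g.K := fun he => h.face_ne hF
      (Set.Subset.antisymm (h.isFace hF).subset (he ▸ Set.inter_subset_left))
    obtain ⟨F₀, hF₀, he⟩ := (h.faces _).1 ⟨hint, hintne⟩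
    have hd : dim (g.face a F₀) < dim (g.face a F) := by
      rw [← he]
      refine (hint.mono Set.inter_subset_left (h.isFace hF).subset).dim_lt fun he' => hc (Or.inl ?_)
      exact (h.face_subset_iff hab hF hF').1 (Set.inter_eq_left.1 he')
    have hd' : dim (g.face a F₀) < dim (g.face a F') := by
      rw [← he]
      refine (hint.mono Set.inter_subset_right (h.isFace hF').subset).dim_lt
        fun he' => hc (Or.inr ?_)
      exact (h.face_subset_iff hab hF' hF).1 (Set.inter_eq_right.1 he')
    obtain ⟨M, hM, hdom⟩ := h.poly.exists_dominate (l := l) (l' := -innerSL ℝ (a F₀))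
      (β' := -g.β F₀) hle (fun y hy heq => by
        have h1 := hleq y hy heq
        rw [he] at h1
        simp [h1.2])
    have h1n : dim (g.face a F) + g.m = (dim (g.face a F₀) + g.m) +
      (dim (g.face a F) - dim (g.face a F₀)) := by omega
    have h2n : dim (g.face a F') + g.m = (dim (g.face a F₀) + g.m) +
      (dim (g.face a F') - dim (g.face a F₀)) := by omega
    have ht := ((tendsto_pow_nhdsGT_zero (n := dim (g.face a F) - dim (g.face a F₀))
      (by omega)).add (tendsto_pow_nhdsGT_zero (n := dim (g.face a F') - dim (g.face a F₀))
      (by omega))).const_mul M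
    rw [add_zero, mul_zero] at ht
    filter_upwards [eventually_pos, ht.eventually (gt_mem_nhds one_pos)] with ε hε hlt y hy hnn h0 h0'
    have h1 := hdom y hy
    have h2 : g.β F + g.β F' - l y = ε ^ (dim (g.face a F) + g.m) +
        ε ^ (dim (g.face a F') + g.m) := by
      rw [← hzero hε hF h0, ← hzero hε hF' h0', hl, add_apply, innerSL_apply_apply,
        innerSL_apply_apply]
      ring
    rw [h2, h1n, h2n, neg_apply, innerSL_apply_apply, pow_add ε (dim (g.face a F₀) + g.m),
      pow_add ε (dim (g.face a F₀) + g.m)] at h1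
    have h3 := hnn F₀ hF₀
    rw [h.cut_eq hF₀] at h3
    have h4 := nonneg_of_mul_nonneg_right h3 (by positivity)
    have h5 : 0 < ε ^ (dim (g.face a F₀) + g.m) := by positivity
    have h6 := mul_lt_mul_of_pos_left hlt h5
    linarith

end IsGerm

end Sweep

namespace Sweep

open Filter Topology

variable {E : Type*} [NormedAddCommGroup E] [InnerProductSpace ℝ E]

theorem faceHull_eq {P S F : Set E} (hF : IsFace P F) (hS : S ⊆ F)
    (h : ∀ F', IsFace P F' → S ⊆ F' → F ⊆ F') : faceHull P S = F :=
  Set.Subset.antisymm (Set.sInter_subset_of_mem ⟨hF, hS⟩)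
    (Set.subset_sInter fun F' hF' => h F' hF'.1 hF'.2)

/-- The constant family `P`. -/
def baseGerm (P : Set E) (b : Set E → ℝ) : Germ E where
  K := P
  z := fun _ => 0
  k := 0
  m := 1
  L := {F | IsFace P F ∧ F ≠ P}
  β := b

theorem sect_baseGerm {P : Set E} {b : Set E → ℝ} {ε : ℝ} : (baseGerm P b).sect ε = P := by
  simp [Germ.sect, place, baseGerm]

theorem isGerm_baseGerm {P : Set E} {a : Set E → E} {b : Set E → ℝ} (hP : IsPolytope P)
    (hab : IsSupportFamily P a b) : IsGerm P a b (baseGerm P b) := by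
  have hface : ∀ F, IsFace P F → F ≠ P → (baseGerm P b).face a F = F := fun F hF hne =>
    (hab F hF hne).2.symm
  constructor
  · exact hP
  · exact le_rfl
  · exact fun F hF => hF
  · exact fun F hF => (hab F hF.1 hF.2).1
  · intro N
    constructor
    · exact fun hN => ⟨N, hN, (hface N hN.1 hN.2).symm⟩
    · rintro ⟨F, hF, rfl⟩
      rw [hface F hF.1 hF.2]
      exact hF
  · intro F hF
    rw [hface F hF.1 hF.2]
    simp [baseGerm]
  · intro F hF ε
    simp [baseGerm]
  · exact Eventually.of_forall fun ε => sect_baseGerm.subset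
  · exact Eventually.of_forall fun ε F hF hne hL => absurd ⟨hF, hne⟩ hL
  · refine Eventually.of_forall fun ε F hF F' hF' hs => ?_
    rwa [sect_baseGerm, Set.inter_eq_left.2 hF.1.subset] at hs

theorem IsGerm.faceHull_inter {P : Set E} {a : Set E → E} {b : Set E → ℝ} {g : Germ E}
    (h : IsGerm P a b g) :
    ∀ᶠ ε in 𝓝[>] 0, ∀ F ∈ g.L, faceHull P (F ∩ g.sect ε) = F := by
  filter_upwards [h.hull] with ε hε F hF
  exact faceHull_eq (h.proper F hF).1 Set.inter_subset_left (hε F hF)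

theorem IsGerm.faceHull_vertex {P : Set E} {a : Set E → E} {b : Set E → ℝ} {g : Germ E}
    (h : IsGerm P a b g) (hab : IsSupportFamily P a b) {Fv : Set E} {v : E} (hFv : Fv ∈ g.L)
    (hv : g.face a Fv = {v}) : ∀ᶠ ε in 𝓝[>] 0, faceHull P {g.z ε + ε ^ g.k • v} = Fv := by
  filter_upwards [h.faceHull_inter, h.inter_sect hab] with ε h1 h2
  rw [← place_singleton, ← hv, ← h2 Fv hFv, h1 Fv hFv]

/-! ### Links -/

/-- The faces created by truncating the vertices that correspond to the vertex `v` of `g.K`, where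
`Fv` is the face of `P` that corresponds to `v`. -/
noncomputable def Germ.link (g : Germ E) (a : Set E → E) (Fv : Set E) (v : E) : Germ E where
  K := vertexFigure (innerSL ℝ (a Fv)) (g.β Fv) v g.K
  z := fun ε => g.z ε + ε ^ g.k • v
  -- A vertex is cut off at relative depth `ε ^ m`, so the link is `ε ^ m` times the vertex figure.
  -- A face of dimension `i` at depth exponent `i + m` becomes one of dimension `i - 1` at exponent
  -- `i` in the new scale, so the new `m` is 1. The origin moves to `v`, which lies on all remaining
  -- faces, so the constant terms vanish.
  k := g.k + g.m
  m := 1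
  L := {F ∈ g.L | Fv ⊂ F}
  β := 0

theorem Germ.link_point {g : Germ E} {a : Set E → E} {Fv : Set E} {v y : E} {ε : ℝ} :
    (g.link a Fv v).z ε + ε ^ (g.link a Fv v).k • y = g.z ε + ε ^ g.k • (v + ε ^ g.m • y) := by
  simp only [Germ.link, pow_add, smul_add, smul_smul, add_assoc]

namespace IsGerm

variable {P : Set E} {a : Set E → E} {b : Set E → ℝ} {g : Germ E} {F F' Fv : Set E} {y v : E}
  {ε : ℝ}

theorem mem_of_face_eq (hv : g.face a Fv = {v}) : v ∈ g.K ∧ inner ℝ (a Fv) v = g.β Fv :=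
  (hv.ge rfl : v ∈ g.face a Fv)

theorem inner_lt_of_ne (h : IsGerm P a b g) (hFv : Fv ∈ g.L) (hv : g.face a Fv = {v}) :
     ∀ x ∈ g.K, x ≠ v → innerSL ℝ (a Fv) x < g.β Fv := fun x hx hne =>
  lt_of_le_of_ne (h.supp Fv hFv x hx) fun he => hne (hv.le (⟨hx, he⟩ : x ∈ g.face a Fv))

theorem vertex_mem_face_iff (h : IsGerm P a b g) (hFv : Fv ∈ g.L) (hv : g.face a Fv = {v})
    (hab : IsSupportFamily P a b) (hF : F ∈ g.L) :
    v ∈ g.face a F ↔ Fv ⊆ F := by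
  rw [← h.face_subset_iff hab hFv hF, hv, Set.singleton_subset_iff]

theorem link_face (h : IsGerm P a b g) (hFv : Fv ∈ g.L) (hv : g.face a Fv = {v})
    (hab : IsSupportFamily P a b) (hF : F ∈ (g.link a Fv v).L) :
    (g.link a Fv v).face a F = vertexFigure (innerSL ℝ (a Fv)) (g.β Fv) v (g.face a F) := by
  have hvF := ((h.vertex_mem_face_iff hFv hv hab hF.1).2 hF.2.1).2
  refine (vertexFigure_eq_of_face (l' := innerSL ℝ (a F)) (h.inner_lt_of_ne hFv hv) ?_).symm
  simp only [innerSL_apply_apply, hvF]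
  rfl

theorem face_ne_singleton (h : IsGerm P a b g) (hFv : Fv ∈ g.L) (hv : g.face a Fv = {v})
    (hab : IsSupportFamily P a b) (hF : F ∈ (g.link a Fv v).L) :
    g.face a F ≠ {v} := by
  intro he
  exact hF.2.2 ((h.face_subset_iff hab hF.1 hFv).1 (he.trans hv.symm).subset)

theorem exists_ne_of_mem_link (h : IsGerm P a b g) (hFv : Fv ∈ g.L) (hv : g.face a Fv = {v})
    (hab : IsSupportFamily P a b) (hF : F ∈ (g.link a Fv v).L) :
    ∃ x ∈ g.face a F, x ≠ v := by
  by_contra! hc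
  exact h.face_ne_singleton hFv hv hab hF
    (Set.eq_singleton_iff_unique_mem.2 ⟨(h.vertex_mem_face_iff hFv hv hab hF.1).2 hF.2.1, hc⟩)

theorem exists_ne_of_dim_pos {K : Set E} (hd : 0 < dim K) (v : E) : ∃ x ∈ K, x ≠ v := by
  by_contra! hc
  exact hd.ne' (dim_eq_zero_of_subsingleton fun x hx y hy => (hc x hx).trans (hc y hy).symm)

theorem link_polytope (h : IsGerm P a b g) (hFv : Fv ∈ g.L) (hv : g.face a Fv = {v})
    (hd : 0 < dim g.K) : IsPolytope (g.link a Fv v).K ∧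
      ∃ η₀ : ℝ, 0 < η₀ ∧ ∀ y ∈ (g.link a Fv v).K, v + η₀ • y ∈ g.K :=
  vertexFigure_polytope h.poly (mem_of_face_eq hv).1 (mem_of_face_eq hv).2
    (h.inner_lt_of_ne hFv hv) (exists_ne_of_dim_pos hd v)

theorem link_add_mem (h : IsGerm P a b g) (hFv : Fv ∈ g.L) (hv : g.face a Fv = {v})
    (hd : 0 < dim g.K) :
    ∀ᶠ ε : ℝ in 𝓝[>] 0, ∀ y ∈ (g.link a Fv v).K, v + ε ^ g.m • y ∈ g.K := by
  obtain ⟨η₀, hη₀, hK⟩ := (h.link_polytope hFv hv hd).2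
  have hm : g.m ≠ 0 := by have := h.m_pos; omega
  filter_upwards [eventually_pos, (tendsto_pow_nhdsGT_zero hm).eventually (ge_mem_nhds hη₀)]
    with ε hε hle y hy
  have h1 := h.poly.convex.add_smul_sub_mem (mem_of_face_eq hv).1 (hK y hy)
    (t := ε ^ g.m / η₀) ⟨by positivity, by rwa [div_le_one hη₀]⟩
  rwa [add_sub_cancel_left, smul_smul, div_mul_cancel₀ _ hη₀.ne'] at h1

theorem link_sect_subset (h : IsGerm P a b g) (hFv : Fv ∈ g.L) (hv : g.face a Fv = {v})
    (hd : 0 < dim g.K) :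
    ∀ᶠ ε in 𝓝[>] 0, (g.link a Fv v).sect ε ⊆ g.sect ε := by
  filter_upwards [h.link_add_mem hFv hv hd] with ε hε
  rintro _ ⟨y, hy, rfl⟩
  change (g.link a Fv v).z ε + ε ^ (g.link a Fv v).k • y ∈ _
  rw [Germ.link_point]
  exact mem_place (hε y hy)

theorem link_inner (h : IsGerm P a b g) (hFv : Fv ∈ g.L) (hv : g.face a Fv = {v})
    (hy : y ∈ (g.link a Fv v).K) : inner ℝ (a Fv) y = -1 :=
  apply_vertexFigure (mem_of_face_eq hv).2 (h.inner_lt_of_ne hFv hv) hy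

theorem link_cut_eq_zero (h : IsGerm P a b g) (hFv : Fv ∈ g.L) (hv : g.face a Fv = {v})
    (hy : y ∈ (g.link a Fv v).K) :
    cut a b ε Fv (g.z ε + ε ^ g.k • (v + ε ^ g.m • y)) = 0 := by
  rw [h.cut_eq hFv, hv, dim_singleton, inner_add_right, inner_smul_right,
    h.link_inner hFv hv hy, (mem_of_face_eq hv).2, zero_add]
  ring

/-- A face that misses `v` has slack bounded away from zero near `v`, the truncating function of
`Fv` vanishes on the link, and faces outside `g.L` are harmless already on the larger section. -/
theorem link_out (h : IsGerm P a b g) (hFv : Fv ∈ g.L) (hv : g.face a Fv = {v})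
    [FiniteDimensional ℝ E] (hP : IsPolytope P) (hab : IsSupportFamily P a b)
    (hd : 0 < dim g.K) : ∀ᶠ ε in 𝓝[>] 0, ∀ F, IsFace P F → F ≠ P → F ∉ (g.link a Fv v).L →
      ∀ x ∈ (g.link a Fv v).sect ε, 0 ≤ cut a b ε F x := by
  have hm := h.m_pos
  have hs : ∀ᶠ ε in 𝓝[>] 0, ∀ F ∈ g.L, v ∉ g.face a F → ∀ y ∈ (g.link a Fv v).K,
      0 ≤ cut a b ε F (g.z ε + ε ^ g.k • (v + ε ^ g.m • y)) := by
    refine (eventually_all_finite (h.finite hP)).2 fun F hF => ?_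
    by_cases hvF : v ∈ g.face a F
    · exact Eventually.of_forall fun ε hn => absurd hvF hn
    have hlt : 0 < g.β F - inner ℝ (a F) v := sub_pos.2 <|
      lt_of_le_of_ne (h.supp F hF v (mem_of_face_eq hv).1) fun he => hvF ⟨(mem_of_face_eq hv).1, he⟩
    have hpoly := (h.link_polytope hFv hv hd).1
    obtain ⟨y₀, -, hmax⟩ := hpoly.exists_vert_max (innerSL ℝ (a F))
    have ht := ((tendsto_pow_nhdsGT_zero (n := g.m) (by omega)).mul_const (inner ℝ (a F) y₀)).add
      (tendsto_pow_nhdsGT_zero (n := dim (g.face a F) + g.m) (by omega))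
    rw [zero_mul, add_zero] at ht
    filter_upwards [eventually_pos, ht.eventually (gt_mem_nhds hlt)] with ε hε hε' _ y hy
    rw [h.cut_eq hF, inner_add_right, inner_smul_right]
    have h1 : inner ℝ (a F) y ≤ inner ℝ (a F) y₀ := hmax y hy
    have h2 := mul_le_mul_of_nonneg_left h1 (pow_pos hε g.m).le
    exact mul_nonneg (by positivity) (by linarith)
  filter_upwards [hs, h.out, h.link_sect_subset hFv hv hd] with ε h1 h2 h3 F hF hne hL x hx
  by_cases hFL : F ∈ g.L
  · obtain ⟨y, hy, rfl⟩ := hx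
    change 0 ≤ cut a b ε F ((g.link a Fv v).z ε + ε ^ (g.link a Fv v).k • y)
    rw [Germ.link_point]
    by_cases hvF : v ∈ g.face a F
    · have h4 := (h.vertex_mem_face_iff hFv hv hab hFL).1 hvF
      have h5 : Fv = F := by
        by_contra hc
        exact hL ⟨hFL, h4.ssubset_of_ne hc⟩
      rw [← h5, h.link_cut_eq_zero hFv hv hy]
    · exact h1 F hFL hvF y hy
  · exact h2 F hF hne hFL x (h3 hx)

/-- The link contains a point of the open segment from `v` to a relative interior point `y₀` of the
face. A face of `P` through that point contains `y₀` by extremality, then the whole section of `F`,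
and the corresponding property of `g` finishes the argument. -/
theorem link_hull (h : IsGerm P a b g) (hFv : Fv ∈ g.L) (hv : g.face a Fv = {v})
    [FiniteDimensional ℝ E] (hP : IsPolytope P) (hab : IsSupportFamily P a b) :
    ∀ᶠ ε in 𝓝[>] 0, ∀ F ∈ (g.link a Fv v).L, ∀ F', IsFace P F' →
      F ∩ (g.link a Fv v).sect ε ⊆ F' → F ⊆ F' := by
  have hm : g.m ≠ 0 := by have := h.m_pos; omega
  refine (eventually_all_finite ((h.finite hP).subset (Set.sep_subset _ _))).2 fun F hF => ?_
  have hface := h.isFace hF.1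
  obtain ⟨y₀, hy₀⟩ := (h.poly.face hface).exists_isRelInt
  have hvface : IsFace g.K {v} := hv ▸ h.isFace hFv
  have hne : y₀ ≠ v := fun he => h.face_ne_singleton hFv hv hab hF <|
    (Set.Nonempty.subset_singleton_iff hface.2).1
      (hy₀.subset_of_mem_face hface.subset hvface.isExtreme he)
  have hpos : 0 < g.β Fv - inner ℝ (a Fv) y₀ :=
    sub_pos.2 (h.inner_lt_of_ne hFv hv y₀ (hface.subset hy₀.1) hne)
  filter_upwards [eventually_pos, (tendsto_pow_nhdsGT_zero hm).eventually (gt_mem_nhds hpos),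
    h.hull, h.sub, h.inter_sect hab] with ε hε hlt hhull hsub hinter F' hF' hs
  refine hhull F hF.1 F' hF' ?_
  rw [hinter F hF.1]
  have hk : 0 < ε ^ g.k := by positivity
  refine (isRelInt_place (z := g.z ε) hk hy₀).subset_of_mem_face (K := P)
    (by rw [← hinter F hF.1]; exact Set.inter_subset_right.trans hsub) hF'.isExtreme ?_
  set s := ε ^ g.m * (g.β Fv - inner ℝ (a Fv) y₀)⁻¹ with hsdef
  have hs0 : 0 < s := by positivity
  have hs1 : s < 1 := by rwa [hsdef, ← div_eq_mul_inv, div_lt_one hpos]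
  have hvmem : v ∈ g.face a F := (h.vertex_mem_face_iff hFv hv hab hF.1).2 hF.2.1
  have hx : v + s • (y₀ - v) ∈ g.face a F :=
    (h.poly.face hface).convex.add_smul_sub_mem hvmem hy₀.1 ⟨hs0.le, hs1.le⟩
  have hmem : g.z ε + ε ^ g.k • (v + s • (y₀ - v)) ∈ F' := by
    refine hs ⟨?_, ?_⟩
    · have := mem_place (z := g.z ε) (r := ε ^ g.k) hx
      rw [← hinter F hF.1] at this
      exact this.1
    · have h1 : (g.β Fv - inner ℝ (a Fv) y₀)⁻¹ • (y₀ - v) ∈ (g.link a Fv v).K :=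
        ⟨y₀, hface.subset hy₀.1, hne, rfl⟩
      rw [hsdef, mul_smul, ← Germ.link_point (a := a) (Fv := Fv)]
      exact mem_place h1
  refine hF'.isExtreme.left_mem_of_mem_openSegment (hsub (mem_place (hface.subset hy₀.1)))
    (hsub (mem_place (mem_of_face_eq hv).1)) hmem ⟨s, 1 - s, hs0, by linarith, by ring, ?_⟩
  simp only [smul_add, smul_sub, sub_smul, one_smul, smul_smul]
  rw [mul_comm (ε ^ g.k) s]
  have : (1 - s) * ε ^ g.k = ε ^ g.k - s * ε ^ g.k := by ring
  rw [this, sub_smul]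
  abel

theorem link (h : IsGerm P a b g) (hFv : Fv ∈ g.L) (hv : g.face a Fv = {v})
    [FiniteDimensional ℝ E] (hP : IsPolytope P) (hab : IsSupportFamily P a b)
    (hd : 0 < dim g.K) : IsGerm P a b (g.link a Fv v) := by
  have hl := h.inner_lt_of_ne hFv hv
  obtain ⟨hvK, hlv⟩ := mem_of_face_eq hv
  constructor
  · exact (h.link_polytope hFv hv hd).1
  · exact le_rfl
  · exact fun F hF => h.proper F hF.1
  · rintro F hF _ ⟨x, hx, hne, rfl⟩
    have h1 := h.supp F hF.1 x hx
    have h2 := ((h.vertex_mem_face_iff hFv hv hab hF.1).2 hF.2.1).2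
    have h3 := hl x hx hne
    rw [inner_smul_right, inner_sub_right]
    exact mul_nonpos_of_nonneg_of_nonpos (inv_nonneg.2 (sub_pos.2 h3).le) (by linarith)
  · intro N'
    constructor
    · rintro ⟨hN', hne⟩
      obtain ⟨N, hN, hvN, hNv, rfl⟩ := exists_face_of_isFace_vertexFigure hvK hlv hl hN'
      obtain ⟨F, hF, rfl⟩ := (h.faces N).1 ⟨hN, fun he => hne (by rw [he]; rfl)⟩
      have h1 : F ∈ (g.link a Fv v).L := by
        refine ⟨hF, (h.vertex_mem_face_iff hFv hv hab hF).1 hvN, fun hs => hNv ?_⟩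
        have := (h.face_subset_iff hab hF hFv).2 hs
        rw [hv] at this
        exact (Set.Nonempty.subset_singleton_iff hN.2).1 this
      exact ⟨F, h1, (h.link_face hFv hv hab h1).symm⟩
    · rintro ⟨F, hF, rfl⟩
      have hvF := (h.vertex_mem_face_iff hFv hv hab hF.1).2 hF.2.1
      rw [h.link_face hFv hv hab hF]
      exact ⟨isFace_vertexFigure hl (h.isFace hF.1) hvF (h.face_ne_singleton hFv hv hab hF),
        fun he => h.face_ne hF.1 (eq_of_vertexFigure_eq hl (h.isFace hF.1) hvF he)⟩
  · intro F hF
    have h1 := dim_vertexFigure ((h.vertex_mem_face_iff hFv hv hab hF.1).2 hF.2.1)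
      (l := innerSL ℝ (a Fv)) hlv (fun x hx => hl x ((h.isFace hF.1).subset hx))
      (h.exists_ne_of_mem_link hFv hv hab hF)
    have h2 := h.dim_eq F hF.1
    rw [h.link_face hFv hv hab hF]
    change _ = g.k + g.m + _ + 1
    omega
  · intro F hF ε
    have h2 := ((h.vertex_mem_face_iff hFv hv hab hF.1).2 hF.2.1).2
    change b F - inner ℝ (a F) (g.z ε + ε ^ g.k • v) = ε ^ (g.k + g.m) * 0
    rw [h.sub_inner hF.1, h2, sub_self, mul_zero, mul_zero]
  · filter_upwards [h.sub, h.link_sect_subset hFv hv hd] with ε h1 h2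
    exact h2.trans h1
  · exact h.link_out hFv hv hP hab hd
  · exact h.link_hull hFv hv hP hab

theorem linkAt_eq (h : IsGerm P a b g) (hFv : Fv ∈ g.L) (hv : g.face a Fv = {v})
    (hab : IsSupportFamily P a b) (hd : 0 < dim g.K) : ∀ᶠ ε in 𝓝[>] 0,
    linkAt P (cut a b ε) (g.sect ε) (g.z ε + ε ^ g.k • v) = (g.link a Fv v).sect ε := by
  filter_upwards [h.faceHull_vertex hab hFv hv, h.link_sect_subset hFv hv hd, eventually_pos]
    with ε h1 h2 hε
  ext x
  rw [linkAt, h1]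
  constructor
  · rintro ⟨⟨y, hy, rfl⟩, h0⟩
    change cut a b ε Fv (g.z ε + ε ^ g.k • y) = 0 at h0
    rw [h.cut_eq hFv, hv, dim_singleton, zero_add, mul_eq_zero] at h0
    have h3 := h0.resolve_left (by positivity)
    have hm : 0 < ε ^ g.m := by positivity
    have hne : y ≠ v := by
      rintro rfl
      rw [(mem_of_face_eq hv).2] at h3
      linarith
    have h4 : (g.β Fv - inner ℝ (a Fv) y)⁻¹ • (y - v) ∈ (g.link a Fv v).K := ⟨y, hy, hne, rfl⟩
    have h5 := mem_place (z := (g.link a Fv v).z ε) (r := ε ^ (g.link a Fv v).k) h4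
    rw [Germ.link_point, show g.β Fv - inner ℝ (a Fv) y = ε ^ g.m by linarith, smul_smul,
      mul_inv_cancel₀ hm.ne', one_smul, add_sub_cancel] at h5
    exact h5
  · intro hx
    refine ⟨h2 hx, ?_⟩
    obtain ⟨y, hy, rfl⟩ := hx
    change cut a b ε Fv ((g.link a Fv v).z ε + ε ^ (g.link a Fv v).k • y) = 0
    rw [Germ.link_point, h.link_cut_eq_zero hFv hv hy]

theorem linkFaces_eq (h : IsGerm P a b g) (hFv : Fv ∈ g.L) (hv : g.face a Fv = {v})
    (hab : IsSupportFamily P a b) : ∀ᶠ ε in 𝓝[>] 0,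
    linkFaces P g.L (g.z ε + ε ^ g.k • v) = (g.link a Fv v).L := by
  filter_upwards [h.faceHull_vertex hab hFv hv] with ε h1
  rw [linkFaces, h1]
  rfl

theorem dim_link (h : IsGerm P a b g) (hFv : Fv ∈ g.L) (hv : g.face a Fv = {v})
    [FiniteDimensional ℝ E] (hd : 0 < dim g.K) :
    dim (g.link a Fv v).K + 1 = dim g.K :=
  dim_vertexFigure (mem_of_face_eq hv).1 (mem_of_face_eq hv).2 (h.inner_lt_of_ne hFv hv)
    (exists_ne_of_dim_pos hd v)

theorem dim_link_face (h : IsGerm P a b g) (hFv : Fv ∈ g.L) (hv : g.face a Fv = {v})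
    [FiniteDimensional ℝ E] (hab : IsSupportFamily P a b)
    (hF : F ∈ (g.link a Fv v).L) :
    dim ((g.link a Fv v).face a F) + 1 = dim (g.face a F) := by
  rw [h.link_face hFv hv hab hF]
  exact dim_vertexFigure ((h.vertex_mem_face_iff hFv hv hab hF.1).2 hF.2.1)
      (mem_of_face_eq hv).2
      (fun x hx => h.inner_lt_of_ne hFv hv x ((h.isFace hF.1).subset hx))
      (h.exists_ne_of_mem_link hFv hv hab hF)

theorem exists_face_vertex (h : IsGerm P a b g) (hd : 0 < dim g.K) (hv : v ∈ vert g.K) :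
    ∃ Fv ∈ g.L, g.face a Fv = {v} := by
  obtain ⟨F, hF, he⟩ := (h.faces {v}).1 ⟨hv, fun he => by
    rw [← he, dim_singleton] at hd
    exact hd.false⟩
  exact ⟨F, hF, he.symm⟩

end IsGerm

end Sweep

namespace Sweep

open Filter Topology

variable {E : Type*} [NormedAddCommGroup E] [InnerProductSpace ℝ E]

/-! ### Slices -/

/-- The sections of the members of a family by parallel hyperplanes with normal vector `q`. -/
def Germ.slice (g : Germ E) (a : Set E → E) (q : E) : Germ E where
  K := {y ∈ g.K | inner ℝ q y = 0}
  z := g.z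
  k := g.k
  -- A crossing face loses one dimension while its truncation depth is unchanged, so the offset goes
  -- up by one.
  m := g.m + 1
  L := {F ∈ g.L | (∃ y ∈ g.face a F, 0 < inner ℝ q y) ∧ ∃ y ∈ g.face a F, inner ℝ q y < 0}
  β := g.β

namespace IsGerm

variable {P : Set E} {a : Set E → E} {b : Set E → ℝ} {g : Germ E} {F F' Fv : Set E} {y v q : E}
  {ε : ℝ}

theorem slice_face : (g.slice a q).face a F = {y ∈ g.face a F | inner ℝ q y = 0} := by
  ext y
  simp only [Germ.face, Germ.slice, Set.mem_ofPred_eq]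
  tauto

theorem slice_sect_subset : (g.slice a q).sect ε ⊆ g.sect ε :=
  Set.image_mono fun _ hy => hy.1

theorem mem_slice_of_exists [FiniteDimensional ℝ E] (h : IsGerm P a b g)
    (hvert : ∀ w ∈ vert g.K, inner ℝ q w ≠ 0)
    (hF : F ∈ g.L) (hne : ∃ y ∈ g.face a F, inner ℝ q y = 0) : F ∈ (g.slice a q).L :=
  ⟨hF, crossing_of_nonempty (l := innerSL ℝ q) (h.poly.face (h.isFace hF))
    (fun w hw => hvert w (h.poly.face_trans (h.isFace hF) hw)) hne⟩

theorem slice [FiniteDimensional ℝ E] (h : IsGerm P a b g) (hP : IsPolytope P)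
    (hab : IsSupportFamily P a b) (hvert : ∀ w ∈ vert g.K, inner ℝ q w ≠ 0)
    (hpos : ∃ y ∈ g.K, 0 < inner ℝ q y) (hneg : ∃ y ∈ g.K, inner ℝ q y < 0) :
    IsGerm P a b (g.slice a q) := by
  have hex : ∀ F ∈ (g.slice a q).L, ∃ y₀, IsRelInt (g.face a F) y₀ ∧ inner ℝ q y₀ = 0 :=
    fun F hF => exists_isRelInt_section (l := innerSL ℝ q) (h.poly.face (h.isFace hF.1)) hF.2.1
      hF.2.2
  obtain ⟨y₀, hy₀, hy₀q⟩ := exists_isRelInt_section (l := innerSL ℝ q) h.poly hpos hneg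
  have hpoly : IsPolytope (g.slice a q).K :=
    isPolytope_section (l := innerSL ℝ q) h.poly ⟨y₀, hy₀.1, hy₀q⟩
  constructor
  · exact hpoly
  · exact Nat.le_add_left 1 g.m
  · exact fun F hF => h.proper F hF.1
  · exact fun F hF y hy => h.supp F hF.1 y hy.1
  · intro N'
    constructor
    · rintro ⟨hN', hne⟩
      obtain ⟨N, hN, rfl⟩ := exists_face_of_isFace_section (l := innerSL ℝ q) h.poly hN'
      obtain ⟨F, hF, rfl⟩ := (h.faces N).1 ⟨hN, fun he => hne (by rw [he]; rfl)⟩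
      exact ⟨F, h.mem_slice_of_exists hvert hF hN'.2, slice_face.symm⟩
    · rintro ⟨F, hF, rfl⟩
      rw [slice_face]
      obtain ⟨y₁, hy₁, hy₁q⟩ := hex F hF
      exact ⟨isFace_section (l := innerSL ℝ q) (h.isFace hF.1) ⟨y₁, hy₁.1, hy₁q⟩,
        section_ne (l := innerSL ℝ q) h.poly hpos hneg (h.isFace hF.1) (h.face_ne hF.1)⟩
  · intro F hF
    have h1 := dim_section (l := innerSL ℝ q) (h.poly.face (h.isFace hF.1)) hF.2.1 hF.2.2
    have h2 := h.dim_eq F hF.1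
    rw [slice_face]
    change dim F + 1 = g.k + _ + (g.m + 1)
    simp only [innerSL_apply_apply] at h1
    omega
  · exact fun F hF => h.shift F hF.1
  · filter_upwards [h.sub] with ε h1
    exact slice_sect_subset.trans h1
  -- As no vertex lies on the hyperplane, a face that does not cross it does not meet the slice at
  -- all. Its slack then has a positive minimum on the slice, which exceeds the truncation depth for
  -- small ε.
  · have hs : ∀ᶠ ε in 𝓝[>] 0, ∀ F ∈ g.L, F ∉ (g.slice a q).L → ∀ y ∈ (g.slice a q).K,
        0 ≤ cut a b ε F (g.z ε + ε ^ g.k • y) := by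
      refine (eventually_all_finite (h.finite hP)).2 fun F hF => ?_
      by_cases hFs : F ∈ (g.slice a q).L
      · exact Eventually.of_forall fun ε hn => absurd hFs hn
      obtain ⟨w, hw, hmax⟩ := hpoly.exists_vert_max (innerSL ℝ (a F))
      have hwK := mem_of_mem_vert hw
      have hlt : 0 < g.β F - inner ℝ (a F) w := sub_pos.2 <|
        lt_of_le_of_ne (h.supp F hF w hwK.1) fun he =>
          hFs (h.mem_slice_of_exists hvert hF ⟨w, ⟨hwK.1, he⟩, hwK.2⟩)
      have hm := h.m_pos
      filter_upwards [eventually_pos, (tendsto_pow_nhdsGT_zero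
        (n := dim (g.face a F) + g.m) (by omega)).eventually (gt_mem_nhds hlt)] with ε hε hε' _ y hy
      rw [h.cut_eq hF]
      have h1 : inner ℝ (a F) y ≤ inner ℝ (a F) w := hmax y hy
      exact mul_nonneg (by positivity) (by linarith)
    filter_upwards [hs, h.out] with ε h1 h2 F hF hne hL x hx
    by_cases hFL : F ∈ g.L
    · obtain ⟨y, hy, rfl⟩ := hx
      exact h1 F hFL hL y hy
    · exact h2 F hF hne hFL x (slice_sect_subset hx)
  · filter_upwards [h.hull, h.inter_sect hab, h.sub, eventually_pos] with ε h1 h2 h3 hε F hF F' hF' hs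
    obtain ⟨y₁, hy₁, hy₁q⟩ := hex F hF
    refine h1 F hF.1 F' hF' ?_
    have h4 := h2 F hF.1
    have hy : g.z ε + ε ^ g.k • y₁ ∈ F ∩ g.sect ε := h4 ▸ mem_place hy₁.1
    rw [h4]
    refine (isRelInt_place (z := g.z ε) (pow_pos hε g.k) hy₁).subset_of_mem_face (K := P) ?_
      hF'.isExtreme (hs ⟨hy.1, mem_place ⟨((h.isFace hF.1).subset hy₁.1), hy₁q⟩⟩)
    rw [← h4]
    exact Set.inter_subset_right.trans h3

/-! ### Truncation of the members of a family -/

theorem cut_comb {s t : ℝ} (hst : s + t = 1) (x y : E) :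
    cut a b ε F (s • x + t • y) = s * cut a b ε F x + t * cut a b ε F y := by
  rw [cut, cut, cut, inner_add_right, inner_smul_right, inner_smul_right]
  linear_combination (ε ^ (dim F + 1) - b F) * hst

theorem eq_of_face_subset_singleton (h : IsGerm P a b g) (hab : IsSupportFamily P a b)
    (hFv : Fv ∈ g.L) (hv : g.face a Fv = {v}) (hF : F ∈ g.L) (hs : F ⊆ Fv) : F = Fv := by
  refine hs.antisymm ((h.face_subset_iff hab hFv hF).1 ?_)
  have h1 := (h.face_subset_iff hab hF hFv).2 hs
  rw [hv] at h1 ⊢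
  exact ((Set.Nonempty.subset_singleton_iff (h.isFace hF).2).1 h1).superset

/-- Every chain of faces is the set of faces whose truncating hyperplanes contain some point of the
truncated section. -/
def HasTight (P : Set E) (a : Set E → E) (b : Set E → ℝ) (g : Germ E) (ε : ℝ) : Prop :=
  ∀ C ⊆ g.L, IsChain (· ⊆ ·) C →
    ∃ x ∈ trunc P (cut a b ε) (g.sect ε), ∀ F ∈ g.L, cut a b ε F x = 0 ↔ F ∈ C

theorem hasTight_zero [FiniteDimensional ℝ E] (h : IsGerm P a b g) (hd : dim g.K = 0) :
    ∀ᶠ ε in 𝓝[>] 0, HasTight P a b g ε := by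
  have hL : ∀ F, F ∉ g.L := fun F hF => by
    have := (h.isFace hF).dim_lt (h.face_ne hF)
    omega
  filter_upwards [h.out] with ε h1 C hC _
  obtain ⟨y, hy⟩ := h.poly.nonempty
  exact ⟨_, ⟨mem_place hy, fun F hF hne => h1 F hF hne (hL F) _ (mem_place hy)⟩,
    fun F hF => absurd hF (hL F)⟩

/-- A point of the link lies on the hyperplane that truncates `Fv`. Any other face whose hyperplane
passes through it is comparable with `Fv`, cannot be smaller than a vertex, and so belongs to the
faces of the link. -/
theorem exists_tight_link (h : IsGerm P a b g) (hab : IsSupportFamily P a b)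
    (hFv : Fv ∈ g.L) (hv : g.face a Fv = {v})
    (hlink : HasTight P a b (g.link a Fv v) ε)
    (hsub : (g.link a Fv v).sect ε ⊆ g.sect ε)
    (hcomp : ∀ x ∈ g.sect ε, (∀ F ∈ g.L, 0 ≤ cut a b ε F x) → ∀ F ∈ g.L, ∀ F' ∈ g.L,
      cut a b ε F x = 0 → cut a b ε F' x = 0 → F ⊆ F' ∨ F' ⊆ F)
    {C : Set (Set E)} (hC : C ⊆ (g.link a Fv v).L) (hchain : IsChain (· ⊆ ·) C) :
    ∃ x ∈ trunc P (cut a b ε) (g.sect ε), ∀ F ∈ g.L, cut a b ε F x = 0 ↔ F ∈ insert Fv C := by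
  obtain ⟨x, ⟨hx, hxP⟩, hxC⟩ := hlink C hC hchain
  have hFvx : cut a b ε Fv x = 0 := by
    obtain ⟨y, hy, rfl⟩ := hx
    change cut a b ε Fv ((g.link a Fv v).z ε + ε ^ (g.link a Fv v).k • y) = 0
    rw [Germ.link_point]
    exact h.link_cut_eq_zero hFv hv hy
  refine ⟨x, ⟨hsub hx, hxP⟩, fun F hF => ⟨fun h0 => ?_, ?_⟩⟩
  · rcases eq_or_ne F Fv with rfl | hne
    · exact Set.mem_insert _ _
    right
    have hnn : ∀ F ∈ g.L, 0 ≤ cut a b ε F x := fun F hF => hxP F (h.proper F hF).1 (h.proper F hF).2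
    rcases hcomp x (hsub hx) hnn F hF Fv hFv h0 hFvx with hs | hs
    · exact absurd (h.eq_of_face_subset_singleton hab hFv hv hF hs) hne
    · exact (hxC F ⟨hF, hs.ssubset_of_ne hne.symm⟩).1 h0
  · rintro (rfl | hFC)
    · exact hFvx
    · exact (hxC F (hC hFC)).2 hFC

/-- Induction on the dimension through the links. A chain that contains a vertex is realized in the
link of that vertex. For the remaining chains, two realizations with different added vertices are
averaged. -/
theorem hasTight [FiniteDimensional ℝ E] (hP : IsPolytope P) (hab : IsSupportFamily P a b) (n : ℕ) :
    ∀ g : Germ E, IsGerm P a b g → dim g.K = n → ∀ᶠ ε in 𝓝[>] 0, HasTight P a b g ε := by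
  induction n with
  | zero => exact fun g h hd => h.hasTight_zero hd
  | succ n ih =>
    intro g h hn
    have hd : 0 < dim g.K := by omega
    have hfin := h.finite hP
    have hlink : ∀ᶠ ε in 𝓝[>] 0, ∀ v ∈ vert g.K, ∃ Fv ∈ g.L, g.face a Fv = {v} ∧
        HasTight P a b (g.link a Fv v) ε ∧ (g.link a Fv v).sect ε ⊆ g.sect ε := by
      refine (eventually_all_finite h.poly.finite_vert).2 fun v hv => ?_
      obtain ⟨Fv, hFv, hface⟩ := h.exists_face_vertex hd hv
      have h1 := h.dim_link hFv hface hd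
      filter_upwards [ih _ (h.link hFv hface hP hab hd) (by omega),
        h.link_sect_subset hFv hface hd] with ε h2 h3
      exact ⟨Fv, hFv, hface, h2, h3⟩
    filter_upwards [hlink, h.comparable hP hab] with ε hlink hcomp C hC hchain
    by_cases h0 : ∃ F ∈ C, dim (g.face a F) = 0
    · obtain ⟨F, hFC, hF0⟩ := h0
      obtain ⟨v, hv⟩ := (h.isFace (hC hFC)).2
      have hFv := (subsingleton_of_dim_eq_zero hF0).eq_singleton_of_mem hv
      have hvK : v ∈ vert g.K := by
        have := h.isFace (hC hFC)
        rw [hFv] at this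
        exact this
      obtain ⟨Fv, hFvL, hface, h1, h2⟩ := hlink v hvK
      have hFeq : F = Fv := by
        refine h.eq_of_face_subset_singleton hab hFvL hface (hC hFC) ?_
        exact (h.face_subset_iff hab (hC hFC) hFvL).1 (by rw [hFv, hface])
      subst hFeq
      have hC' : C \ {F} ⊆ (g.link a F v).L := by
        rintro F' ⟨hF', hne⟩
        refine ⟨hC hF', Set.ssubset_iff_subset_ne.2 ⟨?_, fun he => hne he.symm⟩⟩
        rcases hchain.total hFC hF' with hs | hs
        · exact hs
        · exact absurd (h.eq_of_face_subset_singleton hab hFvL hface (hC hF') hs) hne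
      have := h.exists_tight_link hab hFvL hface h1 h2 hcomp hC'
        (hchain.mono Set.sdiff_subset)
      rwa [Set.insert_sdiff_self_of_mem hFC] at this
    · push Not at h0
      -- The least member of the chain, or `K` itself, has positive dimension and thus two vertices.
      -- The chain enlarged by either vertex is realized in a link; at the midpoint of the two
      -- realizations both added functions are positive, so exactly `C` remains.
      have hN : ∃ N, IsFace g.K N ∧ 0 < dim N ∧ ∀ F ∈ C, N ⊆ g.face a F := by
        rcases C.eq_empty_or_nonempty with rfl | hne
        · exact ⟨g.K, isFace_self h.poly.nonempty, hd, fun F hF => absurd hF (Set.notMem_empty F)⟩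
        · obtain ⟨F, hF, hmin⟩ := exists_least_of_isChain (hfin.subset hC) hchain hne
          exact ⟨g.face a F, h.isFace (hC hF), Nat.pos_of_ne_zero (h0 F hF), fun F' hF' =>
            (h.face_subset_iff hab (hC hF) (hC hF')).2 (hmin F' hF')⟩
      obtain ⟨N, hN, hNd, hNC⟩ := hN
      obtain ⟨v, hv, w, hw, hvw⟩ := (h.poly.face hN).exists_two_vert hNd
      have hkey : ∀ v ∈ vert N, ∃ Fv, g.face a Fv = {v} ∧
          ∃ x ∈ trunc P (cut a b ε) (g.sect ε), ∀ F ∈ g.L,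
            cut a b ε F x = 0 ↔ F ∈ insert Fv C := by
        intro v hv
        obtain ⟨Fv, hFvL, hface, h1, h2⟩ := hlink v (h.poly.face_trans hN hv)
        refine ⟨Fv, hface, h.exists_tight_link hab hFvL hface h1 h2 hcomp (fun F hF => ?_) hchain⟩
        refine ⟨hC hF, Set.ssubset_iff_subset_ne.2 ⟨?_, ?_⟩⟩
        · exact (h.vertex_mem_face_iff hFvL hface hab (hC hF)).1 (hNC F hF (mem_of_mem_vert hv))
        · rintro rfl
          exact h0 Fv hF (by rw [hface, dim_singleton])
      obtain ⟨Fv, hFv, x, hx, hxC⟩ := hkey v hv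
      obtain ⟨Fw, hFw, x', hx', hxC'⟩ := hkey w hw
      have hconv : Convex ℝ (g.sect ε) := (isPolytope_place h.poly).convex
      have hhalf : (1 / 2 : ℝ) + 1 / 2 = 1 := by norm_num
      refine ⟨(1 / 2 : ℝ) • x + (1 / 2 : ℝ) • x', ⟨hconv hx.1 hx'.1 (by norm_num) (by norm_num)
        hhalf, fun F hF hne => ?_⟩, fun F hF => ?_⟩
      · rw [cut_comb hhalf]
        linarith [hx.2 F hF hne, hx'.2 F hF hne]
      · have h1 := hx.2 F (h.proper F hF).1 (h.proper F hF).2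
        have h2 := hx'.2 F (h.proper F hF).1 (h.proper F hF).2
        rw [cut_comb hhalf]
        constructor
        · intro he
          rcases (hxC F hF).1 (by linarith) with rfl | hFC
          · rcases (hxC' F hF).1 (by linarith) with rfl | hFC
            · rw [hFv] at hFw
              exact absurd (Set.singleton_injective hFw) hvw
            · exact hFC
          · exact hFC
        · intro hFC
          rw [(hxC F hF).2 (Set.mem_insert_of_mem _ hFC),
            (hxC' F hF).2 (Set.mem_insert_of_mem _ hFC)]
          norm_num

theorem isTruncated [FiniteDimensional ℝ E] (h : IsGerm P a b g) (hP : IsPolytope P)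
    (hab : IsSupportFamily P a b) :
    ∀ᶠ ε in 𝓝[>] 0, IsTruncated P (cut a b ε) (g.sect ε) g.L := by
  filter_upwards [hasTight hP hab _ g h rfl, h.comparable hP hab, h.faceHull_inter,
    h.inter_sect hab, h.out, h.sub, eventually_pos] with ε htight hcomp hhull hinter hout hsub hε
  have hpos : ε ^ g.k ≠ 0 := by positivity
  have htr : trunc P (cut a b ε) (g.sect ε) = {x ∈ g.sect ε | ∀ F ∈ g.L, 0 ≤ cut a b ε F x} := by
    ext x
    constructor
    · exact fun hx => ⟨hx.1, fun F hF => hx.2 F (h.proper F hF).1 (h.proper F hF).2⟩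
    · refine fun hx => ⟨hx.1, fun F hF hne => ?_⟩
      by_cases hL : F ∈ g.L
      · exact hx.2 F hL
      · exact hout F hF hne hL x hx.1
  constructor
  · exact isPolytope_place h.poly
  · exact h.finite hP
  · intro N
    constructor
    · rintro ⟨hN, hne⟩
      obtain ⟨N', hN', rfl⟩ := exists_isFace_of_isFace_place hpos hN
      obtain ⟨F, hF, rfl⟩ := (h.faces N').1 ⟨hN', fun he => hne (by rw [he]; rfl)⟩
      exact ⟨F, hF, (hinter F hF).symm⟩
    · rintro ⟨F, hF, rfl⟩
      rw [hinter F hF]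
      exact ⟨(isFace_place_iff hpos).2 (h.isFace hF),
        fun he => h.face_ne hF ((place_inj hpos).1 he)⟩
  · exact hhull
  · exact htr
  · intro F hF
    obtain ⟨h1, h2⟩ := hab F (h.proper F hF).1 (h.proper F hF).2
    refine ⟨innerSL ℝ (a F), b F, ε ^ (dim F + 1), by positivity, fun x => rfl, fun x hx =>
      ⟨h1 x (hsub hx), fun he => ?_, fun hxF => ?_⟩⟩
    · rw [h2]
      exact ⟨hsub hx, he⟩
    · rw [h2] at hxF
      exact hxF.2
  · intro x hx
    rw [htr] at hx
    exact hcomp x hx.1 hx.2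
  · exact htight

end IsGerm

end Sweep

namespace Sweep

open Filter Topology

variable {E : Type*} [NormedAddCommGroup E] [InnerProductSpace ℝ E]

/-! ### Vertices at the stages of the truncation -/

namespace IsTruncated

variable {P K : Set E} {c : Set E → E → ℝ} {L : Set (Set E)} {q v w : E}

theorem vert_subset_stageVertices : vert K ⊆ stageVertices P c K := by
  have : stage P c K 0 = K := by simp [stage]
  intro v hv
  exact Set.mem_iUnion.2 ⟨0, by rwa [this]⟩

theorem vert_trunc_subset_stageVertices [FiniteDimensional ℝ E] (h : IsTruncated P c K L) :
    vert (trunc P c K) ⊆ stageVertices P c K := by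
  have : stage P c K (dim K) = trunc P c K := by
    rw [h.trunc_eq]
    ext x
    refine and_congr_right fun _ => ⟨fun hx F hF => ?_, fun hx N hN hne _ => ?_⟩
    · have := hx _ (h.isFace_inter hF) (h.inter_ne hF) (h.dim_inter_lt_dim hF)
      rwa [h.hull F hF] at this
    · obtain ⟨F, hF, rfl⟩ := (h.proper_iff N).1 ⟨hN, hne⟩
      rw [h.hull F hF]
      exact hx F hF
  intro v hv
  exact Set.mem_iUnion.2 ⟨dim K, by rwa [this]⟩

/-- Once all vertices are truncated, `w` is the only point of the resulting polytope that lies both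
on the hyperplane truncating `v` and on the face spanned by `w`. The sum of the two functionals
exposes it; `hout` ensures that `w` survives the truncation of the other vertices. -/
theorem mem_stageVertices_of_mem_linkAt [FiniteDimensional ℝ E] (h : IsTruncated P c K L)
    (hl : IsTruncated P c (linkAt P c K v) (linkFaces P L v)) (hd : 0 < dim K) (hv : v ∈ vert K)
    (hout : ∀ u ∈ vert K, ∀ x ∈ linkAt P c K v, 0 ≤ c (faceHull P {u}) x)
    (hw : w ∈ vert (linkAt P c K v)) (hne : {w} ≠ linkAt P c K v) : w ∈ stageVertices P c K := by
  have hwl := mem_of_mem_vert hw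
  obtain ⟨hF, hFw⟩ := hl.faceHull_mem_of_ne hw hne
  obtain ⟨lv, βv, ηv, hηv, hcv, -⟩ := h.support _ (h.faceHull_mem hd hv).1
  obtain ⟨lF, βF, ηF, hηF, hcF, hsF⟩ := h.support _ hF.1
  refine Set.mem_iUnion.2 ⟨1, ?_⟩
  have hws : w ∈ stage P c K 1 := by
    refine ⟨hwl.1, fun N hN hne h0 => ?_⟩
    obtain ⟨u, hu⟩ := hN.2
    have hNu := (subsingleton_of_dim_eq_zero (Nat.lt_one_iff.1 h0)).eq_singleton_of_mem hu
    subst hNu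
    exact hout u hN w hwl
  have hv1 : ∀ x ∈ stage P c K 1, 0 ≤ c (faceHull P {v}) x := fun x hx =>
    hx.2 {v} hv (fun he => by rw [← he, dim_singleton] at hd; exact hd.false)
      (by rw [dim_singleton]; exact one_pos)
  have h1 : ∀ x ∈ stage P c K 1, (lv + lF) x ≤ βv - ηv + βF := fun x hx => by
    have h2 := hv1 x hx
    have h3 := (hsF x hx.1).1
    rw [hcv] at h2
    rw [add_apply]
    linarith
  have h2 := hwl.2
  rw [hcv] at h2
  have h3 := ((hsF w hwl.1).2).2 (hFw.ge rfl).1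
  have hface := isFace_of_support (lv + lF) h1 hws (by rw [add_apply]; linarith)
  have he : {x ∈ stage P c K 1 | (lv + lF) x = βv - ηv + βF} = {w} := by
    refine Set.eq_singleton_iff_unique_mem.2 ⟨⟨hws, by rw [add_apply]; linarith⟩, ?_⟩
    rintro x ⟨hx, hxe⟩
    have h4 := hv1 x hx
    have h5 := (hsF x hx.1).1
    have h6 := hcv x
    rw [add_apply] at hxe
    have h7 : x ∈ faceHull P {w} := ((hsF x hx.1).2).1 (by linarith)
    have h8 : x ∈ linkAt P c K v := ⟨hx.1, by linarith⟩
    exact hFw.le ⟨h7, h8⟩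
  rw [he] at hface
  exact hface

/-- Both `w` and `v` are stage vertices, so genericity separates them. The exception is that Q_v is
the single point `w`, which is no proper face. Then equal heights would make `q` constant on `K`,
although `K` has two vertices. -/
theorem inner_ne_of_mem_vert_linkAt [FiniteDimensional ℝ E] (h : IsTruncated P c K L)
    (hl : IsTruncated P c (linkAt P c K v) (linkFaces P L v)) (hd : 0 < dim K) (hv : v ∈ vert K)
    (hout : ∀ u ∈ vert K, ∀ x ∈ linkAt P c K v, 0 ≤ c (faceHull P {u}) x)
    (hrad : ∀ x ∈ K, x ≠ v → ∃ s : ℝ, 0 < s ∧ v + s • (x - v) ∈ linkAt P c K v)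
    (hq : Set.InjOn (fun x => inner ℝ q x) (stageVertices P c K))
    (hw : w ∈ vert (linkAt P c K v)) : inner ℝ q w ≠ inner ℝ q v := by
  intro he
  by_cases hne : {w} = linkAt P c K v
  · have hconst : ∀ x ∈ K, x ≠ v → inner ℝ q x = inner ℝ q v := by
      intro x hx hxv
      obtain ⟨s, hs, hmem⟩ := hrad x hx hxv
      rw [← hne] at hmem
      have hmem : v + s • (x - v) = w := hmem
      rw [← hmem, inner_add_right, inner_smul_right, inner_sub_right] at he
      have : s * (inner ℝ q x - inner ℝ q v) = 0 := by linarith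
      linarith [(mul_eq_zero.1 this).resolve_left hs.ne']
    have huniq : ∀ u ∈ vert K, u = v := fun u hu => by
      by_contra hc
      exact hc (hq (vert_subset_stageVertices hu) (vert_subset_stageVertices hv)
        (hconst u (mem_of_mem_vert hu) hc))
    obtain ⟨u, hu, u', hu', huu⟩ := h.poly.exists_two_vert hd
    exact huu ((huniq u hu).trans (huniq u' hu').symm)
  · have hwv := hq (h.mem_stageVertices_of_mem_linkAt hl hd hv hout hw hne)
      (vert_subset_stageVertices hv) he
    have hwl := mem_of_mem_vert hw
    rw [hwv] at hwl
    exact h.notMem_linkAt hd hv hwl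

end IsTruncated

namespace IsGerm

variable {P : Set E} {a : Set E → E} {b : Set E → ℝ} {g : Germ E} {F F' Fv : Set E} {y v q : E}
  {ε : ℝ}

theorem isSwept [FiniteDimensional ℝ E] (h : IsGerm P a b g) (hP : IsPolytope P)
    (hab : IsSupportFamily P a b) (q : E) : ∀ᶠ ε in 𝓝[>] 0,
      Set.InjOn (fun x => inner ℝ q x) (stageVertices P (cut a b ε) (g.sect ε)) →
      IsSwept P (cut a b ε) (g.sect ε) g.L q := by
  have hsep : ∀ᶠ ε in 𝓝[>] 0, ∀ v ∈ vert g.K, ∀ v' ∈ vert g.K, inner ℝ q v < inner ℝ q v' →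
      ∀ x ∈ linkAt P (cut a b ε) (g.sect ε) (g.z ε + ε ^ g.k • v),
      ∀ x' ∈ linkAt P (cut a b ε) (g.sect ε) (g.z ε + ε ^ g.k • v'),
        inner ℝ q x < inner ℝ q x' := by
    refine (eventually_all_finite h.poly.finite_vert).2 fun v hv =>
      (eventually_all_finite h.poly.finite_vert).2 fun v' hv' => ?_
    by_cases hlt : inner ℝ q v < inner ℝ q v'
    · have hd : 0 < dim g.K := by
        by_contra hc
        have := subsingleton_of_dim_eq_zero (Nat.eq_zero_of_not_pos hc) (mem_of_mem_vert hv)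
          (mem_of_mem_vert hv')
        rw [this] at hlt
        exact hlt.false
      obtain ⟨Fv, hFv, hface⟩ := h.exists_face_vertex hd hv
      obtain ⟨Fv', hFv', hface'⟩ := h.exists_face_vertex hd hv'
      -- For small ε the truncating hyperplanes at `v` and `v'` meet the rescaled polytope so close
      -- to these vertices that the level `μ` separates them.
      obtain ⟨μ, h1, h2⟩ := exists_between hlt
      filter_upwards [h.eventually_lt hFv (-innerSL ℝ q) (μ := -μ) (by
          rw [hface]
          rintro y rfl
          simpa using h1), h.eventually_lt hFv' (innerSL ℝ q) (μ := μ) (by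
          rw [hface']
          rintro y rfl
          simpa using h2), h.faceHull_vertex hab hFv hface, h.faceHull_vertex hab hFv' hface',
          eventually_pos] with ε h3 h4 h5 h6 hε _ x hx x' hx'
      rw [linkAt, h5] at hx
      rw [linkAt, h6] at hx'
      obtain ⟨⟨y, hy, rfl⟩, hy0⟩ := hx
      obtain ⟨⟨y', hy', rfl⟩, hy0'⟩ := hx'
      have h7 := h3 y hy hy0
      have h8 := h4 y' hy' hy0'
      rw [neg_apply, innerSL_apply_apply] at h7
      rw [innerSL_apply_apply] at h8
      rw [inner_add_right, inner_smul_right, inner_add_right, inner_smul_right]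
      have := mul_lt_mul_of_pos_left (show inner ℝ q y < inner ℝ q y' by linarith)
        (pow_pos hε g.k)
      linarith
    · exact Eventually.of_forall fun ε hn => absurd hn hlt
  filter_upwards [h.isTruncated hP hab, hsep, eventually_pos] with ε htr hsep hε hq
  refine ⟨htr, hq.mono IsTruncated.vert_subset_stageVertices,
    hq.mono htr.vert_trunc_subset_stageVertices, fun x hx x' hx' hlt => ?_⟩
  have hpos : 0 < ε ^ g.k := by positivity
  obtain ⟨v, hv, rfl⟩ := exists_of_mem_vert_place hpos.ne' hx
  obtain ⟨v', hv', rfl⟩ := exists_of_mem_vert_place hpos.ne' hx'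
  refine hsep v hv v' hv' ?_
  rw [inner_add_right, inner_smul_right, inner_add_right, inner_smul_right] at hlt
  exact lt_of_mul_lt_mul_left (by linarith) hpos.le

theorem link_radial (h : IsGerm P a b g) (hab : IsSupportFamily P a b) (hd : 0 < dim g.K)
    (hFv : Fv ∈ g.L) (hv : g.face a Fv = {v}) : ∀ᶠ ε in 𝓝[>] 0, ∀ x ∈ g.sect ε,
      x ≠ g.z ε + ε ^ g.k • v → ∃ s : ℝ, 0 < s ∧ g.z ε + ε ^ g.k • v +
        s • (x - (g.z ε + ε ^ g.k • v)) ∈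
          linkAt P (cut a b ε) (g.sect ε) (g.z ε + ε ^ g.k • v) := by
  filter_upwards [h.linkAt_eq hFv hv hab hd, eventually_pos] with ε h1 hε
  rintro _ ⟨y, hy, rfl⟩ hne
  have hyv : y ≠ v := fun he => hne (by rw [he])
  have hpos : 0 < g.β Fv - inner ℝ (a Fv) y := sub_pos.2 (h.inner_lt_of_ne hFv hv y hy hyv)
  refine ⟨ε ^ g.m * (g.β Fv - inner ℝ (a Fv) y)⁻¹, by positivity, ?_⟩
  have h2 : (g.β Fv - inner ℝ (a Fv) y)⁻¹ • (y - v) ∈ (g.link a Fv v).K := ⟨y, hy, hyv, rfl⟩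
  have h3 := mem_place (z := (g.link a Fv v).z ε) (r := ε ^ (g.link a Fv v).k) h2
  rw [Germ.link_point, smul_add, ← add_assoc] at h3
  rw [h1, add_sub_add_left_eq_sub, ← smul_sub, smul_comm, mul_smul]
  exact h3

theorem inner_link_point {q : E} :
    inner ℝ q ((g.link a Fv v).z ε + ε ^ (g.link a Fv v).k • y) =
      inner ℝ q (g.z ε + ε ^ g.k • v) + ε ^ (g.k + g.m) * inner ℝ q y := by
  rw [inner_add_right, inner_smul_right]
  rfl

/-- In the coordinates of the vertex figure the height of `v` becomes the level 0, whatever ε is.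
The hypothesis is therefore a condition on a fixed face, and `eventually_lt` gives a single bound on
ε. -/
theorem link_side_pos [FiniteDimensional ℝ E] (h : IsGerm P a b g) (hP : IsPolytope P)
    (hab : IsSupportFamily P a b) (hd : 0 < dim g.K) (q : E) (hFv : Fv ∈ g.L)
    (hv : g.face a Fv = {v}) : ∀ᶠ ε in 𝓝[>] 0, ∀ F ∈ (g.link a Fv v).L,
      (∀ x ∈ F ∩ (g.link a Fv v).sect ε, inner ℝ q (g.z ε + ε ^ g.k • v) < inner ℝ q x) →
      ∀ x ∈ (g.link a Fv v).sect ε, cut a b ε F x = 0 →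
        inner ℝ q (g.z ε + ε ^ g.k • v) < inner ℝ q x := by
  have hl := h.link hFv hv hP hab hd
  have hkey : ∀ᶠ ε in 𝓝[>] 0, ∀ F ∈ (g.link a Fv v).L,
      (∀ y ∈ (g.link a Fv v).face a F, 0 < inner ℝ q y) → ∀ y ∈ (g.link a Fv v).K,
      cut a b ε F ((g.link a Fv v).z ε + ε ^ (g.link a Fv v).k • y) = 0 → 0 < inner ℝ q y := by
    refine (eventually_all_finite (hl.finite hP)).2 fun F hF => ?_
    by_cases hc : ∀ y ∈ (g.link a Fv v).face a F, 0 < inner ℝ q y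
    · filter_upwards [hl.eventually_lt hF (innerSL ℝ q) (μ := 0) hc] with ε hε _
      exact hε
    · exact Eventually.of_forall fun ε hn => absurd hn hc
  filter_upwards [hkey, hl.inter_sect hab, eventually_pos] with ε h1 h2 hε F hF hside
  have hpos : 0 < ε ^ (g.k + g.m) := by positivity
  rintro _ ⟨y, hy, rfl⟩ h0
  have h3 := h1 F hF (fun y' hy' => by
    have h4 : (g.link a Fv v).z ε + ε ^ (g.link a Fv v).k • y' ∈ F ∩ (g.link a Fv v).sect ε := by
      rw [h2 F hF]
      exact mem_place hy'
    have h5 := hside _ h4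
    rw [inner_link_point] at h5
    exact pos_of_mul_pos_right (by linarith) hpos.le) y hy h0
  change _ < inner ℝ q ((g.link a Fv v).z ε + ε ^ (g.link a Fv v).k • y)
  rw [inner_link_point]
  have := mul_pos hpos h3
  linarith

theorem isLink [FiniteDimensional ℝ E] (h : IsGerm P a b g) (hP : IsPolytope P)
    (hab : IsSupportFamily P a b) (hd : 0 < dim g.K) (q : E) : ∀ᶠ ε in 𝓝[>] 0,
      Set.InjOn (fun x => inner ℝ q x) (stageVertices P (cut a b ε) (g.sect ε)) →
      (∀ v ∈ vert (g.sect ε), Set.InjOn (fun x => inner ℝ q x)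
        (stageVertices P (cut a b ε) (linkAt P (cut a b ε) (g.sect ε) v))) →
      ∀ v ∈ vert (g.sect ε), IsLink P (cut a b ε) (g.sect ε) g.L q v := by
  suffices hs : ∀ᶠ ε in 𝓝[>] 0, ∀ v ∈ vert g.K,
      Set.InjOn (fun x => inner ℝ q x) (stageVertices P (cut a b ε) (g.sect ε)) →
      Set.InjOn (fun x => inner ℝ q x)
        (stageVertices P (cut a b ε) (linkAt P (cut a b ε) (g.sect ε) (g.z ε + ε ^ g.k • v))) →
      IsLink P (cut a b ε) (g.sect ε) g.L q (g.z ε + ε ^ g.k • v) by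
    filter_upwards [hs, eventually_pos] with ε h1 hε h2 h3 x hx
    obtain ⟨v, hv, rfl⟩ := exists_of_mem_vert_place (pow_pos hε g.k).ne' hx
    exact h1 v hv h2 (h3 _ hx)
  refine (eventually_all_finite h.poly.finite_vert).2 fun v hv => ?_
  obtain ⟨Fv, hFv, hface⟩ := h.exists_face_vertex hd hv
  have hl := h.link hFv hface hP hab hd
  filter_upwards [h.isTruncated hP hab, hl.isTruncated hP hab, hl.isSwept hP hab q,
    h.linkAt_eq hFv hface hab hd, h.linkFaces_eq hFv hface hab, h.link_radial hab hd hFv hface,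
    h.link_side_pos hP hab hd q hFv hface, h.link_side_pos hP hab hd (-q) hFv hface,
    h.inter_sect hab, hl.inter_sect hab, hl.out, eventually_pos]
    with ε htr htrl hsw hlink hfaces hrad hpos hneg hint hintl hout hε hq hql
  have hk : ε ^ g.k ≠ 0 := by positivity
  have hk' : ε ^ (g.link a Fv v).k ≠ 0 := by positivity
  have hvert : g.z ε + ε ^ g.k • v ∈ vert (g.sect ε) := (mem_vert_place_iff hk).2 hv
  have hdim : dim (g.sect ε) = dim g.K := dim_place hk
  have hd' : 0 < dim (g.sect ε) := by omega
  have htl : IsTruncated P (cut a b ε) (linkAt P (cut a b ε) (g.sect ε) (g.z ε + ε ^ g.k • v))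
      (linkFaces P g.L (g.z ε + ε ^ g.k • v)) := by
    rw [hlink, hfaces]
    exact htrl
  -- The face of `P` at a vertex `u` never strictly contains the one at `v`, so it is not a face of
  -- the link and its truncating function is nonnegative there.
  have hout' : ∀ u ∈ vert (g.sect ε),
      ∀ x ∈ linkAt P (cut a b ε) (g.sect ε) (g.z ε + ε ^ g.k • v),
        0 ≤ cut a b ε (faceHull P {u}) x := by
    intro u hu x hx
    obtain ⟨huL, hui⟩ := htr.faceHull_mem hd' hu
    obtain ⟨hvL, hvi⟩ := htr.faceHull_mem hd' hvert
    rw [hlink] at hx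
    refine hout _ (h.proper _ huL).1 (h.proper _ huL).2 ?_ x hx
    rw [← hfaces]
    rintro ⟨-, hs⟩
    have h1 := hvi.ge (Set.mem_singleton _)
    have h2 : g.z ε + ε ^ g.k • v = u := hui.le ⟨hs.1 h1.1, h1.2⟩
    rw [h2] at hs
    exact hs.2 subset_rfl
  constructor
  · rw [hlink, hfaces]
    rw [hlink] at hql
    exact hsw hql
  · rw [hlink, hdim]
    exact (congrArg (· + 1) (dim_place hk')).trans (h.dim_link hFv hface hd)
  · rw [hlink, hfaces]
    intro F hF
    rw [hintl F hF, hint F hF.1, dim_place hk', dim_place hk]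
    exact h.dim_link_face hFv hface hab hF
  · rw [hlink, hfaces]
    exact hpos
  · rw [hlink, hfaces]
    simpa only [inner_neg_left, neg_lt_neg_iff] using hneg
  · exact fun w hw => htr.inner_ne_of_mem_vert_linkAt htl hd' hvert hout' hrad hq hw
  · exact hrad

end IsGerm

end Sweep

namespace Sweep

open Filter Topology

variable {E : Type*} [NormedAddCommGroup E] [InnerProductSpace ℝ E]

namespace IsGerm

variable {P : Set E} {a : Set E → E} {b : Set E → ℝ} {g : Germ E} {F F' Fv : Set E} {y v q : E}
  {ε : ℝ} {dir : List (Set E) → E} {p : E} {π : List (Set E)} {n : ℕ}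

theorem inner_lt_link_point_iff (hε : 0 < ε) : inner ℝ q (g.z ε + ε ^ g.k • v) <
    inner ℝ q ((g.link a Fv v).z ε + ε ^ (g.link a Fv v).k • y) ↔ 0 < inner ℝ q y := by
  have : 0 < ε ^ (g.k + g.m) := by positivity
  rw [inner_link_point, lt_add_iff_pos_right, mul_pos_iff_of_pos_left this]

theorem link_point_lt_inner_iff (hε : 0 < ε) :
    inner ℝ q ((g.link a Fv v).z ε + ε ^ (g.link a Fv v).k • y) <
      inner ℝ q (g.z ε + ε ^ g.k • v) ↔ inner ℝ q y < 0 := by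
  have : 0 < ε ^ (g.k + g.m) := by positivity
  rw [inner_link_point, add_lt_iff_neg_left, ← neg_pos, ← mul_neg,
    mul_pos_iff_of_pos_left this, neg_pos]

theorem link_point_eq_inner_iff (hε : 0 < ε) :
    inner ℝ q ((g.link a Fv v).z ε + ε ^ (g.link a Fv v).k • y) =
      inner ℝ q (g.z ε + ε ^ g.k • v) ↔ inner ℝ q y = 0 := by
  have : ε ^ (g.k + g.m) ≠ 0 := by positivity
  rw [inner_link_point, add_eq_left, mul_eq_zero, or_iff_right this]

theorem exists_place_iff {z : E} {r : ℝ} {S : Set E} {p : E → Prop} :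
    (∃ x ∈ place z r S, p x) ↔ ∃ y ∈ S, p (z + r • y) := Set.exists_mem_image

theorem isCrossing_iff (hε : 0 < ε) (hlink : linkAt P (cut a b ε) (g.sect ε)
      (g.z ε + ε ^ g.k • v) = (g.link a Fv v).sect ε) :
    IsCrossing P (cut a b ε) (g.sect ε) q (g.z ε + ε ^ g.k • v) ↔
      (∃ y ∈ (g.link a Fv v).K, 0 < inner ℝ q y) ∧ ∃ y ∈ (g.link a Fv v).K, inner ℝ q y < 0 := by
  rw [IsCrossing, hlink, Germ.sect, exists_place_iff, exists_place_iff]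
  simp only [inner_lt_link_point_iff hε, link_point_lt_inner_iff hε]

theorem sliceAt_eq (hε : 0 < ε) (hlink : linkAt P (cut a b ε) (g.sect ε)
      (g.z ε + ε ^ g.k • v) = (g.link a Fv v).sect ε) :
    sliceAt P (cut a b ε) (g.sect ε) q (g.z ε + ε ^ g.k • v) =
      ((g.link a Fv v).slice a q).sect ε := by
  rw [sliceAt, hlink]
  ext x
  constructor
  · rintro ⟨⟨y, hy, rfl⟩, hx⟩
    exact mem_place (S := ((g.link a Fv v).slice a q).K)
      ⟨hy, (link_point_eq_inner_iff (a := a) (Fv := Fv) hε).1 hx⟩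
  · rintro ⟨y, ⟨hy, hyq⟩, rfl⟩
    exact ⟨mem_place hy, (link_point_eq_inner_iff (a := a) (Fv := Fv) hε).2 hyq⟩

theorem sliceFaces_eq (hε : 0 < ε) (hlink : linkAt P (cut a b ε) (g.sect ε)
      (g.z ε + ε ^ g.k • v) = (g.link a Fv v).sect ε)
    (hfaces : linkFaces P g.L (g.z ε + ε ^ g.k • v) = (g.link a Fv v).L)
    (hint : ∀ F ∈ (g.link a Fv v).L, F ∩ (g.link a Fv v).sect ε =
      place ((g.link a Fv v).z ε) (ε ^ (g.link a Fv v).k) ((g.link a Fv v).face a F)) :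
    sliceFaces P (cut a b ε) (g.sect ε) g.L q (g.z ε + ε ^ g.k • v) =
      ((g.link a Fv v).slice a q).L := by
  rw [sliceFaces, hlink, hfaces]
  ext F
  refine and_congr_right fun hF => ?_
  rw [hint F hF, exists_place_iff, exists_place_iff]
  simp only [inner_lt_link_point_iff hε, link_point_lt_inner_iff hε]

/-- The case distinction concerns the fixed vertex figure and not ε, so it can precede the choice of
ε. If it fails, then for small ε a crossing would contradict `IsLink.vert_ne`. -/
theorem isPartitioned_slice [FiniteDimensional ℝ E] (h : IsGerm P a b g) (hP : IsPolytope P)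
    (hab : IsSupportFamily P a b) (hd : 0 < dim g.K) (hn : dim g.K = n) (hFv : Fv ∈ g.L)
    (hv : g.face a Fv = {v}) (q : E) (π : List (Set E))
    (ih : ∀ g : Germ E, IsGerm P a b g → dim g.K = n - 2 → ∀ π q, ∀ᶠ ε in 𝓝[>] 0,
      IsGeneric P (cut a b ε) dir p → Occurs P (cut a b ε) dir p (g.sect ε) π q →
      IsPartitioned P (cut a b ε) dir (n - 2) (g.sect ε) π q) : ∀ᶠ ε in 𝓝[>] 0,
      IsGeneric P (cut a b ε) dir p → Occurs P (cut a b ε) dir p (g.sect ε) π q →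
      IsLink P (cut a b ε) (g.sect ε) g.L q (g.z ε + ε ^ g.k • v) →
      IsCrossing P (cut a b ε) (g.sect ε) q (g.z ε + ε ^ g.k • v) →
      IsTruncated P (cut a b ε) (sliceAt P (cut a b ε) (g.sect ε) q (g.z ε + ε ^ g.k • v))
        (sliceFaces P (cut a b ε) (g.sect ε) g.L q (g.z ε + ε ^ g.k • v)) ∧
      IsPartitioned P (cut a b ε) dir (n - 2)
        (sliceAt P (cut a b ε) (g.sect ε) q (g.z ε + ε ^ g.k • v)) (Fv :: π) (dir (Fv :: π)) := by
  have hl := h.link hFv hv hP hab hd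
  by_cases hc : (∀ w ∈ vert (g.link a Fv v).K, inner ℝ q w ≠ 0) ∧
      (∃ y ∈ (g.link a Fv v).K, 0 < inner ℝ q y) ∧ ∃ y ∈ (g.link a Fv v).K, inner ℝ q y < 0
  · have hs := hl.slice hP hab hc.1 hc.2.1 hc.2.2
    have h1 := dim_section (l := innerSL ℝ q) hl.poly hc.2.1 hc.2.2
    have h2 := h.dim_link hFv hv hd
    have h3 : dim ((g.link a Fv v).slice a q).K = n - 2 := by
      change dim {y ∈ (g.link a Fv v).K | inner ℝ q y = 0} = n - 2
      simp only [innerSL_apply_apply] at h1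
      omega
    filter_upwards [eventually_pos, h.linkAt_eq hFv hv hab hd, h.linkFaces_eq hFv hv hab,
      hl.inter_sect hab, hs.isTruncated hP hab, ih _ hs h3 (Fv :: π) (dir (Fv :: π)),
      h.faceHull_vertex hab hFv hv] with ε hε hlink hfaces hint htr hpart hhull hgen hocc _ _
    have hvert : g.z ε + ε ^ g.k • v ∈ vert (g.sect ε) :=
      (mem_vert_place_iff (pow_pos hε g.k).ne').2 (show IsFace g.K {v} from hv ▸ h.isFace hFv)
    have hocc' := Occurs.slice _ π q _ hocc hvert
    rw [sliceAt_eq hε hlink, hhull] at hocc'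
    rw [sliceAt_eq hε hlink, sliceFaces_eq hε hlink hfaces hint]
    exact ⟨htr, hpart hgen hocc'⟩
  · filter_upwards [eventually_pos, h.linkAt_eq hFv hv hab hd] with ε hε hlink _ _ hL hcr
    refine absurd ⟨fun w hw h0 => ?_, (isCrossing_iff hε hlink).1 hcr⟩ hc
    refine hL.vert_ne ((g.link a Fv v).z ε + ε ^ (g.link a Fv v).k • w) ?_
      ((link_point_eq_inner_iff hε).2 h0)
    rw [hlink]
    exact (mem_vert_place_iff (pow_pos hε _).ne').2 hw

/-- The induction runs over germs instead of individual polytopes. Each germ has finitely many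
vertices, and the record and sweeping vector of each link and slice do not depend on ε, so only
finitely many bounds on ε are combined. Links lower the dimension by one and slices by two, which
calls for strong induction. -/
theorem isPartitioned [FiniteDimensional ℝ E] (hP : IsPolytope P) (hab : IsSupportFamily P a b)
    (dir : List (Set E) → E) (p : E) (n : ℕ) :
    ∀ g : Germ E, IsGerm P a b g → dim g.K = n → ∀ π q, ∀ᶠ ε in 𝓝[>] 0,
      IsGeneric P (cut a b ε) dir p → Occurs P (cut a b ε) dir p (g.sect ε) π q →
      IsPartitioned P (cut a b ε) dir n (g.sect ε) π q := by
  induction n using Nat.strong_induction_on with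
  | _ n ih =>
  intro g h hn π q
  rcases Nat.eq_zero_or_pos n with rfl | hpos
  · filter_upwards [h.isTruncated hP hab, eventually_pos] with ε htr hε _ _
    exact isPartitioned_zero htr ((dim_place (pow_pos hε g.k).ne').trans hn)
  have hd : 0 < dim g.K := by omega
  have hkey : ∀ᶠ ε in 𝓝[>] 0, ∀ v ∈ vert g.K, IsGeneric P (cut a b ε) dir p →
      Occurs P (cut a b ε) dir p (g.sect ε) π q →
      IsLink P (cut a b ε) (g.sect ε) g.L q (g.z ε + ε ^ g.k • v) →
      (1 < n → ∀ w ∈ vert (linkAt P (cut a b ε) (g.sect ε) (g.z ε + ε ^ g.k • v)),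
        IsLink P (cut a b ε) (linkAt P (cut a b ε) (g.sect ε) (g.z ε + ε ^ g.k • v))
          (linkFaces P g.L (g.z ε + ε ^ g.k • v)) q w) ∧
      IsPartitioned P (cut a b ε) dir (n - 1)
        (linkAt P (cut a b ε) (g.sect ε) (g.z ε + ε ^ g.k • v))
        (faceHull P {g.z ε + ε ^ g.k • v} :: π) q ∧
      (IsCrossing P (cut a b ε) (g.sect ε) q (g.z ε + ε ^ g.k • v) →
        IsTruncated P (cut a b ε) (sliceAt P (cut a b ε) (g.sect ε) q (g.z ε + ε ^ g.k • v))
          (sliceFaces P (cut a b ε) (g.sect ε) g.L q (g.z ε + ε ^ g.k • v)) ∧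
        IsPartitioned P (cut a b ε) dir (n - 2)
          (sliceAt P (cut a b ε) (g.sect ε) q (g.z ε + ε ^ g.k • v))
          (faceHull P {g.z ε + ε ^ g.k • v} :: π)
          (dir (faceHull P {g.z ε + ε ^ g.k • v} :: π))) := by
    refine (eventually_all_finite h.poly.finite_vert).2 fun v hv => ?_
    obtain ⟨Fv, hFv, hface⟩ := h.exists_face_vertex hd hv
    have hl := h.link hFv hface hP hab hd
    have hdl := h.dim_link hFv hface hd
    have hll : ∀ᶠ ε in 𝓝[>] 0, 1 < n → Set.InjOn (fun x => inner ℝ q x)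
          (stageVertices P (cut a b ε) ((g.link a Fv v).sect ε)) →
        (∀ w ∈ vert ((g.link a Fv v).sect ε), Set.InjOn (fun x => inner ℝ q x)
          (stageVertices P (cut a b ε) (linkAt P (cut a b ε) ((g.link a Fv v).sect ε) w))) →
        ∀ w ∈ vert ((g.link a Fv v).sect ε),
          IsLink P (cut a b ε) ((g.link a Fv v).sect ε) (g.link a Fv v).L q w := by
      by_cases h1 : 1 < n
      · exact (hl.isLink hP hab (by omega) q).mono fun ε hε _ => hε
      · exact Eventually.of_forall fun ε hn => absurd hn h1
    filter_upwards [hll, h.linkAt_eq hFv hface hab hd, h.linkFaces_eq hFv hface hab,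
      h.faceHull_vertex hab hFv hface, ih (n - 1) (by omega) _ hl (by omega) (Fv :: π) q,
      h.isPartitioned_slice hP hab hd hn hFv hface q π (ih (n - 2) (by omega)), eventually_pos]
      with ε hll hlink hfaces hhull hpart hslice hε hgen hocc hL
    have hvert : g.z ε + ε ^ g.k • v ∈ vert (g.sect ε) :=
      (mem_vert_place_iff (pow_pos hε g.k).ne').2 hv
    have hocc' := Occurs.link _ π q _ hocc hvert
    rw [hhull]
    rw [hlink, hhull] at hocc'
    rw [hlink, hfaces]
    exact ⟨fun h1 => hll h1 (hgen _ _ _ hocc') fun w hw =>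
      hgen _ _ _ (Occurs.link _ _ q w hocc' hw), hpart hgen hocc', hslice hgen hocc hL⟩
  filter_upwards [hkey, h.isSwept hP hab q, h.isLink hP hab hd q, eventually_pos]
    with ε hkey hsw hlink hε hgen hocc
  have hk := (pow_pos hε g.k).ne'
  have hL := hlink (hgen _ _ _ hocc) fun v hv => hgen _ _ _ (Occurs.link _ π q v hocc hv)
  refine IsStep.isPartitioned (L := g.L) ⟨hsw (hgen _ _ _ hocc), (dim_place hk).trans hn, hpos, hL,
    fun h1 x hx => ?_, fun x hx => ?_, fun x hx => ?_, fun x hx => ?_⟩ <;>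
    obtain ⟨v, hv, rfl⟩ := exists_of_mem_vert_place hk hx <;>
    obtain ⟨hll, hpart, hslice⟩ := hkey v hv hgen hocc (hL _ hx)
  · exact hll h1
  · exact fun hc => (hslice hc).1
  · exact hpart
  · exact fun hc => (hslice hc).2

end IsGerm

end Sweep

namespace Sweep

open Filter Topology

variable {E : Type*} [NormedAddCommGroup E] [InnerProductSpace ℝ E] [FiniteDimensional ℝ E]
  {P K : Set E} {c : Set E → E → ℝ} {L : Set (Set E)} {q : E} {G : Set E}

/-! ### The main theorem -/

theorem IsSwept.existsUnique_top (h : IsSwept P c K L q) (hG : IsFace (trunc P c K) G)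
    (hd : 0 < dim G) : ∃! G', IsTopFace P c K q G G' := by
  obtain ⟨C, hC, rfl⟩ := h.exists_eq_cell hG
  have h1 := h.dim_cell hC
  obtain ⟨F, -, -, -, -, hF, -⟩ := h.exists_isTopFace hC (by omega) q
  exact ⟨_, hF, fun G' hG' => h.isTopFace_unique hG hG' hF⟩

theorem IsSwept.existsUnique_bottom (h : IsSwept P c K L q) (hG : IsFace (trunc P c K) G)
    (hd : 0 < dim G) : ∃! G', IsBottomFace P c K q G G' := by
  simpa only [isBottomFace_iff] using h.neg.existsUnique_top hG hd

/-- If a level of the sweep avoids `T(Q_v)` and lies below `v`, then it lies below all blocks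
contributed by `v`. -/
theorem IsPartitioned.lt_of_mem_blocksAt {dir : List (Set E) → E} {π : List (Set E)}
    (hp : IsPartitioned P c dir (dim K) K π q) (h : IsSwept P c K L q) (hd : 0 < dim K)
    (hl : ∀ v ∈ vert K, IsLink P c K L q v) {v : E} (hv : v ∈ vert K) {t : ℝ}
    (hvt : t < inner ℝ q v) (ht : ∀ x ∈ trunc P c (linkAt P c K v), inner ℝ q x ≠ t)
    {B : Set (Set E)} (hB : B ∈ blocksAt P c dir (dim K) K π q v) (hG : G ∈ B) :
    ∀ x ∈ G, t < inner ℝ q x := by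
  obtain ⟨G₀, N, hG₀, h0, hGG₀, hN, hNv, hlt⟩ := hp.bottom hd v hv B hB G hG
  refine lt_of_mem_preBlock h hd hl hG₀ h0 hGG₀ hN hv hNv fun x hx => ?_
  obtain ⟨y, hy⟩ := hN.1.2
  have hyT : y ∈ trunc P c (linkAt P c K v) := ⟨hNv hy, (hN.1.subset hy).2⟩
  -- T(Q_v) is convex and contains the points of `N`, which are above `t`. A point at or below `t`
  -- would force T(Q_v) to meet the level `t`.
  by_contra hc
  obtain ⟨z, hz, hzt⟩ := exists_inner_eq (hl v hv).swept.convex_trunc hx hyT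
    (lt_of_le_of_ne (not_lt.1 hc) (ht x hx)) (hvt.trans (hlt y hy))
  exact ht z hz hzt

theorem eventually_isPartitioned {a : Set E → E} {b : Set E → ℝ} (hP : IsPolytope P)
    (hab : IsSupportFamily P a b) (dir : List (Set E) → E) (p : E) : ∀ᶠ ε in 𝓝[>] 0,
      IsGeneric P (cut a b ε) dir p → ∃ L, IsSwept P (cut a b ε) P L p ∧
        IsPartitioned P (cut a b ε) dir (dim P) P [] p ∧
        (0 < dim P → ∀ v ∈ vert P, IsLink P (cut a b ε) P L p v) := by
  have hg := isGerm_baseGerm hP hab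
  have hlink : ∀ᶠ ε in 𝓝[>] 0, 0 < dim P → IsGeneric P (cut a b ε) dir p →
      ∀ v ∈ vert P, IsLink P (cut a b ε) P (baseGerm P b).L p v := by
    by_cases hd : 0 < dim P
    · filter_upwards [hg.isLink hP hab hd p] with ε hε _ hgen
      rw [sect_baseGerm] at hε
      exact hε (hgen _ _ _ .base) fun v hv => hgen _ _ _ (.link _ _ _ v .base hv)
    · exact Eventually.of_forall fun ε hn => absurd hn hd
  filter_upwards [hg.isSwept hP hab p, IsGerm.isPartitioned hP hab dir p _ _ hg rfl [] p, hlink]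
    with ε hsw hpart hlink hgen
  rw [sect_baseGerm] at hsw hpart
  exact ⟨_, hsw (hgen _ _ _ .base), hpart hgen .base, fun hd => hlink hd hgen⟩

end Sweep

theorem theorem3p1 {E : Type*} [NormedAddCommGroup E] [InnerProductSpace ℝ E]
    [FiniteDimensional ℝ E] (P : Set E) (hP : Sweep.IsPolytope P)
    (a : Set E → E) (b : Set E → ℝ) (hab : Sweep.IsSupportFamily P a b)
    (p : E) (dir : List (Set E) → E) :
    ∃ ε₀ : ℝ, 0 < ε₀ ∧ ∀ ε : ℝ, 0 < ε → ε < ε₀ →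
      ∀ c : Set E → E → ℝ, c = Sweep.cut a b ε → Sweep.IsGeneric P c dir p →
        -- top and bottom faces are well defined
        (∀ G, Sweep.IsFace (Sweep.trunc P c P) G → 0 < Sweep.dim G →
          (∃! G', Sweep.IsTopFace P c P p G G') ∧ (∃! G', Sweep.IsBottomFace P c P p G G')) ∧
        -- the blocks form a partition of the nonempty faces of the complete truncation
        (∀ B ∈ Sweep.blockFamily P c dir p,
          B.Nonempty ∧ ∀ G ∈ B, Sweep.IsFace (Sweep.trunc P c P) G) ∧
        (∀ G, Sweep.IsFace (Sweep.trunc P c P) G →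
          ∃! B, B ∈ Sweep.blockFamily P c dir p ∧ G ∈ B) ∧
        -- P1: each block is contributed by exactly one vertex
        (∀ v ∈ Sweep.vert P, ∀ v' ∈ Sweep.vert P, v ≠ v' →
          Disjoint (Sweep.blocks P c dir p v) (Sweep.blocks P c dir p v')) ∧
        -- P2
        (0 < Sweep.dim P → ∀ G, Sweep.IsFace (Sweep.trunc P c P) G →
          0 ∉ Sweep.labels P c P G →
          ∃ G', Sweep.IsTopFace P c P p G G' ∧
            ∃ B ∈ Sweep.blockFamily P c dir p, G ∈ B ∧ G' ∈ B) ∧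
        -- P3
        (0 < Sweep.dim P → ∀ t : ℝ,
          (∀ u ∈ Sweep.vert P, ∀ x ∈ Sweep.trunc P c (Sweep.linkAt P c P u), inner ℝ p x ≠ t) →
          ∀ v ∈ Sweep.vert P, t < inner ℝ p v →
            ∀ B ∈ Sweep.blocks P c dir p v, ∀ G ∈ B, ∀ x ∈ G, t < inner ℝ p x) := by
  obtain ⟨ε₀, hε₀, hsub⟩ := mem_nhdsGT_iff_exists_Ioo_subset.1
    (Sweep.eventually_isPartitioned hP hab dir p)
  refine ⟨ε₀, hε₀, fun ε hε hlt c hc hgen => ?_⟩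
  subst hc
  obtain ⟨L, hsw, hpart, hlink⟩ := hsub ⟨hε, hlt⟩ hgen
  have hmem : ∀ B, B ∈ Sweep.blockFamily P (Sweep.cut a b ε) dir p ↔
      ∃ v ∈ Sweep.vert P, B ∈ Sweep.blocks P (Sweep.cut a b ε) dir p v := fun B => by
    simp only [Sweep.blockFamily, Set.mem_iUnion, exists_prop]
  refine ⟨fun G hG hd => ⟨hsw.existsUnique_top hG hd, hsw.existsUnique_bottom hG hd⟩,
    fun B hB => ?_, fun G hG => ?_, fun v hv v' hv' hne => ?_, fun hd G hG h0 => ?_,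
    fun hd t ht v hv hvt B hB G hG => ?_⟩
  · obtain ⟨v, hv, hB⟩ := (hmem B).1 hB
    exact hpart.isFace v hv B hB
  · obtain ⟨v, hv, B, hB, hGB⟩ := hpart.cover G hG
    refine ⟨B, ⟨(hmem B).2 ⟨v, hv, hB⟩, hGB⟩, ?_⟩
    rintro B' ⟨hB', hGB'⟩
    obtain ⟨v', hv', hB'⟩ := (hmem B').1 hB'
    exact (hpart.unique v' hv' v hv B' hB' B hB G hGB' hGB).2
  · refine Set.disjoint_left.2 fun B hB hB' => hne ?_
    obtain ⟨G, hG⟩ := (hpart.isFace v hv B hB).1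
    exact (hpart.unique v hv v' hv' B hB B hB' G hG hG).1
  · obtain ⟨v, hv, B, hB, hGB⟩ := hpart.cover G hG
    obtain ⟨C, hC, rfl⟩ := hsw.exists_eq_cell hG
    obtain ⟨w, -, -, -, -, hw⟩ := hsw.exists_top hd hC h0
    exact ⟨_, hw, B, (hmem B).2 ⟨v, hv, hB⟩, hGB, hpart.top hd _ hG h0 v hv B hB hGB _ hw⟩
  · exact hpart.lt_of_mem_blocksAt hsw hd (hlink hd) hv hvt (ht v hv) hB hG
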